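/- Let $G=(V,E)$ be a finite simple graph with $n\ge 1$ vertices. A path decomposition of $G$ is a sequence of $2n$ nodes in which every vertex occurs exactly twice, first at its introduce node and later at its forget node. The bag of a node is the set of vertices introduced at or before this node and not yet forgotten at or before it, and every edge of $G$ is required to be contained in some bag. The width of a path decomposition is the largest number of vertices in a bag, minus $1$, and the path-width of $G$ is the smallest width of a path decomposition of $G$. There is an algorithm which, given (adjacency lists of) a graph $G$ together with a path decomposition of $G$ of width $O(k)$, where $k$ is the path-width of $G$ (and $k$ is not given), computes $k$ in time $2^{O(k^2)}\,n$. Precisely: there is a program for a unit-cost random access machine (with addition, truncated subtraction, comparison and indirect addressing) such that for every constant $c$ there is a constant $C$, depending only on $c$, with the following property. For every graph $G$ with $n\ge 1$ vertices and path-width $k$, given by adjacency lists, and every path decomposition of $G$ of width at most $c\,(k+1)$, the program, run on $G$ and this decomposition, outputs $k$ after at most $C\cdot 2^{Ck^2}\cdot n$ steps, and all numbers that occur during the computation are at most $C\cdot 2^{Ck^2}\cdot n$ (so words of $O(\log n+k^2)$ bits suffice). -/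

import Mathlib

/-! ### Path decompositions as introduce / forget sequences -/

namespace PathDec

/-- The bag obtained after the first `j` operations of a sequence of introduce and forget operations.
Operation `i` acts on the vertex `p i`; it introduces `p i` if `isIntro i = true` and it forgets `p i`
otherwise. -/
def bagAfter {n : ℕ} (p : Fin (2 * n) → Fin n) (isIntro : Fin (2 * n) → Bool) : ℕ → Finset (Fin n)
  | 0 => ∅
  | j + 1 =>
    if h : j < 2 * n then
      if isIntro ⟨j, h⟩ = true then insert (p ⟨j, h⟩) (bagAfter p isIntro j)
      else (bagAfter p isIntro j).erase (p ⟨j, h⟩)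
    else bagAfter p isIntro j

end PathDec

/-- A path decomposition of a graph `G` with `n` vertices, given as a sequence of `2 * n` nodes (indexed
from `0`). Node `j` introduces the vertex `p j` if `isIntro j = true` and forgets it otherwise. -/
structure PathDecomposition {n : ℕ} (G : SimpleGraph (Fin n)) where
  /-- the vertex introduced or forgotten at a node -/
  p : Fin (2 * n) → Fin n
  /-- `true` at introduce nodes, `false` at forget nodes -/
  isIntro : Fin (2 * n) → Bool
  /-- Every vertex occurs exactly twice: first at its introduce node, later at its forget node. -/
  occurs_twice : ∀ v : Fin n, ∃ i j : Fin (2 * n), i < j ∧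
    p i = v ∧ isIntro i = true ∧ p j = v ∧ isIntro j = false ∧ ∀ l, p l = v → l = i ∨ l = j
  /-- Every edge is contained in the bag of some node. -/
  edge_covered : ∀ u v : Fin n, G.Adj u v → ∃ j : Fin (2 * n),
    u ∈ PathDec.bagAfter p isIntro (j + 1) ∧ v ∈ PathDec.bagAfter p isIntro (j + 1)

namespace PathDecomposition

variable {n : ℕ} {G : SimpleGraph (Fin n)}

/-- The bag of a node, that is, the bag right after the operation of this node. -/
def bag (P : PathDecomposition G) (j : Fin (2 * n)) : Finset (Fin n) :=
  PathDec.bagAfter P.p P.isIntro (j + 1)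

/-- The width: the maximal number of vertices of a bag, minus `1`. (The maximum is at least `1` as soon
as the graph has a vertex.) -/
def width (P : PathDecomposition G) : ℕ :=
  (Finset.univ.sup fun j : Fin (2 * n) => (P.bag j).card) - 1

end PathDecomposition

/-- The path-width: the minimal width of a path decomposition. -/
noncomputable def pathWidth {n : ℕ} (G : SimpleGraph (Fin n)) : ℕ :=
  sInf {w : ℕ | ∃ P : PathDecomposition G, P.width = w}

/-! ### Random access machines with unit cost -/

namespace RAM

/-- The instructions. Register numbers, constants and jump targets are part of the program. -/
inductive Instr : Type
  /-- `r_d := c` -/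
  | const (d c : ℕ) : Instr
  /-- `r_d := r_a` -/
  | move (d a : ℕ) : Instr
  /-- `r_d := r_a + r_b` -/
  | add (d a b : ℕ) : Instr
  /-- `r_d := max (r_a - r_b) 0` -/
  | sub (d a b : ℕ) : Instr
  /-- `r_d := mem[r_a]` -/
  | load (d a : ℕ) : Instr
  /-- `mem[r_a] := r_b` -/
  | store (a b : ℕ) : Instr
  /-- continue at instruction `target` -/
  | jump (target : ℕ) : Instr
  /-- continue at instruction `target` if `r_a < r_b`, and at the next instruction otherwise -/
  | jumpLt (a b target : ℕ) : Instr

/-- A program is a finite list of instructions. The machine halts when the program counter leaves it. -/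
abbrev Program : Type := List Instr

/-- A configuration: program counter, registers (named by the program) and memory (addressed through
registers). -/
structure Config : Type where
  /-- program counter -/
  pc : ℕ
  /-- registers -/
  reg : ℕ → ℕ
  /-- memory -/
  mem : ℕ → ℕ

/-- The effect of a single instruction. -/
def Instr.exec (c : Config) : Instr → Config
  | .const d x => ⟨c.pc + 1, Function.update c.reg d x, c.mem⟩
  | .move d a => ⟨c.pc + 1, Function.update c.reg d (c.reg a), c.mem⟩
  | .add d a b => ⟨c.pc + 1, Function.update c.reg d (c.reg a + c.reg b), c.mem⟩
  | .sub d a b => ⟨c.pc + 1, Function.update c.reg d (c.reg a - c.reg b), c.mem⟩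
  | .load d a => ⟨c.pc + 1, Function.update c.reg d (c.mem (c.reg a)), c.mem⟩
  | .store a b => ⟨c.pc + 1, c.reg, Function.update c.mem (c.reg a) (c.reg b)⟩
  | .jump l => ⟨l, c.reg, c.mem⟩
  | .jumpLt a b l => ⟨if c.reg a < c.reg b then l else c.pc + 1, c.reg, c.mem⟩

/-- One step of the machine; a halted configuration does not change. -/
def step (prog : Program) (c : Config) : Config :=
  match prog[c.pc]? with
  | some ins => ins.exec c
  | none => c

/-- The initial configuration: the input occupies an initial segment of the memory, everything else
is `0`. -/
def start (input : List ℕ) : Config := ⟨0, fun _ => 0, fun i => input.getD i 0⟩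

/-- The configuration after `t` steps. -/
def run (prog : Program) (input : List ℕ) (t : ℕ) : Config := (step prog)^[t] (start input)

/-- On `input`, the program halts after at most `T` steps with `output` in register `0`, and no number
that occurs in a register or in a memory cell during the computation exceeds `T` (so words of
`O(log T)` bits suffice). -/
def ComputesWithin (prog : Program) (input : List ℕ) (output T : ℕ) : Prop :=
  ∃ t ≤ T, prog.length ≤ (run prog input t).pc ∧ (run prog input t).reg 0 = output ∧
    ∀ s ≤ t, ∀ i, (run prog input s).reg i ≤ T ∧ (run prog input s).mem i ≤ T

end RAM

/-! ### Input format -/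

/-- An adjacency list representation: for every vertex, its neighbours in some order. -/
structure AdjacencyLists {n : ℕ} (G : SimpleGraph (Fin n)) where
  /-- the list of neighbours -/
  nbrs : Fin n → List (Fin n)
  nodup : ∀ v, (nbrs v).Nodup
  mem_iff : ∀ u v, u ∈ nbrs v ↔ G.Adj v u

/-- The input words: the number `n`; then the path decomposition, as `2 * n` pairs (vertex, `1` for an
introduce node or `0` for a forget node); then `n + 1` offsets, where offset `i` is the total length
of the adjacency lists of the vertices below `i`; then the concatenated adjacency lists. -/
def inputWords {n : ℕ} {G : SimpleGraph (Fin n)} (A : AdjacencyLists G) (P : PathDecomposition G) :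
    List ℕ :=
  [n] ++
  (List.finRange (2 * n)).flatMap (fun j => [(P.p j : ℕ), if P.isIntro j = true then 1 else 0]) ++
  (List.range (n + 1)).map
    (fun i => ∑ v ∈ Finset.univ.filter (fun v : Fin n => (v : ℕ) < i), (A.nbrs v).length) ++
  (List.finRange n).flatMap (fun v => (A.nbrs v).map (fun u => (u : ℕ)))

/-! The program tests `0, 1, 2, …` as a bound for the path-width and stops at the first success, so
it runs `pathWidth G + 1` tests. A test is a dynamic programming along the given decomposition,
whose bags have at most `m ≤ c * (k + 1) + 1` vertices.

A graph has path-width at most `k` iff it has a `BagSeq`: a sequence of sets of at most `K = k + 1`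
vertices in which every vertex occupies one interval and every edge lies in some set
(`pathWidth_le_iff`). After a node of the given decomposition with bag `X`, only the vertices of `X`
can have further edges, so a bag `B` of a partial solution matters only through `B ∩ X` and
`B.card`. A sequence of such traces may also be replaced by another one if, after repetitions of
entries, the sets agree and the sizes do not grow; this is the relation `Dom PairLe`.

Up to mutual domination there are only `2 ^ O((m + K) ^ 2)` sequences of traces. The set component
changes at most `2 * m` times, because every vertex of `X` has one interval. While it is constant,
the sizes form a list of numbers up to `K`, and deleting entries that lie between two others leaves
a list whose oscillation grows and then shrinks strictly (`exists_short`; compare the typical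
sequences of Bodlaender and Kloks). Such a sequence can be written down by `O((m + K) ^ 2)`
elementary operations of a small machine with six instructions. The instruction strings form a 6-ary
tree, and the sequence belonging to a node is read off along its path to the root, so every
equivalence class has a node with number at most `N = 2 ^ (91 * (m + K + 1) ^ 2)`
(`Tree.exists_node`).

The dynamic programming marks nodes of this tree. The invariant `Good` says that marked nodes are
dominating upper bounds of real partial solutions and that every partial solution is an upper bound
of a marked node. It is preserved by introducing a vertex, adding an edge and forgetting a vertex
(`Good.intro`, `Good.edge`, `Good.forget`). Domination between two nodes is determined by the pairs
that involve their parents (`dom_path`), so one transition costs `O(N ^ 2)`. There are `2 * n` nodes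
of the decomposition, and at most `n * m` edges since every vertex has its earlier neighbours in the
bag where it is introduced (`sum_deg_le`); hence the time is linear in `n`.

The algorithm is written in a language of bounded loops, for which compilation to the random access
machine is verified once (`Cm.code_run`). Values, running times and correctness of the commands are
then treated by rules in the style of Hoare logic. -/

/-! ### A language of bounded loops -/

namespace Loop

/-- Expressions. `ite a b x y` is `x` if `a < b` and `y` otherwise. -/
inductive Ex : Type
  | lit (c : ℕ) : Ex
  | var (x : ℕ) : Ex
  | add (a b : Ex) : Ex
  | sub (a b : Ex) : Ex
  | get (A : Fin 32) (i : Ex) : Ex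
  | ite (a b x y : Ex) : Ex

/-- Commands. `rd x e` reads the input word with number `e`; `loop x e c` runs `c` for `x = 0, …, e - 1`,
where `e` is evaluated once. -/
inductive Cm : Type
  | set (x : ℕ) (e : Ex) : Cm
  | put (A : Fin 32) (i e : Ex) : Cm
  | rd (x : ℕ) (e : Ex) : Cm
  | seq (c d : Cm) : Cm
  | loop (x : ℕ) (e : Ex) (c : Cm) : Cm

infixr:60 " ;; " => Cm.seq

/-- States: variables and arrays. -/
structure St : Type where
  v : ℕ → ℕ
  a : Fin 32 → ℕ → ℕ

namespace St

def setv (σ : St) (x n : ℕ) : St := ⟨Function.update σ.v x n, σ.a⟩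

def seta (σ : St) (A : Fin 32) (i n : ℕ) : St :=
  ⟨σ.v, Function.update σ.a A (Function.update (σ.a A) i n)⟩

@[simp] lemma setv_v (σ : St) (x n y : ℕ) : (σ.setv x n).v y = if y = x then n else σ.v y := by
  simp [setv, Function.update_apply]
@[simp] lemma setv_a (σ : St) (x n : ℕ) : (σ.setv x n).a = σ.a := rfl
@[simp] lemma seta_v (σ : St) (A : Fin 32) (i n : ℕ) : (σ.seta A i n).v = σ.v := rfl
@[simp] lemma seta_a (σ : St) (A B : Fin 32) (i n j : ℕ) :
    (σ.seta A i n).a B j = if B = A ∧ j = i then n else σ.a B j := by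
  by_cases h : B = A
  · subst h; simp [seta, Function.update_apply]
  · simp [seta, h]

end St

/-- The value of an expression. -/
def Ex.ev (σ : St) : Ex → ℕ
  | .lit c => c
  | .var x => σ.v x
  | .add a b => a.ev σ + b.ev σ
  | .sub a b => a.ev σ - b.ev σ
  | .get A i => σ.a A (i.ev σ)
  | .ite a b x y => if a.ev σ < b.ev σ then x.ev σ else y.ev σ

/-- The states in the course of a loop. -/
def iter (f : ℕ → St → St) (σ : St) : ℕ → St
  | 0 => σ
  | i + 1 => f i (iter f σ i)

/-- The state after the execution of a command. -/
def Cm.ev (I : ℕ → ℕ) : Cm → St → St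
  | .set x e, σ => σ.setv x (e.ev σ)
  | .put A i e, σ => σ.seta A (i.ev σ) (e.ev σ)
  | .rd x e, σ => σ.setv x (I (e.ev σ))
  | .seq c d, σ => d.ev I (c.ev I σ)
  | .loop x e c, σ => iter (fun i τ => c.ev I (τ.setv x i)) σ (e.ev σ)

/-- The number of instructions of the code of an expression. -/
def Ex.len : Ex → ℕ
  | .lit _ => 1
  | .var _ => 1
  | .add a b => a.len + b.len + 1
  | .sub a b => a.len + b.len + 1
  | .get _ i => i.len + 9
  | .ite a b x y => a.len + b.len + x.len + y.len + 2

/-- A factor that bounds the growth of numbers during the evaluation of an expression. -/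
def Ex.wt : Ex → ℕ
  | .lit c => c + 1
  | .var _ => 1
  | .add a b => a.wt + b.wt
  | .sub a b => a.wt + b.wt
  | .get _ i => i.wt + 1
  | .ite a b x y => a.wt + b.wt + x.wt + y.wt

/-- In `put`, `9` stands for the eight instructions of `addrCode` and the store. In `loop`, `8`
stands for five instructions of initialization, test and assignment of the loop variable, and three
that increase the counter and jump back. -/
def Cm.len : Cm → ℕ
  | .set _ e => e.len + 1
  | .put _ i e => i.len + e.len + 9
  | .rd _ e => e.len + 1
  | .seq c d => c.len + d.len
  | .loop _ e c => e.len + c.len + 8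

def Cm.wt : Cm → ℕ
  | .set _ e => e.wt
  | .put _ i e => i.wt + e.wt
  | .rd _ e => e.wt
  | .seq c d => c.wt + d.wt
  | .loop _ e c => e.wt + c.wt

/-- A bound for the number of steps of the compiled command. -/
def Cm.time (I : ℕ → ℕ) : Cm → St → ℕ
  | .set _ e, _ => e.len + 1
  | .put _ i e, _ => i.len + e.len + 9
  | .rd _ e, _ => e.len + 1
  | .seq c d, σ => c.time I σ + d.time I (c.ev I σ)
  | .loop x e c, σ => e.len + 8 + ∑ i ∈ Finset.range (e.ev σ),
      (c.time I ((iter (fun i τ => c.ev I (τ.setv x i)) σ i).setv x i) + 8)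

/-- All assigned values are at most `W`, all loop bounds are at most `D`, and only input words with
numbers below `β` are read. -/
def Cm.ok (I : ℕ → ℕ) (β W D : ℕ) : Cm → St → Prop
  | .set _ e, σ => e.ev σ ≤ W
  | .put _ _ e, σ => e.ev σ ≤ W
  | .rd _ e, σ => e.ev σ < β ∧ I (e.ev σ) ≤ W
  | .seq c d, σ => c.ok I β W D σ ∧ d.ok I β W D (c.ev I σ)
  | .loop x e c, σ => e.ev σ ≤ D ∧ ∀ i < e.ev σ,
      c.ok I β W D ((iter (fun i τ => c.ev I (τ.setv x i)) σ i).setv x i)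

lemma Cm.ok_mono {I : ℕ → ℕ} {β W W' D D' : ℕ} (hW : W ≤ W') (hD : D ≤ D') (c : Cm) :
    ∀ σ, c.ok I β W D σ → c.ok I β W' D' σ := by
  induction c with
  | set x e => intro σ h; exact le_trans h hW
  | put A i e => intro σ h; exact le_trans h hW
  | rd x e => intro σ h; exact ⟨h.1, h.2.trans hW⟩
  | seq c d ihc ihd => intro σ h; exact ⟨ihc _ h.1, ihd _ h.2⟩
  | loop x e c ih => intro σ h; exact ⟨h.1.trans hD, fun i hi => ih _ (h.2 i hi)⟩

/-- Bounded states. -/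
def St.Bdd (W : ℕ) (σ : St) : Prop := (∀ x, σ.v x ≤ W) ∧ ∀ A i, σ.a A i ≤ W

lemma St.Bdd.setv {W : ℕ} {σ : St} (h : σ.Bdd W) {n : ℕ} (hn : n ≤ W) (x : ℕ) :
    (σ.setv x n).Bdd W := by
  refine ⟨fun y => ?_, h.2⟩
  rw [St.setv_v]; split_ifs
  · exact hn
  · exact h.1 y

lemma St.Bdd.seta {W : ℕ} {σ : St} (h : σ.Bdd W) {n : ℕ} (hn : n ≤ W) (A : Fin 32) (i : ℕ) :
    (σ.seta A i n).Bdd W := by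
  refine ⟨h.1, fun B j => ?_⟩
  rw [St.seta_a]; split_ifs
  · exact hn
  · exact h.2 B j

lemma Cm.bdd_ev {I : ℕ → ℕ} {β W D : ℕ} (hD : D ≤ W) (c : Cm) :
    ∀ σ, σ.Bdd W → c.ok I β W D σ → (c.ev I σ).Bdd W := by
  induction c with
  | set x e => intro σ h ho; exact h.setv ho x
  | put A i e => intro σ h ho; exact h.seta ho A _
  | rd x e => intro σ h ho; exact h.setv ho.2 x
  | seq c d ihc ihd => intro σ h ho; exact ihd _ (ihc _ h ho.1) ho.2
  | loop x e c ih =>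
    intro σ h ho
    have : ∀ i ≤ e.ev σ, (iter (fun i τ => c.ev I (τ.setv x i)) σ i).Bdd W := by
      intro i
      induction i with
      | zero => intro _; exact h
      | succ i ihi =>
        intro hi
        exact ih _ ((ihi (by omega)).setv (by have := ho.1; omega) x) (ho.2 i (by omega))
    exact this _ le_rfl

lemma iter_bdd {I : ℕ → ℕ} {β W D : ℕ} (hD : D ≤ W) {x : ℕ} {e : Ex} {c : Cm} {σ : St}
    (h : σ.Bdd W) (ho : (Cm.loop x e c).ok I β W D σ) : ∀ i ≤ e.ev σ,
    (iter (fun i τ => c.ev I (τ.setv x i)) σ i).Bdd W := by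
  intro i
  induction i with
  | zero => intro _; exact h
  | succ i ihi =>
    intro hi
    exact c.bdd_ev hD _ ((ihi (by omega)).setv (by have := ho.1; omega) x) (ho.2 i (by omega))

/-- `Cm.ok` restricts neither array indices nor intermediate values. They are controlled by this
bound, whose factor depends only on the program. -/
lemma Ex.ev_le {W : ℕ} (hW : 1 ≤ W) {σ : St} (h : σ.Bdd W) (e : Ex) : e.ev σ ≤ e.wt * W := by
  induction e with
  | lit c => simp only [Ex.ev, Ex.wt]; nlinarith
  | var x => simpa [Ex.ev, Ex.wt] using h.1 x
  | add a b iha ihb => simp only [Ex.ev, Ex.wt, add_mul]; omega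
  | sub a b iha ihb => simp only [Ex.ev, Ex.wt, add_mul]; omega
  | get A i ih => simp only [Ex.ev, Ex.wt, add_mul]; have := h.2 A (i.ev σ); omega
  | ite a b x y iha ihb ihx ihy => simp only [Ex.ev, Ex.wt, add_mul]; split_ifs <;> omega

/-- Nesting depth of loops. -/
def Cm.depth : Cm → ℕ
  | .seq c d => max c.depth d.depth
  | .loop _ _ c => c.depth + 1
  | _ => 0

/-- A crude bound that suffices for commands acting on tables, where all loops have about the same
length. The factor `2` absorbs the overhead of `8` per pass. The loops over nodes and edges of the
input need the exact sum in `Cm.time` instead. -/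
lemma Cm.time_le {I : ℕ → ℕ} {β W D : ℕ} (c : Cm) :
    ∀ σ, c.ok I β W D σ → c.time I σ ≤ 2 * c.len * (D + 1) ^ c.depth := by
  induction c with
  | set x e => intro σ _; simp [Cm.time, Cm.len, Cm.depth]
  | put A i e => intro σ _; simp [Cm.time, Cm.len, Cm.depth]
  | rd x e => intro σ _; simp [Cm.time, Cm.len, Cm.depth]
  | seq c d ihc ihd =>
    intro σ h
    have h1 := ihc _ h.1
    have h2 := ihd _ h.2
    have h3 : (D + 1) ^ c.depth ≤ (D + 1) ^ max c.depth d.depth :=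
      Nat.pow_le_pow_right (by omega) (le_max_left _ _)
    have h4 : (D + 1) ^ d.depth ≤ (D + 1) ^ max c.depth d.depth :=
      Nat.pow_le_pow_right (by omega) (le_max_right _ _)
    simp only [Cm.time, Cm.len, Cm.depth]
    nlinarith
  | loop x e c ih =>
    intro σ h
    simp only [Cm.time, Cm.len, Cm.depth]
    have h1 : ∑ i ∈ Finset.range (e.ev σ),
        (c.time I ((iter (fun i τ => c.ev I (τ.setv x i)) σ i).setv x i) + 8)
        ≤ D * (2 * c.len * (D + 1) ^ c.depth + 8) := by
      refine (Finset.sum_le_card_nsmul _ _ (2 * c.len * (D + 1) ^ c.depth + 8) ?_).trans ?_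
      · intro i hi
        exact Nat.add_le_add_right (ih _ (h.2 i (by simpa using hi))) 8
      · simp only [Finset.card_range, smul_eq_mul]; exact Nat.mul_le_mul_right _ h.1
    have h2 : 1 ≤ (D + 1) ^ c.depth := Nat.one_le_pow _ _ (by omega)
    rw [pow_succ]
    nlinarith [Nat.zero_le (e.len * D), Nat.zero_le (c.len),
      mul_le_mul_left (α := ℕ) h2 (e.len + 8), mul_le_mul_left (α := ℕ) h2 ((e.len + 8) * D)]

/-! ### Compilation -/

open RAM

/-- registers of temporaries -/
def regT (d : ℕ) : ℕ := 3 * d + 1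
/-- registers of loop counters and loop bounds; `regH 0` holds the base address -/
def regH (d : ℕ) : ℕ := 3 * d + 2
/-- registers of variables -/
def regV (x : ℕ) : ℕ := 3 * x + 3

/-- Turns the index in temporary `d` into the address of the corresponding cell of the array `A`. -/
def addrCode (A : Fin 32) (d : ℕ) : List Instr :=
  [.add (regT d) (regT d) (regT d), .add (regT d) (regT d) (regT d), .add (regT d) (regT d) (regT d),
   .add (regT d) (regT d) (regT d), .add (regT d) (regT d) (regT d), .const (regT (d + 1)) A,
   .add (regT d) (regT d) (regT (d + 1)), .add (regT d) (regT d) (regH 0)]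

/-- The second argument is the temporary that receives the value; all higher temporaries are free.
The third one is the address of the code, needed because jump targets are absolute. In `ite` the
code of `y` stands before the code of `x`. -/
def Ex.code : Ex → ℕ → ℕ → List Instr
  | .lit c, d, _ => [.const (regT d) c]
  | .var x, d, _ => [.move (regT d) (regV x)]
  | .add a b, d, p => a.code d p ++ (b.code (d + 1) (p + a.len) ++
      [.add (regT d) (regT d) (regT (d + 1))])
  | .sub a b, d, p => a.code d p ++ (b.code (d + 1) (p + a.len) ++
      [.sub (regT d) (regT d) (regT (d + 1))])
  | .get A i, d, p => i.code d p ++ (addrCode A d ++ [.load (regT d) (regT d)])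
  | .ite a b x y, d, p => a.code d p ++ (b.code (d + 1) (p + a.len) ++
      (.jumpLt (regT d) (regT (d + 1)) (p + a.len + b.len + y.len + 2) ::
      (y.code d (p + a.len + b.len + 1) ++
      (.jump (p + a.len + b.len + y.len + 2 + x.len) ::
      x.code d (p + a.len + b.len + y.len + 2)))))

/-- The second argument is the number of enclosing loops. Counter and bound of a loop live in
registers that the source language cannot name, and the counter is copied to `x` at the start of
each pass; so the body may overwrite `x` or the variables in `e` without disturbing the loop. -/
def Cm.code : Cm → ℕ → ℕ → List Instr
  | .set x e, _, p => e.code 0 p ++ [.move (regV x) (regT 0)]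
  | .put A i e, _, p => i.code 0 p ++ (addrCode A 0 ++ (e.code 1 (p + i.len + 8) ++
      [.store (regT 0) (regT 1)]))
  | .rd x e, _, p => e.code 0 p ++ [.load (regV x) (regT 0)]
  | .seq c d, h, p => c.code h p ++ d.code h (p + c.len)
  | .loop x e c, h, p => e.code 0 p ++ (.move (regH (2 * h + 2)) (regT 0) ::
      .const (regH (2 * h + 1)) 0 ::
      .jumpLt (regH (2 * h + 1)) (regH (2 * h + 2)) (p + e.len + 4) ::
      .jump (p + e.len + c.len + 8) ::
      .move (regV x) (regH (2 * h + 1)) ::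
      (c.code (h + 1) (p + e.len + 5) ++
      [.const (regT 0) 1, .add (regH (2 * h + 1)) (regH (2 * h + 1)) (regT 0),
       .jump (p + e.len + 2)]))

lemma Ex.code_length (e : Ex) : ∀ d p, (e.code d p).length = e.len := by
  induction e with
  | lit c => intros; rfl
  | var c => intros; rfl
  | add a b iha ihb => intros; simp [Ex.code, Ex.len, iha, ihb]; omega
  | sub a b iha ihb => intros; simp [Ex.code, Ex.len, iha, ihb]; omega
  | get A i ih => intros; simp [Ex.code, Ex.len, ih, addrCode]
  | ite a b x y iha ihb ihx ihy => intros; simp [Ex.code, Ex.len, iha, ihb, ihx, ihy]; omega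

lemma Cm.code_length (c : Cm) : ∀ h p, (c.code h p).length = c.len := by
  induction c with
  | set x e => intros; simp [Cm.code, Cm.len, Ex.code_length]
  | put A i e => intros; simp [Cm.code, Cm.len, Ex.code_length, addrCode]; omega
  | rd x e => intros; simp [Cm.code, Cm.len, Ex.code_length]
  | seq c d ihc ihd => intros; simp [Cm.code, Cm.len, ihc, ihd]
  | loop x e c ih => intros; simp [Cm.code, Cm.len, Ex.code_length, ih]; omega

/-- The code occurs in the program at the given position. -/
def CodeAt (prog : Program) (p : ℕ) (code : List Instr) : Prop :=
  ∀ i < code.length, prog[p + i]? = code[i]?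

lemma codeAt_append {prog : Program} {p : ℕ} {l m : List Instr} :
    CodeAt prog p (l ++ m) ↔ CodeAt prog p l ∧ CodeAt prog (p + l.length) m := by
  constructor
  · intro h
    refine ⟨fun i hi => ?_, fun i hi => ?_⟩
    · rw [h i (by simp; omega), List.getElem?_append_left hi]
    · rw [add_assoc, h _ (by simp; omega), List.getElem?_append_right (by omega)]
      simp
  · rintro ⟨h1, h2⟩ i hi
    by_cases hl : i < l.length
    · rw [h1 i hl, List.getElem?_append_left hl]
    · rw [List.getElem?_append_right (by omega), ← h2 _ (by simp at hi; omega)]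
      congr 1; omega

lemma codeAt_cons {prog : Program} {p : ℕ} {x : Instr} {m : List Instr} :
    CodeAt prog p (x :: m) ↔ prog[p]? = some x ∧ CodeAt prog (p + 1) m := by
  rw [show x :: m = [x] ++ m from rfl, codeAt_append]
  simp [CodeAt]

/-- All numbers in a configuration are at most `B`. -/
def CBdd (B : ℕ) (c : Config) : Prop := ∀ i, c.reg i ≤ B ∧ c.mem i ≤ B

/-- `t` steps lead from `c` to `c'`, and no number exceeds `B` on the way. -/
def Steps (prog : Program) (B : ℕ) (c : Config) (t : ℕ) (c' : Config) : Prop :=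
  (step prog)^[t] c = c' ∧ ∀ s ≤ t, CBdd B ((step prog)^[s] c)

lemma Steps.bdd {prog : Program} {B t : ℕ} {c c' : Config} (h : Steps prog B c t c') : CBdd B c' := by
  have := h.2 t le_rfl
  rwa [h.1] at this

lemma Steps.trans {prog : Program} {B s t : ℕ} {c c' c'' : Config} (h : Steps prog B c s c')
    (h' : Steps prog B c' t c'') : Steps prog B c (s + t) c'' := by
  refine ⟨by rw [add_comm, Function.iterate_add_apply, h.1, h'.1], fun r hr => ?_⟩
  by_cases hs : r ≤ s
  · exact h.2 r hs
  · have := h'.2 (r - s) (by omega)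
    rw [← h.1, ← Function.iterate_add_apply] at this
    rwa [show r - s + s = r by omega] at this

lemma Steps.one {prog : Program} {B : ℕ} {c : Config} {ins : Instr} (h : CBdd B c)
    (hi : prog[c.pc]? = some ins) (h' : CBdd B (ins.exec c)) : Steps prog B c 1 (ins.exec c) := by
  have : step prog c = ins.exec c := by simp [step, hi]
  refine ⟨this, fun s hs => ?_⟩
  obtain rfl | rfl : s = 0 ∨ s = 1 := by omega
  · exact h
  · simpa [this] using h'

lemma CBdd.reg {B : ℕ} {c : Config} (h : CBdd B c) {d n p : ℕ} (hn : n ≤ B) :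
    CBdd B ⟨p, Function.update c.reg d n, c.mem⟩ := by
  intro i
  refine ⟨?_, (h i).2⟩
  simp only [Function.update_apply]; split_ifs
  · exact hn
  · exact (h i).1

lemma CBdd.mem {B : ℕ} {c : Config} (h : CBdd B c) {d n p : ℕ} (hn : n ≤ B) :
    CBdd B ⟨p, c.reg, Function.update c.mem d n⟩ := by
  intro i
  refine ⟨(h i).1, ?_⟩
  simp only [Function.update_apply]; split_ifs
  · exact hn
  · exact (h i).2

end Loop

/-! ### Correctness of the compiled code -/

namespace Loop
open RAM

/-- Registers and memory represent the state. -/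
structure Match (β : ℕ) (I : ℕ → ℕ) (σ : St) (reg mem : ℕ → ℕ) : Prop where
  vars : ∀ x, reg (regV x) = σ.v x
  base : reg (regH 0) = β
  inp : ∀ i < β, mem i = I i
  arr : ∀ (A : Fin 32) i, mem (32 * i + A + β) = σ.a A i

lemma Match.congr {β : ℕ} {I : ℕ → ℕ} {σ : St} {reg reg' mem : ℕ → ℕ} (h : Match β I σ reg mem)
    (hr : ∀ r, (∀ d, r ≠ regT d) → reg' r = reg r) : Match β I σ reg' mem := by
  refine ⟨fun x => ?_, ?_, h.inp, h.arr⟩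
  · rw [hr _ (fun d => by simp only [regV, regT]; omega), h.vars]
  · rw [hr _ (fun d => by simp only [regH, regT]; omega), h.base]

lemma Match.setv {β : ℕ} {I : ℕ → ℕ} {σ : St} {reg mem : ℕ → ℕ} (h : Match β I σ reg mem)
    (x n : ℕ) : Match β I (σ.setv x n) (Function.update reg (regV x) n) mem := by
  refine ⟨fun y => ?_, ?_, h.inp, h.arr⟩
  · have : regV y = regV x ↔ y = x := by simp only [regV]; omega
    simp [Function.update_apply, this, h.vars]
  · rw [Function.update_of_ne (by simp only [regV, regH]; omega), h.base]

lemma Match.seta {β : ℕ} {I : ℕ → ℕ} {σ : St} {reg mem : ℕ → ℕ} (h : Match β I σ reg mem)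
    (A : Fin 32) (i n : ℕ) :
    Match β I (σ.seta A i n) reg (Function.update mem (32 * i + A + β) n) := by
  refine ⟨h.vars, h.base, fun j hj => ?_, fun B j => ?_⟩
  · rw [Function.update_of_ne (by omega), h.inp j hj]
  · have : 32 * j + (B : ℕ) + β = 32 * i + A + β ↔ B = A ∧ j = i := by
      rw [Fin.ext_iff]; omega
    simp only [Function.update_apply, this, St.seta_a, h.arr]

/-- The 32 arrays are stored interleaved behind the `β` input words; five doublings multiply the
index by `32`. -/
lemma addr_run {prog : Program} {B p d β : ℕ} (A : Fin 32) {reg mem : ℕ → ℕ}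
    (hc : CodeAt prog p (addrCode A d)) (hb : CBdd B ⟨p, reg, mem⟩)
    (hbase : reg (regH 0) = β) (hB : β + 32 * reg (regT d) + 32 ≤ B) :
    ∃ reg', Steps prog B ⟨p, reg, mem⟩ 8 ⟨p + 8, reg', mem⟩ ∧
      reg' (regT d) = 32 * reg (regT d) + A + β ∧
      ∀ r, (∀ d' ≥ d, r ≠ regT d') → reg' r = reg r := by
  simp only [addrCode, codeAt_cons] at hc
  obtain ⟨h1, h2, h3, h4, h5, h6, h7, h8, -⟩ := hc
  have hA := A.2
  have hne : regT d ≠ regT (d + 1) := by simp only [regT]; omega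
  have hne' : regH 0 ≠ regT (d + 1) := by simp only [regT, regH]; omega
  have hne2 : regH 0 ≠ regT d := by simp only [regT, regH]; omega
  have s1 := Steps.one (c := ⟨p, reg, mem⟩) hb h1 (hb.reg (by dsimp only; omega))
  have s2 := Steps.one s1.bdd h2 (s1.bdd.reg (by simp [Instr.exec]; omega))
  have s3 := Steps.one s2.bdd h3 (s2.bdd.reg (by simp [Instr.exec]; omega))
  have s4 := Steps.one s3.bdd h4 (s3.bdd.reg (by simp [Instr.exec]; omega))
  have s5 := Steps.one s4.bdd h5 (s4.bdd.reg (by simp [Instr.exec]; omega))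
  have s6 := Steps.one s5.bdd h6 (s5.bdd.reg (by omega))
  have s7 := Steps.one s6.bdd h7 (s6.bdd.reg (by simp [Instr.exec, hne]; omega))
  have s8 := Steps.one s7.bdd h8 (s7.bdd.reg (by
    simp [Instr.exec, hne, hne', hne2, hbase]; omega))
  refine ⟨_, ((((((s1.trans s2).trans s3).trans s4).trans s5).trans s6).trans s7).trans s8, ?_, ?_⟩
  · simp [Instr.exec, hne, hne', hne2, hbase]; omega
  · intro r hr
    have e1 := hr d le_rfl
    have e2 := hr (d + 1) (by omega)
    simp [Instr.exec, e1, e2]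

/-- The bound `B` has room for the address of an array cell with index up to `S * W` and for
literals, which are below `S`. That temporaries below `d` survive is what keeps left operands intact
while right operands are evaluated. -/
lemma Ex.code_run {prog : Program} {B β S W : ℕ} {I : ℕ → ℕ} {σ : St} {mem : ℕ → ℕ} (hW : 1 ≤ W)
    (hσ : σ.Bdd W) (hB : β + 32 * (S * W) + 32 + S ≤ B) (e : Ex) : ∀ (d p : ℕ) (reg : ℕ → ℕ),
    e.wt ≤ S → CodeAt prog p (e.code d p) → CBdd B ⟨p, reg, mem⟩ → Match β I σ reg mem →
    ∃ t ≤ e.len, ∃ reg', Steps prog B ⟨p, reg, mem⟩ t ⟨p + e.len, reg', mem⟩ ∧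
      reg' (regT d) = e.ev σ ∧ ∀ r, (∀ d' ≥ d, r ≠ regT d') → reg' r = reg r := by
  have hev : ∀ e : Ex, e.wt ≤ S → e.ev σ ≤ S * W := fun e he =>
    (Ex.ev_le hW hσ e).trans (Nat.mul_le_mul_right _ he)
  induction e with
  | lit c =>
    intro d p reg hS hc hb hm
    simp only [Ex.code, codeAt_cons, Ex.wt] at hc hS
    refine ⟨1, le_rfl, _, Steps.one hb hc.1 (hb.reg (by omega)), by simp [Ex.ev], fun r hr => ?_⟩
    simp [hr d le_rfl]
  | var x =>
    intro d p reg hS hc hb hm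
    simp only [Ex.code, codeAt_cons, Ex.wt] at hc hS
    refine ⟨1, le_rfl, _, Steps.one hb hc.1 (hb.reg ((hb _).1)), by simp [Ex.ev, hm.vars],
      fun r hr => ?_⟩
    simp [hr d le_rfl]
  | add a b iha ihb =>
    intro d p reg hS hc hb hm
    have hab := hev _ hS
    simp only [Ex.wt, Ex.ev] at hS hab
    simp only [Ex.code, codeAt_append, codeAt_cons, Ex.code_length] at hc
    obtain ⟨ha, hbc, hi, -⟩ := hc
    obtain ⟨t1, ht1, reg1, s1, v1, f1⟩ := iha d p reg (by omega) ha hb hm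
    have hm1 := hm.congr (reg' := reg1) (fun r hr => f1 r fun d' _ => hr d')
    obtain ⟨t2, ht2, reg2, s2, v2, f2⟩ := ihb (d + 1) _ reg1 (by omega) hbc s1.bdd hm1
    have e1 : reg2 (regT d) = a.ev σ := by
      rw [f2 _ (fun d' hd' => by simp only [regT]; omega), v1]
    have s3 := Steps.one s2.bdd hi (s2.bdd.reg (by dsimp only; rw [e1, v2]; omega))
    refine ⟨t1 + t2 + 1, ?_, Function.update reg2 (regT d) (reg2 (regT d) + reg2 (regT (d + 1))),
      ?_, ?_, ?_⟩
    · simp only [Ex.len]; omega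
    · convert (s1.trans s2).trans s3 using 1
      simp only [Ex.len, Instr.exec]; congr 1; omega
    · simp [e1, v2, Ex.ev]
    · intro r hr
      simp only [Function.update_apply, hr d le_rfl, if_false]
      rw [f2 r (fun d' hd' => hr d' (by omega)), f1 r hr]
  | sub a b iha ihb =>
    intro d p reg hS hc hb hm
    have hab := hev a (by simp only [Ex.wt] at hS; omega)
    simp only [Ex.wt] at hS hab
    simp only [Ex.code, codeAt_append, codeAt_cons, Ex.code_length] at hc
    obtain ⟨ha, hbc, hi, -⟩ := hc
    obtain ⟨t1, ht1, reg1, s1, v1, f1⟩ := iha d p reg (by omega) ha hb hm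
    have hm1 := hm.congr (reg' := reg1) (fun r hr => f1 r fun d' _ => hr d')
    obtain ⟨t2, ht2, reg2, s2, v2, f2⟩ := ihb (d + 1) _ reg1 (by omega) hbc s1.bdd hm1
    have e1 : reg2 (regT d) = a.ev σ := by
      rw [f2 _ (fun d' hd' => by simp only [regT]; omega), v1]
    have s3 := Steps.one s2.bdd hi (s2.bdd.reg (by dsimp only; rw [e1, v2]; omega))
    refine ⟨t1 + t2 + 1, ?_, Function.update reg2 (regT d) (reg2 (regT d) - reg2 (regT (d + 1))),
      ?_, ?_, ?_⟩
    · simp only [Ex.len]; omega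
    · convert (s1.trans s2).trans s3 using 1
      simp only [Ex.len, Instr.exec]; congr 1; omega
    · simp [e1, v2, Ex.ev]
    · intro r hr
      simp only [Function.update_apply, hr d le_rfl, if_false]
      rw [f2 r (fun d' hd' => hr d' (by omega)), f1 r hr]
  | get A i ih =>
    intro d p reg hS hc hb hm
    have hi' := hev i (by simp only [Ex.wt] at hS; omega)
    simp only [Ex.wt] at hS
    simp only [Ex.code, codeAt_append, codeAt_cons, Ex.code_length] at hc
    obtain ⟨ha, had, hl, -⟩ := hc
    obtain ⟨t1, ht1, reg1, s1, v1, f1⟩ := ih d p reg (by omega) ha hb hm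
    have hm1 := hm.congr (reg' := reg1) (fun r hr => f1 r fun d' _ => hr d')
    obtain ⟨reg2, s2, v2, f2⟩ := addr_run A had s1.bdd hm1.base (by rw [v1]; omega)
    have s3 := Steps.one s2.bdd hl (s2.bdd.reg ((s2.bdd _).2))
    refine ⟨_, ?_, _, (s1.trans s2).trans s3, ?_, ?_⟩
    · simp only [Ex.len]; omega
    · simp [v2, v1, Ex.ev, hm.arr]
    · intro r hr
      simp only [Function.update_apply, hr d le_rfl, if_false]
      rw [f2 r hr, f1 r hr]
  | ite a b x y iha ihb ihx ihy =>
    intro d p reg hS hc hb hm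
    simp only [Ex.wt] at hS
    simp only [Ex.code, codeAt_append, codeAt_cons, Ex.code_length] at hc
    obtain ⟨ha, hbc, hi, hy, hj, hx⟩ := hc
    obtain ⟨t1, ht1, reg1, s1, v1, f1⟩ := iha d p reg (by omega) ha hb hm
    have hm1 := hm.congr (reg' := reg1) (fun r hr => f1 r fun d' _ => hr d')
    obtain ⟨t2, ht2, reg2, s2, v2, f2⟩ := ihb (d + 1) _ reg1 (by omega) hbc s1.bdd hm1
    have hm2 := hm1.congr (reg' := reg2) (fun r hr => f2 r fun d' _ => hr d')
    have e1 : reg2 (regT d) = a.ev σ := by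
      rw [f2 _ (fun d' hd' => by simp only [regT]; omega), v1]
    have s3 := Steps.one s2.bdd hi (fun i => s2.bdd i)
    simp only [Instr.exec, e1, v2] at s3
    by_cases hlt : a.ev σ < b.ev σ
    · rw [if_pos hlt] at s3
      have hx' : CodeAt prog (p + a.len + b.len + y.len + 2) (x.code d (p + a.len + b.len + y.len + 2)) := by
        convert hx using 1; omega
      obtain ⟨t4, ht4, reg4, s4, v4, f4⟩ := ihx d _ reg2 (by omega) hx' s3.bdd hm2
      refine ⟨t1 + t2 + 1 + t4, ?_, reg4, ?_, ?_, ?_⟩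
      rotate_left
      · convert ((s1.trans s2).trans s3).trans s4 using 2
        simp only [Ex.len]; omega
      · simp [v4, Ex.ev, hlt]
      · intro r hr
        rw [f4 r hr, f2 r (fun d' hd' => hr d' (by omega)), f1 r hr]
      · simp only [Ex.len]; omega
    · rw [if_neg hlt] at s3
      obtain ⟨t4, ht4, reg4, s4, v4, f4⟩ := ihy d _ reg2 (by omega) hy s3.bdd hm2
      have s5 := Steps.one s4.bdd (ins := .jump (p + a.len + b.len + y.len + 2 + x.len))
        (by convert hj using 2) (by exact fun i => s4.bdd i)
      refine ⟨t1 + t2 + 1 + t4 + 1, ?_, reg4, ?_, ?_, ?_⟩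
      rotate_left
      · convert (((s1.trans s2).trans s3).trans s4).trans s5 using 1
        simp only [Ex.len, Instr.exec]; congr 1; omega
      · simp [v4, Ex.ev, hlt]
      · intro r hr
        rw [f4 r hr, f2 r (fun d' hd' => hr d' (by omega)), f1 r hr]
      · simp only [Ex.len]; omega

/-- The compiled command leads from a representation of `σ` to a representation of `c.ev I σ`. -/
theorem Cm.code_run {prog : Program} {B β S W D : ℕ} {I : ℕ → ℕ} (hW : 1 ≤ W) (hD : D ≤ W)
    (hB : β + 32 * (S * W) + 32 + S + W + 1 ≤ B) (c : Cm) : ∀ (h p : ℕ) (σ : St) (reg mem : ℕ → ℕ),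
    c.wt ≤ S → CodeAt prog p (c.code h p) → CBdd B ⟨p, reg, mem⟩ → σ.Bdd W → c.ok I β W D σ →
    Match β I σ reg mem →
    ∃ t ≤ c.time I σ, ∃ reg' mem', Steps prog B ⟨p, reg, mem⟩ t ⟨p + c.len, reg', mem'⟩ ∧
      Match β I (c.ev I σ) reg' mem' ∧ ∀ d ≤ 2 * h, reg' (regH d) = reg (regH d) := by
  induction c with
  | set x e =>
    intro h p σ reg mem hS hc hb hσ ho hm
    simp only [Cm.code, codeAt_append, codeAt_cons, Ex.code_length] at hc
    obtain ⟨he, hi, -⟩ := hc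
    obtain ⟨t1, ht1, reg1, s1, v1, f1⟩ :=
      Ex.code_run (S := S) hW hσ (by omega) e 0 p reg hS he hb hm
    have hm1 := hm.congr (reg' := reg1) (fun r hr => f1 r fun d' _ => hr d')
    have s2 := Steps.one s1.bdd hi (s1.bdd.reg ((s1.bdd _).1))
    refine ⟨_, ?_, _, _, s1.trans s2, ?_, ?_⟩
    · simp only [Cm.time]; omega
    · simp only [v1]; exact hm1.setv x _
    · intro d _
      dsimp only
      rw [Function.update_of_ne (by simp only [regV, regH]; omega),
        f1 _ (fun d' _ => by simp only [regT, regH]; omega)]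
  | rd x e =>
    intro h p σ reg mem hS hc hb hσ ho hm
    simp only [Cm.code, codeAt_append, codeAt_cons, Ex.code_length] at hc
    obtain ⟨he, hi, -⟩ := hc
    obtain ⟨t1, ht1, reg1, s1, v1, f1⟩ :=
      Ex.code_run (S := S) hW hσ (by omega) e 0 p reg hS he hb hm
    have hm1 := hm.congr (reg' := reg1) (fun r hr => f1 r fun d' _ => hr d')
    have s2 := Steps.one s1.bdd hi (s1.bdd.reg ((s1.bdd _).2))
    refine ⟨_, ?_, _, _, s1.trans s2, ?_, ?_⟩
    · simp only [Cm.time]; omega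
    · simp only [v1]; rw [hm.inp _ ho.1]; exact hm1.setv x _
    · intro d _
      dsimp only
      rw [Function.update_of_ne (by simp only [regV, regH]; omega),
        f1 _ (fun d' _ => by simp only [regT, regH]; omega)]
  | put A i e =>
    intro h p σ reg mem hS hc hb hσ ho hm
    simp only [Cm.code, codeAt_append, codeAt_cons, Ex.code_length, Cm.wt] at hc hS
    obtain ⟨he, had, he2, hi, -⟩ := hc
    have hi' : i.ev σ ≤ S * W := (Ex.ev_le hW hσ i).trans (Nat.mul_le_mul_right _ (by omega))
    obtain ⟨t1, ht1, reg1, s1, v1, f1⟩ :=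
      Ex.code_run (S := S) hW hσ (by omega) i 0 p reg (by omega) he hb hm
    have hm1 := hm.congr (reg' := reg1) (fun r hr => f1 r fun d' _ => hr d')
    obtain ⟨reg2, s2, v2, f2⟩ := addr_run A had s1.bdd hm1.base (by rw [v1]; omega)
    have hm2 := hm1.congr (reg' := reg2) (fun r hr => f2 r fun d' _ => hr d')
    obtain ⟨t3, ht3, reg3, s3, v3, f3⟩ :=
      Ex.code_run (S := S) hW hσ (by omega) e 1 _ reg2 (by omega) (by simpa [addrCode] using he2) s2.bdd hm2
    have hm3 := hm2.congr (reg' := reg3) (fun r hr => f3 r fun d' _ => hr d')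
    have e3 : reg3 (regT 0) = 32 * i.ev σ + A + β := by
      rw [f3 _ (fun d' hd' => by simp only [regT]; omega), v2, v1]
    have s4 := Steps.one s3.bdd (by simpa [addrCode] using hi) (s3.bdd.mem ((s3.bdd _).1))
    refine ⟨t1 + 8 + t3 + 1, ?_, reg3, Function.update mem (reg3 (regT 0)) (reg3 (regT 1)), ?_, ?_, ?_⟩
    rotate_left
    · convert ((s1.trans s2).trans s3).trans s4 using 1
      simp only [Cm.len, Instr.exec]; congr 1; omega
    · simp only [e3, v3]
      exact hm3.seta A _ _
    · intro d _
      have := fun d' => show regH d ≠ regT d' by simp only [regT, regH]; omega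
      rw [f3 _ (fun d' _ => this d'), f2 _ (fun d' _ => this d'), f1 _ (fun d' _ => this d')]
    · simp only [Cm.time]; omega
  | seq c d ihc ihd =>
    intro h p σ reg mem hS hc hb hσ ho hm
    simp only [Cm.code, codeAt_append, Cm.code_length, Cm.wt] at hc hS
    obtain ⟨t1, ht1, reg1, mem1, s1, m1, f1⟩ := ihc h p σ reg mem (by omega) hc.1 hb hσ ho.1 hm
    obtain ⟨t2, ht2, reg2, mem2, s2, m2, f2⟩ := ihd h _ _ reg1 mem1 (by omega) hc.2 s1.bdd
      (c.bdd_ev hD _ hσ ho.1) ho.2 m1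
    refine ⟨t1 + t2, ?_, reg2, mem2, ?_, m2, fun r hr => by rw [f2 r hr, f1 r hr]⟩
    rotate_left
    · convert s1.trans s2 using 2
      simp only [Cm.len]; omega
    · simp only [Cm.time]; omega
  | loop x e c ih =>
    intro h p σ reg mem hS hc hb hσ ho hm
    simp only [Cm.code, codeAt_append, codeAt_cons, Ex.code_length, Cm.code_length, Cm.wt] at hc hS
    obtain ⟨he, hi1, hi2, hi3, hi4, hi5, hcc, hi6, hi7, hi8, -⟩ := hc
    obtain ⟨t1, ht1, reg1, s1, v1, f1⟩ :=
      Ex.code_run (S := S) hW hσ (by omega) e 0 p reg (by omega) he hb hm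
    have hm1 := hm.congr (reg' := reg1) (fun r hr => f1 r fun d' _ => hr d')
    have s2 := Steps.one s1.bdd hi1 (s1.bdd.reg ((s1.bdd _).1))
    have s3 := Steps.one s2.bdd hi2 (s2.bdd.reg (by omega))
    have hHV : ∀ d x, regV x ≠ regH d := fun d x => by simp only [regV, regH]; omega
    have hHT : ∀ d x, regT x ≠ regH d := fun d x => by simp only [regT, regH]; omega
    have hHH : ∀ d d', regH d = regH d' ↔ d = d' := fun d d' => by simp only [regH]; omega
    -- The invariant at the loop test, before pass `i`. The registers `regH d` with `d ≤ 2 * h`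
    -- belong to enclosing loops and the base address; the body is compiled for depth `h + 1` and
    -- therefore also preserves the two registers of this loop.
    have key : ∀ i ≤ e.ev σ, ∃ t ≤ ∑ j ∈ Finset.range i,
        (c.time I ((iter (fun i τ => c.ev I (τ.setv x i)) σ j).setv x j) + 8),
        ∃ reg' mem', Steps prog B ⟨p, reg, mem⟩ (t1 + 1 + 1 + t) ⟨p + e.len + 2, reg', mem'⟩ ∧
        Match β I (iter (fun i τ => c.ev I (τ.setv x i)) σ i) reg' mem' ∧
        (∀ d ≤ 2 * h, reg' (regH d) = reg (regH d)) ∧ reg' (regH (2 * h + 1)) = i ∧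
        reg' (regH (2 * h + 2)) = e.ev σ := by
      intro i
      induction i with
      | zero =>
        intro _
        refine ⟨0, le_rfl, _, _, (s1.trans s2).trans s3, ?_, ?_, ?_, ?_⟩
        · refine ⟨fun y => ?_, ?_, hm1.inp, hm1.arr⟩
          · simp only [Instr.exec, Function.update_apply, hHV, iter, if_false]; exact hm1.vars y
          · simpa [Instr.exec, Function.update_apply, hHH] using hm1.base
        · intro d hd
          have h1 : d ≠ 2 * h + 1 := by omega
          have h2 : d ≠ 2 * h + 2 := by omega
          simp only [Instr.exec, Function.update_apply, hHH, h1, h2, if_false]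
          exact f1 _ fun d' _ => (hHT _ _).symm
        · simp
        · simp [Instr.exec, hHH, v1]
      | succ i ihi =>
        intro hi
        obtain ⟨t, ht, reg2, mem2, s, m, f, v, v'⟩ := ihi (by omega)
        set τ := iter (fun i τ => c.ev I (τ.setv x i)) σ i
        have hτ : τ.Bdd W := iter_bdd hD hσ ho i (by omega)
        have hiW : i ≤ W := by have := ho.1; omega
        have r1 := Steps.one s.bdd hi3 (fun i => s.bdd i)
        simp only [Instr.exec, v, v'] at r1
        rw [if_pos (by omega)] at r1
        have r2 := Steps.one r1.bdd (by convert hi5 using 2) (r1.bdd.reg ((r1.bdd _).1))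
        simp only [Instr.exec, v] at r2
        obtain ⟨t3, ht3, reg3, mem3, r3, m3, f3⟩ := ih (h + 1) _ (τ.setv x i)
          (Function.update reg2 (regV x) i) mem2 (by omega) (by convert hcc using 1)
          r2.bdd (hτ.setv hiW x) (ho.2 i (by omega)) (m.setv x i)
        have r4 := Steps.one r3.bdd (ins := .const (regT 0) 1) (by convert hi6 using 2) (r3.bdd.reg (by omega))
        have e3 : reg3 (regH (2 * h + 1)) = i := by
          rw [f3 _ (by omega), Function.update_of_ne (hHV _ _).symm, v]
        have r5 := Steps.one r4.bdd (ins := .add (regH (2 * h + 1)) (regH (2 * h + 1)) (regT 0))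
          (by convert hi7 using 2; simp [Instr.exec]) (r4.bdd.reg (by
          simp [Instr.exec, (hHT _ _).symm, e3]; omega))
        have r6 := Steps.one r5.bdd (ins := .jump (p + e.len + 2)) (by convert hi8 using 2; simp [Instr.exec]) (fun i => r5.bdd i)
        refine ⟨t + (1 + 1 + t3 + 1 + 1 + 1), ?_,
          Function.update (Function.update reg3 (regT 0) 1) (regH (2 * h + 1)) (i + 1), mem3, ?_, ?_, ?_, ?_, ?_⟩
        rotate_left
        · convert s.trans (((((r1.trans r2).trans r3).trans r4).trans r5).trans r6) using 1
          · omega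
          · simp [Instr.exec, (hHT _ _).symm, e3]
        · have := m3
          refine ⟨fun y => ?_, ?_, m3.inp, m3.arr⟩
          · have : regV y ≠ regT 0 := by simp only [regV, regT]; omega
            simp only [Function.update_apply, hHV, this, if_false]
            exact m3.vars y
          · simp only [Function.update_apply, hHH, (hHT _ _).symm, if_false]
            simpa using m3.base
        · intro d hd
          have h1 : d ≠ 2 * h + 1 := by omega
          simp only [Function.update_apply, hHH, (hHT _ _).symm, h1, if_false]
          rw [f3 _ (by omega), Function.update_of_ne (hHV _ _).symm, f d hd]
        · simp
        · simp only [Function.update_apply, hHH, (hHT _ _).symm, if_false]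
          rw [if_neg (by omega), f3 _ (by omega), Function.update_of_ne (hHV _ _).symm, v']
        · have : t3 ≤ c.time I ((iter (fun i τ => c.ev I (τ.setv x i)) σ i).setv x i) := ht3
          rw [Finset.sum_range_succ]; omega
    obtain ⟨t, ht, reg', mem', s, m, f, v, v'⟩ := key _ le_rfl
    have r1 := Steps.one s.bdd hi3 (fun i => s.bdd i)
    simp only [Instr.exec, v, v', lt_irrefl, if_false] at r1
    have r2 := Steps.one r1.bdd hi4 (fun i => r1.bdd i)
    refine ⟨t1 + 1 + 1 + t + 1 + 1, ?_, reg', mem', ?_, m, f⟩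
    rotate_left
    · convert (s.trans r1).trans r2 using 1
      simp only [Cm.len, Instr.exec]; congr 1; omega
    · simp only [Cm.time]; omega

end Loop

/-! ### Domination of sequences up to repetition -/

/-- After suitable repetitions of entries, the two lists are related entrywise. -/
inductive Dom {α β : Type*} (R : α → β → Prop) : List α → List β → Prop
  | nil : Dom R [] []
  | left {x : α} {y : β} {l : List α} {m : List β} :
      R x y → Dom R l (y :: m) → Dom R (x :: l) (y :: m)
  | right {x : α} {y : β} {l : List α} {m : List β} :
      R x y → Dom R (x :: l) m → Dom R (x :: l) (y :: m)
  | both {x : α} {y : β} {l : List α} {m : List β} :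
      R x y → Dom R l m → Dom R (x :: l) (y :: m)

/-- The first list arises from the second one by repetitions. -/
inductive Stretch {α : Type*} : List α → List α → Prop
  | nil : Stretch [] []
  | new {x : α} {z l : List α} : Stretch z l → Stretch (x :: z) (x :: l)
  | dup {x : α} {z l : List α} : Stretch z (x :: l) → Stretch (x :: z) (x :: l)

/-- The number of maximal blocks of entries with the property `p`. -/
noncomputable def runs {α : Type*} (p : α → Prop) : List α → ℕ
  | [] => 0
  | x :: l => runs p l + open Classical in if p x ∧ ¬ ∃ y ∈ l.head?, p y then 1 else 0

namespace Stretch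

variable {α β : Type*}

lemma refl : ∀ l : List α, Stretch l l
  | [] => nil
  | _ :: l => new (refl l)

lemma mem_iff {z l : List α} (h : Stretch z l) (a : α) : a ∈ z ↔ a ∈ l := by
  induction h with
  | nil => rfl
  | new _ ih => simp [ih]
  | dup _ ih => simp [ih]

lemma head? {z l : List α} (h : Stretch z l) : z.head? = l.head? := by
  cases h <;> rfl

lemma getLast? {z l : List α} (h : Stretch z l) : z.getLast? = l.getLast? := by
  induction h with
  | nil => rfl
  | new _ ih => rw [List.getLast?_cons, List.getLast?_cons, ih]
  | dup _ ih => rw [List.getLast?_cons, ih, List.getLast?_cons]; simp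

lemma runs_eq (p : α → Prop) {z l : List α} (h : Stretch z l) : runs p z = runs p l := by
  classical
  induction h with
  | nil => rfl
  | new h ih =>
    rw [runs, runs, ih]
    exact congrArg _ (if_congr (by rw [h.head?]) rfl rfl)
  | dup h ih =>
    rw [runs, ih, if_neg, add_zero]
    rintro ⟨h1, h2⟩
    exact h2 ⟨_, by rw [h.head?]; rfl, h1⟩

lemma append {z l z' l' : List α} (h : Stretch z l) (h' : Stretch z' l') :
    Stretch (z ++ z') (l ++ l') := by
  induction h with
  | nil => exact h'
  | new _ ih => exact ih.new
  | dup _ ih => exact ih.dup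

lemma snoc {z l : List α} (h : Stretch z l) {x : α} (hx : l.getLast? = some x) :
    Stretch (z ++ [x]) l := by
  induction h with
  | nil => simp at hx
  | @new y z l h ih =>
    cases l with
    | nil =>
      cases h
      obtain rfl : y = x := by simpa using hx
      exact dup (new nil)
    | cons w l => exact (ih (by simpa using hx)).new
  | dup h ih => exact (ih hx).dup

lemma reverse {z l : List α} (h : Stretch z l) : Stretch z.reverse l.reverse := by
  induction h with
  | nil => exact nil
  | new _ ih => simpa using ih.append (refl [_])
  | dup _ ih => rw [List.reverse_cons]; exact ih.snoc (by simp)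

end Stretch

lemma runs_map {α β : Type*} (p : β → Prop) (f : α → β) (l : List α) :
    runs p (l.map f) = runs (fun x => p (f x)) l := by
  classical
  induction l with
  | nil => rfl
  | cons x l ih =>
    rw [List.map_cons, runs, runs, ih]
    exact congrArg _ (if_congr (by cases l <;> simp) rfl rfl)

lemma runs_congr {α : Type*} {p q : α → Prop} {l : List α} (h : ∀ x ∈ l, p x ↔ q x) :
    runs p l = runs q l := by
  classical
  induction l with
  | nil => rfl
  | cons x l ih =>
    rw [runs, runs, ih fun y hy => h y (List.mem_cons_of_mem _ hy)]
    refine congrArg _ (if_congr ?_ rfl rfl)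
    cases l with
    | nil => simp [h x]
    | cons y l => simp [h x, h y]

lemma runs_eq_zero {α : Type*} {p : α → Prop} {l : List α} : runs p l = 0 ↔ ∀ x ∈ l, ¬ p x := by
  induction l with
  | nil => simp [runs]
  | cons x l ih =>
    rw [runs, Nat.add_eq_zero_iff, ih]
    constructor
    · rintro ⟨h1, h2⟩ y hy
      have hx : ¬ p x := by
        intro hx
        split_ifs at h2 with h
        simp only [hx, true_and, not_not] at h
        obtain ⟨y, hy, hpy⟩ := h
        exact h1 y (List.mem_of_mem_head? hy) hpy
      rcases List.mem_cons.1 hy with rfl | hy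
      exacts [hx, h1 y hy]
    · intro h
      refine ⟨fun y hy => h y (List.mem_cons_of_mem _ hy), ?_⟩
      rw [if_neg]
      exact fun hh => h x List.mem_cons_self hh.1

namespace Dom

variable {α β γ δ : Type*} {R : α → β → Prop}

/-- Together with `of_zip` this describes `Dom` by one list of matched pairs whose projections
stretch the two given lists. Whatever is invariant under repetitions can be transported through `z`.
-/
lemma zip {l : List α} {m : List β} (h : Dom R l m) : ∃ z : List (α × β),
    (∀ p ∈ z, R p.1 p.2) ∧ Stretch (z.map Prod.fst) l ∧ Stretch (z.map Prod.snd) m := by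
  induction h with
  | nil => exact ⟨[], by simp, .nil, .nil⟩
  | @left x y l m h _ ih =>
    obtain ⟨z, hz, h1, h2⟩ := ih
    exact ⟨(x, y) :: z, by simpa [h] using hz, h1.new, h2.dup⟩
  | @right x y l m h _ ih =>
    obtain ⟨z, hz, h1, h2⟩ := ih
    exact ⟨(x, y) :: z, by simpa [h] using hz, h1.dup, h2.new⟩
  | @both x y l m h _ ih =>
    obtain ⟨z, hz, h1, h2⟩ := ih
    exact ⟨(x, y) :: z, by simpa [h] using hz, h1.new, h2.new⟩

lemma of_zip {z : List (α × β)} : ∀ {l : List α} {m : List β},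
    (∀ p ∈ z, R p.1 p.2) → Stretch (z.map Prod.fst) l → Stretch (z.map Prod.snd) m → Dom R l m := by
  induction z with
  | nil => intro l m _ h1 h2; cases h1; cases h2; exact .nil
  | cons p z ih =>
    intro l m hz h1 h2
    have hp := hz p List.mem_cons_self
    have ih' := fun {l m} => ih (l := l) (m := m) fun q hq => hz q (List.mem_cons_of_mem _ hq)
    simp only [List.map_cons] at h1 h2
    cases h1 with
    | new h1 =>
      cases h2 with
      | new h2 => exact both hp (ih' h1 h2)
      | dup h2 => exact left hp (ih' h1 h2)
    | dup h1 =>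
      cases h2 with
      | new h2 => exact right hp (ih' h1 h2)
      | dup h2 => exact ih' h1 h2

lemma refl {R : α → α → Prop} (h : ∀ x, R x x) : ∀ l, Dom R l l
  | [] => .nil
  | x :: l => .both (h x) (refl h l)

lemma flip {l : List α} {m : List β} (h : Dom R l m) : Dom (fun y x => R x y) m l := by
  induction h with
  | nil => exact .nil
  | left h _ ih => exact .right h ih
  | right h _ ih => exact .left h ih
  | both h _ ih => exact .both h ih

/-- The two derivations are merged along the middle list, whose current head must be the same in
both. -/
lemma trans {S : β → γ → Prop} {T : α → γ → Prop} {l : List α} {m : List β} {n : List γ}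
    (h : Dom R l m) (h' : Dom S m n) (hT : ∀ x y z, R x y → S y z → T x z) : Dom T l n := by
  induction h generalizing n with
  | nil => cases h'; exact .nil
  | @left x y l m hxy _ ih =>
    cases h' with
    | left hyz h' => exact .left (hT _ _ _ hxy hyz) (ih (.left hyz h'))
    | right hyz h' => exact .left (hT _ _ _ hxy hyz) (ih (.right hyz h'))
    | both hyz h' => exact .left (hT _ _ _ hxy hyz) (ih (.both hyz h'))
  | @right x y l m hxy _ ih =>
    -- The inner induction passes over the entries of `n` that are matched with the same middle
    -- entry `y`, until the second derivation drops `y` as well.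
    generalize hq : y :: m = q at h'
    induction h' with
    | nil => cases hq
    | left hyz h' _ => cases hq; exact ih h'
    | right hyz h' ih' => cases hq; exact .right (hT _ _ _ hxy hyz) (ih' rfl)
    | both hyz h' _ => cases hq; exact .right (hT _ _ _ hxy hyz) (ih h')
  | @both x y l m hxy _ ih =>
    generalize hq : y :: m = q at h'
    induction h' with
    | nil => cases hq
    | left hyz h' _ => cases hq; exact .left (hT _ _ _ hxy hyz) (ih h')
    | right hyz h' ih' => cases hq; exact .right (hT _ _ _ hxy hyz) (ih' rfl)
    | both hyz h' _ => cases hq; exact .both (hT _ _ _ hxy hyz) (ih h')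

lemma map {S : γ → δ → Prop} (f : α → γ) (g : β → δ) {l : List α} {m : List β} (h : Dom R l m)
    (hS : ∀ x y, R x y → S (f x) (g y)) : Dom S (l.map f) (m.map g) := by
  induction h with
  | nil => exact .nil
  | left h _ ih => exact .left (hS _ _ h) ih
  | right h _ ih => exact .right (hS _ _ h) ih
  | both h _ ih => exact .both (hS _ _ h) ih

lemma mono {S : α → β → Prop} {l : List α} {m : List β} (h : Dom R l m)
    (hS : ∀ x y, x ∈ l → y ∈ m → R x y → S x y) : Dom S l m := by
  obtain ⟨z, hz, h1, h2⟩ := h.zip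
  refine of_zip (fun p hp => hS _ _ ?_ ?_ (hz p hp)) h1 h2
  · exact (h1.mem_iff _).1 (List.mem_map_of_mem hp)
  · exact (h2.mem_iff _).1 (List.mem_map_of_mem hp)

lemma of_map {S : γ → δ → Prop} {f : α → γ} {g : β → δ} {l : List α} {m : List β}
    (h : Dom S (l.map f) (m.map g)) : Dom (fun x y => S (f x) (g y)) l m := by
  generalize hl : l.map f = l' at h
  generalize hm : m.map g = m' at h
  induction h generalizing l m with
  | nil => simp at hl hm; subst hl hm; exact .nil
  | left h _ ih =>
    obtain ⟨x, l, rfl, rfl, rfl⟩ := List.map_eq_cons_iff.1 hl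
    obtain ⟨y, m, rfl, rfl, rfl⟩ := List.map_eq_cons_iff.1 hm
    exact .left h (ih rfl rfl)
  | right h _ ih =>
    obtain ⟨x, l, rfl, rfl, rfl⟩ := List.map_eq_cons_iff.1 hl
    obtain ⟨y, m, rfl, rfl, rfl⟩ := List.map_eq_cons_iff.1 hm
    exact .right h (ih rfl rfl)
  | both h _ ih =>
    obtain ⟨x, l, rfl, rfl, rfl⟩ := List.map_eq_cons_iff.1 hl
    obtain ⟨y, m, rfl, rfl, rfl⟩ := List.map_eq_cons_iff.1 hm
    exact .both h (ih rfl rfl)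

lemma append {l l' : List α} {m m' : List β} (h : Dom R l m) (h' : Dom R l' m') :
    Dom R (l ++ l') (m ++ m') := by
  induction h with
  | nil => exact h'
  | left h _ ih => exact .left h ih
  | right h _ ih => exact .right h ih
  | both h _ ih => exact .both h ih

lemma append_left {A l : List α} {y : β} {m : List β} (hA : ∀ a ∈ A, R a y)
    (h : Dom R l (y :: m)) : Dom R (A ++ l) (y :: m) := by
  induction A with
  | nil => exact h
  | cons a A ih =>
    exact .left (hA a List.mem_cons_self) (ih fun b hb => hA b (List.mem_cons_of_mem _ hb))

lemma append_right {l : List α} {x : α} {A m : List β} (hA : ∀ a ∈ A, R x a)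
    (h : Dom R (x :: l) m) : Dom R (x :: l) (A ++ m) := by
  induction A with
  | nil => exact h
  | cons a A ih =>
    exact .right (hA a List.mem_cons_self) (ih fun b hb => hA b (List.mem_cons_of_mem _ hb))

lemma runs_eq {l : List α} {m : List β} (h : Dom R l m) {p : α → Prop} {q : β → Prop}
    (hpq : ∀ x y, R x y → (p x ↔ q y)) : runs p l = runs q m := by
  obtain ⟨z, hz, h1, h2⟩ := h.zip
  rw [← h1.runs_eq, ← h2.runs_eq, runs_map, runs_map]
  exact runs_congr fun r hr => hpq _ _ (hz r hr)

lemma exists_right {l : List α} {m : List β} (h : Dom R l m) {x : α} (hx : x ∈ l) :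
    ∃ y ∈ m, R x y := by
  obtain ⟨z, hz, h1, h2⟩ := h.zip
  obtain ⟨p, hp, rfl⟩ := List.mem_map.1 ((h1.mem_iff x).2 hx)
  exact ⟨p.2, (h2.mem_iff _).1 (List.mem_map_of_mem hp), hz p hp⟩

lemma exists_left {l : List α} {m : List β} (h : Dom R l m) {y : β} (hy : y ∈ m) :
    ∃ x ∈ l, R x y := h.flip.exists_right hy

lemma getLast? {l : List α} {m : List β} (h : Dom R l m) {x : α} (hx : l.getLast? = some x) :
    ∃ y, m.getLast? = some y ∧ R x y := by
  obtain ⟨z, hz, h1, h2⟩ := h.zip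
  rw [← h1.getLast?, List.getLast?_map, Option.map_eq_some_iff] at hx
  obtain ⟨p, hp, rfl⟩ := hx
  refine ⟨p.2, ?_, hz p (List.mem_of_getLast? hp)⟩
  rw [← h2.getLast?, List.getLast?_map, hp]; rfl

lemma reverse {l : List α} {m : List β} (h : Dom R l m) : Dom R l.reverse m.reverse := by
  obtain ⟨z, hz, h1, h2⟩ := h.zip
  refine of_zip (z := z.reverse) (by simpa using hz) ?_ ?_
  · rw [List.map_reverse]; exact h1.reverse
  · rw [List.map_reverse]; exact h2.reverse

end Dom

/-! ### Short representatives of sequences of numbers -/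

/-- Mutual domination. -/
def Sim {α : Type*} (R : α → α → Prop) (l m : List α) : Prop := Dom R l m ∧ Dom R m l

namespace Sim

variable {α : Type*} {R : α → α → Prop}

lemma refl (h : ∀ x, R x x) (l : List α) : Sim R l l := ⟨.refl h l, .refl h l⟩

lemma trans (h : ∀ x y z, R x y → R y z → R x z) {l m n : List α} (h1 : Sim R l m)
    (h2 : Sim R m n) : Sim R l n := ⟨h1.1.trans h2.1 h, h2.2.trans h1.2 h⟩

lemma append {l m l' m' : List α} (h1 : Sim R l m) (h2 : Sim R l' m') :
    Sim R (l ++ l') (m ++ m') := ⟨h1.1.append h2.1, h1.2.append h2.2⟩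

lemma reverse {l m : List α} (h : Sim R l m) : Sim R l.reverse m.reverse :=
  ⟨h.1.reverse, h.2.reverse⟩

end Sim

abbrev NSim (l m : List ℕ) : Prop := Sim (· ≤ ·) l m

lemma NSim.trans {l m n : List ℕ} (h : NSim l m) (h' : NSim m n) : NSim l n :=
  Sim.trans (R := (· ≤ ·)) (fun _ _ _ h1 h2 => le_trans h1 h2) h h'

lemma NSim.refl (l : List ℕ) : NSim l l := Sim.refl (fun _ => le_rfl) l

/-- Entries between two values can be left out. -/
lemma nsim_between {x z : ℕ} {A C : List ℕ}
    (h : (x ≤ z ∧ ∀ a ∈ A, x ≤ a ∧ a ≤ z) ∨ (z ≤ x ∧ ∀ a ∈ A, z ≤ a ∧ a ≤ x)) :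
    NSim (x :: (A ++ z :: C)) (x :: z :: C) := by
  have hr : Dom (· ≤ ·) (z :: C) (z :: C) := .refl (fun _ => le_rfl) _
  rcases h with ⟨hxz, hA⟩ | ⟨hxz, hA⟩
  · exact ⟨.both le_rfl (.append_left (fun a ha => (hA a ha).2) hr),
      .right le_rfl (.append_right (fun a ha => (hA a ha).1) (.left hxz hr))⟩
  · exact ⟨.left le_rfl (.append_left (fun a ha => (hA a ha).2) (.right hxz hr)),
      .both le_rfl (.append_right (fun a ha => (hA a ha).1) hr)⟩

lemma exists_last_max : ∀ B : List ℕ, B ≠ [] →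
    ∃ A z C, B = A ++ z :: C ∧ (∀ a ∈ A, a ≤ z) ∧ ∀ c ∈ C, c < z
  | [], h => (h rfl).elim
  | b :: B, _ => by
    by_cases hB : B = []
    · exact ⟨[], b, [], by simp [hB], by simp, by simp⟩
    · obtain ⟨A, z, C, rfl, hA, hC⟩ := exists_last_max B hB
      by_cases hb : b ≤ z
      · exact ⟨b :: A, z, C, rfl, by simpa [hb] using hA, hC⟩
      · refine ⟨[], b, A ++ z :: C, rfl, by simp, fun c hc => ?_⟩
        simp only [List.mem_append, List.mem_cons] at hc
        rcases hc with hc | rfl | hc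
        · have := hA c hc; omega
        · omega
        · have := hC c hc; omega

lemma exists_last_min : ∀ B : List ℕ, B ≠ [] →
    ∃ A z C, B = A ++ z :: C ∧ (∀ a ∈ A, z ≤ a) ∧ ∀ c ∈ C, z < c
  | [], h => (h rfl).elim
  | b :: B, _ => by
    by_cases hB : B = []
    · exact ⟨[], b, [], by simp [hB], by simp, by simp⟩
    · obtain ⟨A, z, C, rfl, hA, hC⟩ := exists_last_min B hB
      by_cases hb : z ≤ b
      · exact ⟨b :: A, z, C, rfl, by simpa [hb] using hA, hC⟩
      · refine ⟨[], b, A ++ z :: C, rfl, by simp, fun c hc => ?_⟩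
        simp only [List.mem_append, List.mem_cons] at hc
        rcases hc with hc | rfl | hc
        · have := hA c hc; omega
        · omega
        · have := hC c hc; omega

def ndist (x y : ℕ) : ℕ := (x - y) + (y - x)

/-- The length of a list plus the sum of the distances between entries two places apart. -/
def zcost : List ℕ → ℕ
  | x :: y :: z :: t => ndist x z + 1 + zcost (y :: z :: t)
  | l => l.length

/-- The head enters the cost through one distance only. -/
lemma zcost_head (p q : ℕ) (l : List ℕ) : zcost (p :: l) ≤ zcost (q :: l) + ndist p q := by
  match l with
  | [] => simp [zcost]
  | [_] => simp [zcost]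
  | y :: z :: t => simp only [zcost, ndist]; omega

lemma zcost_snoc (l : List ℕ) (z y x : ℕ) :
    zcost (l ++ [z, y, x]) = zcost (l ++ [z, y]) + ndist x z + 1 := by
  match l with
  | [] => simp only [zcost, ndist, List.nil_append, List.length]; omega
  | [a] => simp only [zcost, ndist, List.nil_append, List.cons_append, List.length]; omega
  | [a, b] => simp only [zcost, ndist, List.nil_append, List.cons_append, List.length]; omega
  | a :: b :: c :: t =>
    have := zcost_snoc (b :: c :: t) z y x
    simp only [zcost, List.cons_append] at this ⊢
    omega

lemma zcost_reverse : ∀ l : List ℕ, zcost l.reverse = zcost l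
  | [] => rfl
  | [_] => rfl
  | [_, _] => rfl
  | x :: y :: z :: t => by
    have := zcost_reverse (y :: z :: t)
    simp only [List.reverse_cons, List.append_assoc, List.cons_append, List.nil_append] at this ⊢
    rw [zcost_snoc, this, zcost]
    omega

/-- At most two distances between entries two places apart cross the seam, each at most `K`. -/
lemma zcost_append {K : ℕ} : ∀ l m : List ℕ, (∀ x ∈ l, x ≤ K) → (∀ x ∈ m, x ≤ K) →
    zcost (l ++ m) ≤ zcost l + zcost m + 2 * K
  | [], m, _, _ => by simp [zcost]
  | [x], m, hl, hm => by
    match m with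
    | [] => simp [zcost]
    | [_] => simp [zcost]
    | y :: z :: t =>
      have h1 := hl x (by simp)
      have h2 := hm z (by simp)
      simp only [zcost, ndist, List.cons_append, List.nil_append, List.length]; omega
  | [x, w], m, hl, hm => by
    match m with
    | [] => simp [zcost]
    | [z] =>
      have h1 := hl x (by simp)
      have h2 := hm z (by simp)
      simp only [zcost, ndist, List.cons_append, List.nil_append, List.length]; omega
    | y :: z :: t =>
      have h1 := hl x (by simp)
      have h3 := hl w (by simp)
      have h2 := hm z (by simp)
      have h4 := hm y (by simp)
      simp only [zcost, ndist, List.cons_append, List.nil_append, List.length]; omega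
  | x :: y :: z :: t, m, hl, hm => by
    have := zcost_append (y :: z :: t) m (fun a ha => hl a (List.mem_cons_of_mem _ ha)) hm
    simp only [zcost, List.cons_append] at this ⊢
    omega

/-- Here `x` is a strict extremum. Everything before the last opposite extremum `z` of `B` lies
between `x` and `z` and can be dropped; what follows lies strictly between them. Repeating this, the
oscillation narrows at every turn, so the distances between every second entry telescope. The extra
entry `y` in front of `x` accounts for the distance that ends in `z` and makes the recursion close.
-/
lemma exists_contracting : ∀ (n : ℕ) (B : List ℕ), B.length ≤ n → ∀ x y : ℕ,
    ((x ≤ y ∧ ∀ b ∈ B, x < b ∧ b ≤ y) ∨ (y ≤ x ∧ ∀ b ∈ B, y ≤ b ∧ b < x)) →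
    ∃ B', NSim (x :: B) (x :: B') ∧ zcost (y :: x :: B') ≤ 2 * ndist x y + 2 := by
  intro n
  induction n with
  | zero =>
    intro B hB x y _
    obtain rfl : B = [] := List.length_eq_zero_iff.1 (by omega)
    exact ⟨[], NSim.refl _, by simp [zcost]⟩
  | succ n ih =>
    intro B hB x y h
    by_cases hB0 : B = []
    · subst hB0; exact ⟨[], NSim.refl _, by simp [zcost]⟩
    rcases h with ⟨hxy, h⟩ | ⟨hxy, h⟩
    · obtain ⟨A, z, C, rfl, hA, hC⟩ := exists_last_max B hB0
      have hz := h z (by simp)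
      -- The entries of `C` exceed `x` strictly, so the interval shrinks to `[x + 1, z)`. The gain
      -- of `2` in the bound pays for the new entry and for replacing `x + 1` by `x`.
      obtain ⟨C', hs, hc⟩ := ih C (by simp at hB; omega) z (x + 1) (Or.inr ⟨hz.1, fun b hb =>
        ⟨(h b (by simp [hb])).1, hC b hb⟩⟩)
      refine ⟨z :: C', (nsim_between (Or.inl ⟨hz.1.le, fun a ha =>
        ⟨(h a (by simp [ha])).1.le, hA a ha⟩⟩)).trans (Sim.append (NSim.refl [x]) hs), ?_⟩
      have := zcost_head x (x + 1) (z :: C')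
      simp only [zcost, ndist] at *
      omega
    · obtain ⟨A, z, C, rfl, hA, hC⟩ := exists_last_min B hB0
      have hz := h z (by simp)
      obtain ⟨C', hs, hc⟩ := ih C (by simp at hB; omega) z (x - 1) (Or.inl ⟨by omega, fun b hb =>
        ⟨hC b hb, by have := (h b (by simp [hb])).2; omega⟩⟩)
      refine ⟨z :: C', (nsim_between (Or.inr ⟨hz.2.le, fun a ha =>
        ⟨hA a ha, (h a (by simp [ha])).2.le⟩⟩)).trans (Sim.append (NSim.refl [x]) hs), ?_⟩
      have := zcost_head x (x - 1) (z :: C')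
      simp only [zcost, ndist] at *
      omega

/-- After the last minimum of `B` the entries are strictly above it, which is the situation of
`exists_contracting`. -/
lemma exists_short_of_max {K x : ℕ} (B : List ℕ) (hx : x ≤ K) (hB : ∀ b ∈ B, b ≤ x) :
    ∃ B', NSim (x :: B) (x :: B') ∧ zcost (x :: B') ≤ 2 * K + 3 := by
  by_cases hB0 : B = []
  · exact ⟨[], by subst hB0; exact NSim.refl _, by simp [zcost]⟩
  obtain ⟨A, z, C, rfl, hA, hC⟩ := exists_last_min B hB0
  have hz := hB z (by simp)
  obtain ⟨C', hs, hc⟩ := exists_contracting _ C le_rfl z x (Or.inl ⟨hz, fun b hb =>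
    ⟨hC b hb, hB b (by simp [hb])⟩⟩)
  refine ⟨z :: C', (nsim_between (Or.inr ⟨hz, fun a ha => ⟨hA a ha, hB a (by simp [ha])⟩⟩)).trans
    (Sim.append (NSim.refl [x]) hs), ?_⟩
  simp only [ndist] at hc
  omega

lemma NSim.le {K : ℕ} {l m : List ℕ} (h : NSim l m) (hl : ∀ x ∈ l, x ≤ K) : ∀ x ∈ m, x ≤ K := by
  intro x hx
  obtain ⟨y, hy, hxy⟩ := h.2.exists_right hx
  exact hxy.trans (hl y hy)

/-- Every list of numbers up to `K` is equivalent to a list of cost `O(K)`. -/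
lemma exists_short {K : ℕ} (l : List ℕ) (hl : ∀ x ∈ l, x ≤ K) :
    ∃ l', NSim l l' ∧ zcost l' ≤ 6 * K + 6 := by
  by_cases h0 : l = []
  · exact ⟨[], by subst h0; exact NSim.refl _, by simp [zcost]⟩
  obtain ⟨A, M, C, rfl, hA, hC⟩ := exists_last_max l h0
  have hM := hl M (by simp)
  obtain ⟨A', hA', cA⟩ := exists_short_of_max A.reverse hM (by simpa using hA)
  obtain ⟨C', hC', cC⟩ := exists_short_of_max C hM fun c hc => (hC c hc).le
  have hA2 : NSim (A ++ [M]) (M :: A').reverse := by simpa using hA'.reverse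
  -- The maximum is doubled so that both the reversed left part and the right part start with it.
  have e : NSim (A ++ M :: C) (A ++ M :: M :: C) := by
    refine Sim.append (NSim.refl A) ?_
    exact ⟨.right le_rfl (.refl (fun _ => le_rfl) _), .left le_rfl (.refl (fun _ => le_rfl) _)⟩
  have e2 : NSim (A ++ M :: C) ((M :: A').reverse ++ M :: C') := by
    refine e.trans ?_
    simpa using Sim.append hA2 hC'
  refine ⟨_, e2, ?_⟩
  have hle := e2.le hl
  refine (zcost_append (K := K) _ _ (fun x hx => hle x (List.mem_append_left _ hx))
    fun x hx => hle x (List.mem_append_right _ hx)).trans ?_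
  rw [zcost_reverse]
  omega

/-! ### Short representatives of sequences of pairs -/

/-- Equal first components and ordered second components. -/
def PairLe {γ : Type*} (x y : γ × ℕ) : Prop := x.1 = y.1 ∧ x.2 ≤ y.2

lemma PairLe.rfl' {γ : Type*} (x : γ × ℕ) : PairLe x x := ⟨rfl, le_rfl⟩

lemma PairLe.trans {γ : Type*} (x y z : γ × ℕ) (h : PairLe x y) (h' : PairLe y z) : PairLe x z :=
  ⟨h.1.trans h'.1, h.2.trans h'.2⟩

lemma exists_segment {γ : Type*} : ∀ l : List (γ × ℕ), l ≠ [] → ∃ c s r, l = s.map (Prod.mk c) ++ r ∧ s ≠ [] ∧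
    ∀ y ∈ r.head?, y.1 ≠ c
  | [], h => (h rfl).elim
  | x :: l, _ => by
    by_cases hl : l = []
    · exact ⟨x.1, [x.2], [], by simp [hl], by simp, by simp⟩
    obtain ⟨c, s, r, rfl, hs, hr⟩ := exists_segment l hl
    by_cases hx : x.1 = c
    · exact ⟨c, x.2 :: s, r, by simp [← hx], by simp, hr⟩
    · refine ⟨x.1, [x.2], s.map (Prod.mk c) ++ r, by simp, by simp, ?_⟩
      cases s with
      | nil => exact (hs rfl).elim
      | cons a s => simpa using fun h => hx h.symm

section Changes

variable {γ : Type*} [DecidableEq γ]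

/-- The number of changes of the first component. -/
def changes : List (γ × ℕ) → ℕ
  | x :: y :: t => (if x.1 = y.1 then 0 else 1) + changes (y :: t)
  | _ => 0

lemma changes_append {c : γ} {y : γ × ℕ} {r : List (γ × ℕ)} (hy : y.1 ≠ c) :
    ∀ s : List ℕ, s ≠ [] → changes (y :: r) + 1 ≤ changes (s.map (Prod.mk c) ++ y :: r)
  | [], h => (h rfl).elim
  | [a], _ => by simp [changes, Ne.symm hy, add_comm]
  | a :: b :: s, _ => by
    have := changes_append (r := r) hy (b :: s) (by simp)
    simpa [changes] using this

/-- Each block with constant first component is shortened separately. It costs `6 * K + 6` by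
`exists_short`, and `2 * K` more at the seam to the next block. -/
lemma exists_short_pairs {K : ℕ} : ∀ (n : ℕ) (l : List (γ × ℕ)), l.length ≤ n → l ≠ [] →
    (∀ x ∈ l, x.2 ≤ K) →
    ∃ l', Sim PairLe l l' ∧ zcost (l'.map Prod.snd) ≤ (changes l + 1) * (8 * K + 6) := by
  intro n
  induction n with
  | zero => intro l h h0; exact (h0 (List.length_eq_zero_iff.1 (by omega))).elim
  | succ n ih =>
    intro l hn h0 hl
    obtain ⟨c, s, r, rfl, hs, hr⟩ := exists_segment l h0
    obtain ⟨s', hs', cs⟩ := exists_short s (fun x hx => hl (c, x) (by simp [hx]))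
    have hss : Sim PairLe (s.map (Prod.mk c)) (s'.map (Prod.mk c)) :=
      ⟨hs'.1.map _ _ fun _ _ h => ⟨rfl, h⟩, hs'.2.map _ _ fun _ _ h => ⟨rfl, h⟩⟩
    have hsnd : (s'.map (Prod.mk c)).map Prod.snd = s' := by simp [Function.comp_def]
    have hK : ∀ x ∈ s', x ≤ K := hs'.le fun x hx => hl (c, x) (by simp [hx])
    cases r with
    | nil =>
      refine ⟨s'.map (Prod.mk c), by simpa using hss, ?_⟩
      rw [hsnd]
      nlinarith [Nat.zero_le (changes (s.map (Prod.mk c) ++ []))]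
    | cons y r =>
      have hlen : (y :: r).length ≤ n := by
        have : 0 < s.length := List.length_pos_iff.2 hs
        simp at hn ⊢; omega
      obtain ⟨r', hr', cr⟩ := ih (y :: r) hlen (by simp) fun x hx => hl x (List.mem_append_right _ hx)
      refine ⟨_, hss.append hr', ?_⟩
      have h1 := changes_append (r := r) (hr y (by simp)) s hs
      have hK' : ∀ x ∈ r'.map Prod.snd, x ≤ K := by
        intro x hx
        obtain ⟨p, hp, rfl⟩ := List.mem_map.1 hx
        obtain ⟨q, hq, hpq⟩ := hr'.2.exists_right hp
        exact hpq.2.trans (hl q (List.mem_append_right _ hq))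
      have h2 := zcost_append s' (r'.map Prod.snd) hK hK'
      rw [List.map_append, hsnd]
      have h3 : (changes (y :: r) + 1 + 1) * (8 * K + 6) ≤
        (changes (s.map (Prod.mk c) ++ y :: r) + 1) * (8 * K + 6) := Nat.mul_le_mul_right _ (by omega)
      nlinarith

end Changes

section Toggles

variable {ι : Type*} [DecidableEq ι]

/-- The sum of the sizes of the changes of the first component. -/
def toggles : List (Finset ι × ℕ) → ℕ
  | x :: y :: t => (symmDiff x.1 y.1).card + toggles (y :: t)
  | _ => 0

/-- The sum of the differences of first components two places apart. -/
def toggles₂ : List (Finset ι × ℕ) → ℕ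
  | x :: y :: z :: t => (symmDiff x.1 z.1).card + toggles₂ (y :: z :: t)
  | _ => 0

lemma card_symmDiff_triangle (A B C : Finset ι) :
    (symmDiff A C).card ≤ (symmDiff A B).card + (symmDiff B C).card :=
  (Finset.card_le_card (symmDiff_triangle A B C)).trans (Finset.card_union_le _ _)

/-- By the triangle inequality every difference two places apart is bounded by two consecutive
differences, and each of those is used at most twice. -/
lemma toggles₂_le (x : Finset ι × ℕ) : ∀ l, toggles₂ (x :: l) ≤ toggles (x :: l) + toggles l
  | [] => by simp [toggles₂]
  | [_] => by simp [toggles₂]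
  | y :: z :: t => by
    have h1 := toggles₂_le y (z :: t)
    have h2 := card_symmDiff_triangle x.1 y.1 z.1
    simp only [toggles₂, toggles] at *
    omega

lemma toggles_tail_le (x : Finset ι × ℕ) (l) : toggles l ≤ toggles (x :: l) := by
  cases l with
  | nil => simp [toggles]
  | cons y t => simp [toggles]

lemma changes_le_toggles : ∀ l : List (Finset ι × ℕ), changes l ≤ toggles l
  | [] => le_rfl
  | [_] => le_rfl
  | x :: y :: t => by
    have := changes_le_toggles (y :: t)
    simp only [changes, toggles]
    split_ifs with h
    · omega
    · have : 0 < (symmDiff x.1 y.1).card := by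
        rw [Finset.card_pos, Finset.nonempty_iff_ne_empty]
        exact fun h' => h (symmDiff_eq_bot.1 h')
      omega

/-- A run of an element has two ends, each of which is at most one change. A run that contains the
first entry has only one end inside the list, and this leaves room for the summand `x.1.card`. In
the induction step both sides grow by `2 * (x.1 \ y.1).card` or less on the left. -/
lemma toggles_le_runs {U : Finset ι} : ∀ (x : Finset ι × ℕ) (l : List (Finset ι × ℕ)),
    (∀ y ∈ x :: l, y.1 ⊆ U) →
    toggles (x :: l) + x.1.card ≤ 2 * ∑ v ∈ U, runs (fun y => v ∈ y.1) (x :: l)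
  | x, [], h => by
    classical
    have hx := h x (by simp)
    have : ∑ v ∈ U, runs (fun y : Finset ι × ℕ => v ∈ y.1) [x] = x.1.card := by
      simp only [runs, List.head?_nil]
      simp only [Option.mem_def, reduceCtorEq, false_and, exists_false, not_false_eq_true, and_true,
        zero_add]
      rw [← Finset.sum_filter, Finset.sum_const, smul_eq_mul, mul_one,
        Finset.filter_mem_eq_inter, Finset.inter_eq_right.2 hx]
    rw [this]; simp [toggles]; omega
  | x, y :: t, h => by
    classical
    have ih := toggles_le_runs y t fun z hz => h z (List.mem_cons_of_mem _ hz)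
    have hx := h x (by simp)
    have hy := h y (by simp)
    have e : ∑ v ∈ U, runs (fun z : Finset ι × ℕ => v ∈ z.1) (x :: y :: t) =
        ∑ v ∈ U, runs (fun z : Finset ι × ℕ => v ∈ z.1) (y :: t) + (x.1 \ y.1).card := by
      have : ∀ v, runs (fun z : Finset ι × ℕ => v ∈ z.1) (x :: y :: t) =
          runs (fun z : Finset ι × ℕ => v ∈ z.1) (y :: t) + if v ∈ x.1 \ y.1 then 1 else 0 := by
        intro v
        rw [runs]
        by_cases hv : v ∈ x.1 \ y.1
        · rw [if_pos hv, if_pos (by simpa using hv)]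
        · rw [if_neg hv, if_neg (by simpa using hv)]
      simp only [this]
      rw [Finset.sum_add_distrib, ← Finset.sum_filter, Finset.sum_const, smul_eq_mul, mul_one,
        Finset.filter_mem_eq_inter, Finset.inter_eq_right.2 (Finset.sdiff_subset.trans hx)]
    rw [e, toggles]
    have h1 : (symmDiff x.1 y.1).card ≤ (x.1 \ y.1).card + (y.1 \ x.1).card :=
      Finset.card_union_le _ _
    have h2 := Finset.card_sdiff_add_card_inter x.1 y.1
    have h3 := Finset.card_sdiff_add_card_inter y.1 x.1
    rw [Finset.inter_comm] at h3
    omega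

end Toggles

/-! ### A tree whose nodes encode sequences of pairs -/

namespace Tree

/-- The state of a machine with two pairs `(z₀, a₀)`, `(z₁, a₁)`, of which number `sel` is the current
one and the other one can be changed. -/
structure Nd : Type where
  sel : ℕ
  b : ℕ
  z₀ : ℕ
  z₁ : ℕ
  a₀ : ℕ
  a₁ : ℕ

def Nd.cur (s : Nd) : ℕ × ℕ := if s.sel = 0 then (s.z₀, s.a₀) else (s.z₁, s.a₁)

def Nd.oth (s : Nd) : ℕ × ℕ := if s.sel = 0 then (s.z₁, s.a₁) else (s.z₀, s.a₀)

/-- The operations of the machine. -/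
def Nd.step (d : ℕ) (s : Nd) : Nd where
  sel := if d = 2 then 1 - s.sel else s.sel
  b := if d = 3 then s.b + s.b else if d < 3 then s.b else 1
  z₀ := if s.sel = 0 then s.z₀ else if d < 4 then s.z₀ else if d = 4 then s.z₀ + s.b else s.z₀ - s.b
  z₁ := if s.sel = 0 then if d < 4 then s.z₁ else if d = 4 then s.z₁ + s.b else s.z₁ - s.b else s.z₁
  a₀ := if s.sel = 0 then s.a₀ else if d = 0 then s.a₀ + 1 else if d = 1 then s.a₀ - 1 else s.a₀
  a₁ := if s.sel = 0 then if d = 0 then s.a₁ + 1 else if d = 1 then s.a₁ - 1 else s.a₁ else s.a₁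

def par (w : ℕ) : ℕ := if w < 2 then 0 else (w - 2) / 6 + 1

def dig (w : ℕ) : ℕ := (w - 2) % 6

lemma par_lt {w : ℕ} (h : w ≠ 0) : par w < w := by unfold par; split_ifs <;> omega

lemma par_le (w : ℕ) : par w ≤ w := by unfold par; split_ifs <;> omega

/-- The machine state at a node; node `1` is the root and node `0` stands for the missing parent. -/
def nd (w : ℕ) : Nd :=
  if w < 2 then ⟨0, 1, 0, 0, 0, 0⟩ else (nd (par w)).step (dig w)
termination_by w
decreasing_by exact par_lt (by omega)

/-- The current pairs on the way from a node to the root. -/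
def path (w : ℕ) : List (ℕ × ℕ) :=
  if w = 0 then [] else (nd w).cur :: path (par w)
termination_by w
decreasing_by exact par_lt (by assumption)

lemma path_zero : path 0 = [] := by rw [path]; simp

lemma path_pos {w : ℕ} (h : w ≠ 0) : path w = (nd w).cur :: path (par w) := by
  rw [path, if_neg h]

lemma nd_small {w : ℕ} (h : w < 2) : nd w = ⟨0, 1, 0, 0, 0, 0⟩ := by rw [nd, if_pos h]

lemma nd_big {w : ℕ} (h : 2 ≤ w) : nd w = (nd (par w)).step (dig w) := by
  rw [nd, if_neg (by omega)]

lemma path_one : path 1 = [(0, 0)] := by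
  rw [path_pos one_ne_zero, nd_small (by omega), show par 1 = 0 from rfl, path_zero]; rfl

/-- The numbering is by levels: the six children of node `p` follow those of node `p - 1`. Hence
`par` is a division by `6`, and nodes up to depth `t` have numbers below `2 * 6 ^ t`. -/
def child (p d : ℕ) : ℕ := 6 * (p - 1) + d + 2

lemma par_child {p d : ℕ} (hp : p ≠ 0) (hd : d < 6) : par (child p d) = p := by
  unfold par child; split_ifs <;> omega

lemma nd_child {p d : ℕ} (hp : p ≠ 0) (hd : d < 6) : nd (child p d) = (nd p).step d := by
  rw [nd_big (by unfold child; omega), par_child hp hd]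
  congr 1
  unfold dig child; omega

lemma path_child {p d : ℕ} (hp : p ≠ 0) (hd : d < 6) :
    path (child p d) = ((nd p).step d).cur :: path p := by
  rw [path_pos (by unfold child; omega), par_child hp hd, nd_child hp hd]

/-- Node `w` has the given current and other pair and the given value of `b`; its path is a stretching
of `l`; and it is found at most `t` levels below the root. -/
structure At (w : ℕ) (c o : ℕ × ℕ) (b : ℕ) (l : List (ℕ × ℕ)) (t : ℕ) : Prop where
  pos : w ≠ 0
  cur : (nd w).cur = c
  oth : (nd w).oth = o
  b : (nd w).b = b
  sel : (nd w).sel ≤ 1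
  str : Stretch (path w) l
  le : w + 1 ≤ 2 * 6 ^ t

namespace At

variable {w b t : ℕ} {c o : ℕ × ℕ} {l : List (ℕ × ℕ)}

lemma child_le (h : At w c o b l t) {d : ℕ} (hd : d < 6) : child w d + 1 ≤ 2 * 6 ^ (t + 1) := by
  have := h.le
  have := h.pos
  rw [pow_succ]
  unfold child
  omega

lemma head (h : At w c o b l t) : ∃ l', l = c :: l' := by
  have := h.str.head?
  rw [path_pos h.pos, h.cur, List.head?_cons] at this
  cases l with
  | nil => simp at this
  | cons x l' => simp at this; exact ⟨l', by rw [this]⟩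

/-- Every operation other than the swap leaves the current pair alone, so the path only repeats its
head and still stretches `l`. -/
lemma keep (h : At w c o b l t) {d : ℕ} (hd : d < 6) (hd2 : d ≠ 2) {o' : ℕ × ℕ} {b' : ℕ}
    (ho : ((nd w).step d).oth = o') (hb : ((nd w).step d).b = b') :
    At (child w d) c o' b' l (t + 1) := by
  have hc : ((nd w).step d).cur = c := by
    rw [← h.cur]
    by_cases hs : (nd w).sel = 0 <;> simp [Nd.step, Nd.cur, hd2, hs]
  refine ⟨by unfold child; omega, by rw [nd_child h.pos hd, hc], by rw [nd_child h.pos hd, ho],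
    by rw [nd_child h.pos hd, hb], ?_, ?_, h.child_le hd⟩
  · rw [nd_child h.pos hd]; simpa [Nd.step, hd2] using h.sel
  · rw [path_child h.pos hd, hc]
    obtain ⟨l', rfl⟩ := h.head
    exact h.str.dup

lemma inc (h : At w c o b l t) : At (child w 0) c (o.1, o.2 + 1) b l (t + 1) := by
  refine h.keep (by omega) (by omega) ?_ ?_
  · rw [← h.oth]; by_cases hs : (nd w).sel = 0 <;> simp [Nd.step, Nd.oth, hs]
  · rw [← h.b]; simp [Nd.step]

lemma dec (h : At w c o b l t) : At (child w 1) c (o.1, o.2 - 1) b l (t + 1) := by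
  refine h.keep (by omega) (by omega) ?_ ?_
  · rw [← h.oth]; by_cases hs : (nd w).sel = 0 <;> simp [Nd.step, Nd.oth, hs]
  · rw [← h.b]; simp [Nd.step]

lemma dbl (h : At w c o b l t) : At (child w 3) c o (b + b) l (t + 1) := by
  refine h.keep (by omega) (by omega) ?_ ?_
  · rw [← h.oth]; by_cases hs : (nd w).sel = 0 <;> simp [Nd.step, Nd.oth, hs]
  · rw [← h.b]; simp [Nd.step]

lemma addb (h : At w c o b l t) : At (child w 4) c (o.1 + b, o.2) 1 l (t + 1) := by
  refine h.keep (by omega) (by omega) ?_ ?_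
  · rw [← h.oth, ← h.b]; by_cases hs : (nd w).sel = 0 <;> simp [Nd.step, Nd.oth, hs]
  · simp [Nd.step]

lemma subb (h : At w c o b l t) : At (child w 5) c (o.1 - b, o.2) 1 l (t + 1) := by
  refine h.keep (by omega) (by omega) ?_ ?_
  · rw [← h.oth, ← h.b]; by_cases hs : (nd w).sel = 0 <;> simp [Nd.step, Nd.oth, hs]
  · simp [Nd.step]

/-- Only the swap lets the path represent a new entry. The pair prepared in the background becomes
current, and the previous entry becomes the pair to be prepared next. -/
lemma swap (h : At w c o b l t) : At (child w 2) o c b (o :: l) (t + 1) := by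
  have hs : (nd w).sel = 0 ∨ (nd w).sel = 1 := by have := h.sel; omega
  have hc : ((nd w).step 2).cur = o := by
    rw [← h.oth]
    rcases hs with hs | hs <;> simp [Nd.step, Nd.cur, Nd.oth, hs]
  refine ⟨by unfold child; omega, by rw [nd_child h.pos (by omega), hc], ?_, ?_, ?_, ?_,
    h.child_le (by omega)⟩
  · rw [nd_child h.pos (by omega), ← h.cur]
    rcases hs with hs | hs <;> simp [Nd.step, Nd.cur, Nd.oth, hs]
  · rw [nd_child h.pos (by omega), ← h.b]; simp [Nd.step]
  · rw [nd_child h.pos (by omega)]; simp [Nd.step]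
  · rw [path_child h.pos (by omega), hc]; exact h.str.new

lemma mono (h : At w c o b l t) {t' : ℕ} (ht : t ≤ t') : At w c o b l t' :=
  ⟨h.pos, h.cur, h.oth, h.b, h.sel, h.str,
    h.le.trans (Nat.mul_le_mul_left _ (Nat.pow_le_pow_right (by omega) ht))⟩

lemma incs (h : At w c o b l t) (n : ℕ) : ∃ w', At w' c (o.1, o.2 + n) b l (t + n) := by
  induction n with
  | zero => exact ⟨w, h⟩
  | succ n ih => obtain ⟨w', h'⟩ := ih; exact ⟨_, h'.inc⟩

lemma decs (h : At w c o b l t) (n : ℕ) : ∃ w', At w' c (o.1, o.2 - n) b l (t + n) := by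
  induction n with
  | zero => exact ⟨w, h⟩
  | succ n ih => obtain ⟨w', h'⟩ := ih; exact ⟨_, h'.dec⟩

lemma dbls (h : At w c o 1 l t) (n : ℕ) : ∃ w', At w' c o (2 ^ n) l (t + n) := by
  induction n with
  | zero => exact ⟨w, h⟩
  | succ n ih =>
    obtain ⟨w', h'⟩ := ih
    refine ⟨child w' 3, ?_⟩
    rw [pow_succ, mul_two]
    exact h'.dbl

lemma change (h : At w c o b l t) (a : ℕ) :
    ∃ w', At w' c (o.1, a) b l (t + ndist a o.2) := by
  by_cases ha : o.2 ≤ a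
  · obtain ⟨w', h'⟩ := h.incs (a - o.2)
    rw [Nat.add_sub_cancel' ha] at h'
    exact ⟨w', h'.mono (by unfold ndist; omega)⟩
  · obtain ⟨w', h'⟩ := h.decs (o.2 - a)
    rw [show o.2 - (o.2 - a) = a by omega] at h'
    exact ⟨w', h'.mono (by unfold ndist; omega)⟩

variable {ι : Type*} [DecidableEq ι]

/-- The number that encodes a finite set. -/
def _root_.Tree.enc (sl : ι → ℕ) (C : Finset ι) : ℕ := ∑ v ∈ C, 2 ^ sl v

/-- Toggling the element `v` takes `sl v` doublings of `b` and one addition or subtraction of `b = 2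
^ sl v`, which also resets `b` to `1`; this is at most `m` operations. -/
lemma toggle_all {m : ℕ} (sl : ι → ℕ) (C' : Finset ι) : ∀ (n : ℕ) (C : Finset ι),
    (symmDiff C' C).card = n → (∀ v ∈ symmDiff C' C, sl v < m) → ∀ (w a t : ℕ),
    At w c (enc sl C, a) 1 l t → ∃ w', At w' c (enc sl C', a) 1 l (t + m * n) := by
  intro n
  induction n with
  | zero =>
    intro C hC _ w a t h
    obtain rfl : C' = C := symmDiff_eq_bot.1 (by simpa using hC)
    exact ⟨w, h⟩
  | succ n ih =>
    intro C hC hm w a t h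
    obtain ⟨v, hv⟩ : (symmDiff C' C).Nonempty := Finset.card_pos.1 (by omega)
    have hvm := hm v hv
    obtain ⟨w1, h1⟩ := h.dbls (sl v)
    by_cases hvC : v ∈ C
    · have e : symmDiff C' (C.erase v) = (symmDiff C' C).erase v := by
        ext x
        have : v ∉ C' := by
          rcases Finset.mem_symmDiff.1 hv with h | h
          · exact absurd hvC h.2
          · exact h.2
        simp only [Finset.mem_symmDiff, Finset.mem_erase]
        by_cases hx : x = v
        · subst hx; simp [this]
        · simp [hx]
      have h2 := h1.subb
      have e2 : enc sl C - 2 ^ sl v = enc sl (C.erase v) := by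
        unfold enc; rw [← Finset.sum_erase_add _ _ hvC]; omega
      simp only [e2] at h2
      obtain ⟨w', h'⟩ := ih (C.erase v) (by rw [e, Finset.card_erase_of_mem hv]; omega)
        (fun x hx => hm x (Finset.mem_of_mem_erase (by rwa [e] at hx))) _ _ _ h2
      exact ⟨w', h'.mono (by rw [mul_add]; omega)⟩
    · have e : symmDiff C' (insert v C) = (symmDiff C' C).erase v := by
        ext x
        have : v ∈ C' := by
          rcases Finset.mem_symmDiff.1 hv with h | h
          · exact h.1
          · exact absurd h.1 hvC
        simp only [Finset.mem_symmDiff, Finset.mem_erase, Finset.mem_insert]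
        by_cases hx : x = v
        · subst hx; simp [this]
        · simp [hx]
      have h2 := h1.addb
      have e2 : enc sl C + 2 ^ sl v = enc sl (insert v C) := by
        unfold enc; rw [Finset.sum_insert hvC]; omega
      simp only [e2] at h2
      obtain ⟨w', h'⟩ := ih (insert v C) (by rw [e, Finset.card_erase_of_mem hv]; omega)
        (fun x hx => hm x (Finset.mem_of_mem_erase (by rwa [e] at hx))) _ _ _ h2
      exact ⟨w', h'.mono (by rw [mul_add]; omega)⟩

end At

variable {ι : Type*} [DecidableEq ι]

/-- Encoding of the first component. -/
def encP (sl : ι → ℕ) (x : Finset ι × ℕ) : ℕ × ℕ := (enc sl x.1, x.2)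

/-- The machine starts with two empty pairs, whence the two final entries `(∅, 0)`. To prepend an
entry, the background pair, which holds the entry two places further on, has to be transformed into
it. This is why the cost is measured by differences two places apart. -/
lemma exists_at {m : ℕ} (sl : ι → ℕ) : ∀ (l : List (Finset ι × ℕ)),
    (∀ x ∈ l, ∀ v ∈ x.1, sl v < m) → ∀ y z t, l ++ [(∅, 0), (∅, 0)] = y :: z :: t →
    ∃ w, At w (encP sl y) (encP sl z) 1 ((l ++ [(∅, 0)]).map (encP sl))
      (m * toggles₂ (y :: z :: t) + zcost ((y :: z :: t).map Prod.snd))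
  | [], _, y, z, t, h => by
    simp only [List.nil_append, List.cons.injEq] at h
    obtain ⟨rfl, rfl, rfl⟩ := h
    refine ⟨1, one_ne_zero, ?_, ?_, ?_, ?_, ?_, ?_⟩
    · simp [nd_small, Nd.cur, encP, enc]
    · simp [nd_small, Nd.oth, encP, enc]
    · simp [nd_small]
    · simp [nd_small]
    · rw [path_one]; simpa [encP, enc] using Stretch.refl [((0 : ℕ), (0 : ℕ))]
    · have := Nat.one_le_pow (m * toggles₂ [((∅ : Finset ι), 0), (∅, 0)] +
        zcost ([((∅ : Finset ι), 0), (∅, 0)].map Prod.snd)) 6 (by omega)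
      omega
  | x :: l, hl, y, z, t, h => by
    obtain ⟨u, v, s, hs⟩ : ∃ u v s, l ++ [((∅ : Finset ι), 0), (∅, 0)] = u :: v :: s := by
      cases l with
      | nil => exact ⟨_, _, _, rfl⟩
      | cons a l =>
        cases l with
        | nil => exact ⟨_, _, _, rfl⟩
        | cons b l => exact ⟨_, _, _, rfl⟩
    have hl' : ∀ x ∈ l, ∀ v ∈ x.1, sl v < m := fun y hy => hl y (List.mem_cons_of_mem _ hy)
    obtain ⟨w, hw⟩ := exists_at sl l hl' u v s hs
    rw [List.cons_append, hs] at h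
    simp only [List.cons.injEq] at h
    obtain ⟨rfl, rfl, rfl⟩ := h
    have hm : ∀ a ∈ symmDiff x.1 v.1, sl a < m := by
      intro a ha
      rcases Finset.mem_symmDiff.1 ha with h | h
      · exact hl x (by simp) a h.1
      · have : v ∈ l ++ [((∅ : Finset ι), 0), (∅, 0)] := by rw [hs]; simp
        rcases List.mem_append.1 this with h1 | h1
        · exact hl' v h1 a h.1
        · have : v.1 = ∅ := by simp at h1; simp [h1]
          rw [this] at h; simp at h
    -- Here `u` is current and `v` is in the background. The latter is turned into `x`, and the swap
    -- adds the summand `1` of `zcost`.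
    obtain ⟨w1, h1⟩ := At.toggle_all sl x.1 _ v.1 rfl hm w v.2 _ hw
    obtain ⟨w2, h2⟩ := h1.change x.2
    refine ⟨_, h2.swap.mono ?_⟩
    simp only [toggles₂, List.map_cons, zcost, mul_add]
    omega

/-- Every sequence of pairs with few changes is equivalent to the path of a node of small number. -/
theorem exists_node {m K : ℕ} (sl : ι → ℕ) {U : Finset ι} (hsl : ∀ v ∈ U, sl v < m)
    (hcard : U.card ≤ m) (l : List (Finset ι × ℕ)) (hlast : l.getLast? = some (∅, 0))
    (hU : ∀ y ∈ l, y.1 ⊆ U) (hK : ∀ y ∈ l, y.2 ≤ K)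
    (hruns : ∀ v ∈ U, runs (fun y => v ∈ y.1) l = 1) :
    ∃ w, 1 ≤ w ∧ w ≤ 2 ^ (91 * (m + K + 1) ^ 2) ∧ Sim PairLe (l.map (encP sl)) (path w) := by
  have h0 : l ≠ [] := by rintro rfl; simp at hlast
  obtain ⟨l', hs, hz⟩ := exists_short_pairs _ l le_rfl h0 hK
  -- Similarity preserves the last entry up to `PairLe` in both directions, and below second
  -- component `0` there is nothing else.
  have hlast' : l'.getLast? = some (∅, 0) := by
    obtain ⟨y, hy, h1, h2⟩ := hs.1.getLast? hlast
    obtain ⟨x, hx, h3, h4⟩ := hs.2.getLast? hy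
    rw [hlast, Option.some_inj] at hx
    subst hx
    rw [hy]
    exact congrArg _ (Prod.ext h1.symm (by simpa using h4))
  obtain ⟨s, rfl⟩ : ∃ s, l' = s ++ [((∅ : Finset ι), 0)] := by
    refine ⟨l'.dropLast, ?_⟩
    exact (List.dropLast_append_getLast? _ hlast').symm
  have hU' : ∀ y ∈ s ++ [((∅ : Finset ι), 0)], y.1 ⊆ U := by
    intro y hy
    obtain ⟨x, hx, h⟩ := hs.2.exists_right hy
    rw [h.1]; exact hU x hx
  have hK' : ∀ y ∈ s ++ [((∅ : Finset ι), 0)], y.2 ≤ K := by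
    intro y hy
    obtain ⟨x, hx, h⟩ := hs.2.exists_right hy
    exact h.2.trans (hK x hx)
  -- The second copy of the last entry is a mere repetition, and similar lists have equal first
  -- components, so the numbers of runs are those of `l`.
  have hr' : ∀ v ∈ U, runs (fun y => v ∈ y.1) (s ++ [((∅ : Finset ι), 0), (∅, 0)]) = 1 := by
    intro v hv
    have := (Stretch.refl (s ++ [((∅ : Finset ι), 0)])).snoc hlast'
    rw [List.append_assoc] at this
    rw [← hruns v hv, hs.1.runs_eq (q := fun y => v ∈ y.1) fun x y h => by rw [h.1]]
    exact this.runs_eq _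
  have hch : changes l ≤ 2 * m := by
    obtain ⟨x, t, rfl⟩ := List.exists_cons_of_ne_nil h0
    have h1 := toggles_le_runs x t hU
    have h2 := changes_le_toggles (x :: t)
    rw [Finset.sum_congr rfl hruns] at h1
    simp at h1
    omega
  have htog : toggles₂ (s ++ [((∅ : Finset ι), 0), (∅, 0)]) ≤ 4 * m := by
    obtain ⟨x, t, hx⟩ := List.exists_cons_of_ne_nil
      (show s ++ [((∅ : Finset ι), 0), (∅, 0)] ≠ [] by simp)
    have hUx : ∀ y ∈ x :: t, y.1 ⊆ U := by
      rw [← hx]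
      intro y hy
      simp only [List.mem_append, List.mem_cons, List.not_mem_nil, or_false, or_self] at hy
      exact hU' y (by simpa using hy)
    have h1 := toggles_le_runs x t hUx
    rw [← hx, Finset.sum_congr rfl hr'] at h1
    have h2 := toggles₂_le x t
    have h3 := toggles_tail_le x t
    rw [← hx] at h2 h3
    simp at h1
    omega
  obtain ⟨y, z, t, hyz⟩ : ∃ u v r, s ++ [((∅ : Finset ι), 0), (∅, 0)] = u :: v :: r := by
    cases s with
    | nil => exact ⟨_, _, _, rfl⟩
    | cons a l =>
      cases l with
      | nil => exact ⟨_, _, _, rfl⟩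
      | cons b l => exact ⟨_, _, _, rfl⟩
  obtain ⟨w, hw⟩ := exists_at (m := m) sl s
    (fun x hx v hv => hsl v (hU' x (List.mem_append_left _ hx) hv)) y z t hyz
  have hzc : zcost ((s ++ [((∅ : Finset ι), 0), (∅, 0)]).map Prod.snd) ≤
      (2 * m + 1) * (8 * K + 6) + 2 * K + 1 := by
    have e : (s ++ [((∅ : Finset ι), 0), (∅, 0)]).map Prod.snd =
      (s ++ [((∅ : Finset ι), 0)]).map Prod.snd ++ [0] := by simp
    rw [e]
    have h1 := zcost_append (K := K) ((s ++ [((∅ : Finset ι), 0)]).map Prod.snd) [0] (by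
      intro x hx
      obtain ⟨p, hp, rfl⟩ := List.mem_map.1 hx
      exact hK' p hp) (by simp)
    have h2 : (changes l + 1) * (8 * K + 6) ≤ (2 * m + 1) * (8 * K + 6) :=
      Nat.mul_le_mul_right _ (by omega)
    have h3 : zcost [0] = 1 := rfl
    omega
  refine ⟨w, Nat.one_le_iff_ne_zero.2 hw.pos, ?_, ?_⟩
  -- The depth is at most `4 * m ^ 2` for the sets plus `(2 * m + 1) * (8 * K + 6) + 2 * K + 1` for
  -- the sizes. With `6 ≤ 2 ^ 3` the bound `30` for the depth becomes `90` in the exponent of `2`,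
  -- and one more absorbs the factor `2`.
  · have hT : m * toggles₂ (y :: z :: t) + zcost ((y :: z :: t).map Prod.snd) ≤
        30 * (m + K + 1) ^ 2 := by
      rw [← hyz]
      have := Nat.mul_le_mul_left m htog
      nlinarith
    have h1 := (hw.mono hT).le
    have h2 : 2 * 6 ^ (30 * (m + K + 1) ^ 2) ≤ 2 ^ (91 * (m + K + 1) ^ 2) := by
      have hq : 1 ≤ (m + K + 1) ^ 2 := Nat.one_le_pow _ _ (by omega)
      calc 2 * 6 ^ (30 * (m + K + 1) ^ 2) ≤ 2 * 8 ^ (30 * (m + K + 1) ^ 2) :=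
            Nat.mul_le_mul_left _ (Nat.pow_le_pow_left (by omega) _)
        _ = 2 ^ (90 * (m + K + 1) ^ 2 + 1) := by
            rw [show (8 : ℕ) = 2 ^ 3 by norm_num, ← pow_mul, pow_succ, mul_comm 2]
            congr 2; ring
        _ ≤ _ := Nat.pow_le_pow_right (by omega) (by omega)
    omega
  · have h1 : Sim PairLe (l.map (encP sl)) ((s ++ [((∅ : Finset ι), 0)]).map (encP sl)) :=
      ⟨hs.1.map _ _ fun x y h => ⟨by simp [encP, h.1], h.2⟩,
        hs.2.map _ _ fun x y h => ⟨by simp [encP, h.1], h.2⟩⟩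
    refine h1.trans PairLe.trans ?_
    have hst := hw.str
    constructor
    · refine Dom.of_zip (z := (path w).map fun x => (x, x)) ?_ ?_ ?_
      · intro p hp
        obtain ⟨x, _, rfl⟩ := List.mem_map.1 hp
        exact PairLe.rfl' _
      · simpa [Function.comp_def] using hst
      · simpa [Function.comp_def] using Stretch.refl _
    · refine Dom.of_zip (z := (path w).map fun x => (x, x)) ?_ ?_ ?_
      · intro p hp
        obtain ⟨x, _, rfl⟩ := List.mem_map.1 hp
        exact PairLe.rfl' _
      · simpa [Function.comp_def] using Stretch.refl _
      · simpa [Function.comp_def] using hst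

end Tree

section PartialSolutions

/-! ### Partial solutions -/

open Tree

/-! ### Binary digits of encoded sets -/

section Bits

/-- The digit of `z` with place value `b`, a power of two. -/
def digit (b z : ℕ) : ℕ := z / b % 2

/-- Sets the digit with place value `b` to zero. -/
def clr (b z : ℕ) : ℕ := if digit b z = 0 then z else z - b

lemma digit_le (b z : ℕ) : digit b z ≤ 1 := by unfold digit; omega

variable {V : Type*} [DecidableEq V]

lemma digit_enc {sl : V → ℕ} {X C : Finset V} (hsl : Set.InjOn sl X) (hC : C ⊆ X) {v : V}
    (hv : v ∈ X) : digit (2 ^ sl v) (enc sl C) = if v ∈ C then 1 else 0 := by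
  have h1 : enc sl C = ∑ i ∈ C.image sl, 2 ^ i := by
    unfold enc
    rw [Finset.sum_image]
    exact fun a ha b hb h => hsl (hC ha) (hC hb) h
  have h2 : (enc sl C).testBit (sl v) = true ↔ v ∈ C := by
    rw [← Nat.mem_bitIndices, ← List.mem_toFinset, h1, Finset.toFinset_bitIndices_sum_two_pow,
      Finset.mem_image]
    constructor
    · rintro ⟨w, hw, h⟩
      rwa [← hsl (hC hw) hv h]
    · exact fun h => ⟨v, h, rfl⟩
  rw [Nat.testBit_eq_decide_div_mod_eq, decide_eq_true_iff] at h2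
  unfold digit
  split_ifs with h
  · exact h2.2 h
  · exact (Nat.mod_two_eq_zero_or_one _).resolve_right fun h' => h (h2.1 h')

lemma clr_enc {sl : V → ℕ} {X C : Finset V} (hsl : Set.InjOn sl X) (hC : C ⊆ X) {v : V}
    (hv : v ∈ X) : clr (2 ^ sl v) (enc sl C) = enc sl (C.erase v) := by
  unfold clr
  rw [digit_enc hsl hC hv]
  by_cases h : v ∈ C
  · simp only [h, if_true, one_ne_zero, if_false]
    unfold enc
    rw [← Finset.sum_erase_add _ _ h]; omega
  · simp [h]

end Bits

lemma Tree.path_getLast {w : ℕ} (h : w ≠ 0) : (path w).getLast? = some (0, 0) := by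
  induction w using Nat.strong_induction_on with
  | _ w ih =>
    by_cases h1 : w = 1
    · subst h1; rw [path_one]; rfl
    · have hp : par w ≠ 0 := by unfold par; split_ifs <;> omega
      rw [path_pos h, List.getLast?_cons, ih _ (par_lt h) hp]; rfl

/-! ### Sequences of bags and the invariant of the dynamic programming -/

variable {V : Type*} [DecidableEq V]

/-- A sequence of bags, all of them subsets of `S` with at most `K` elements, in which every element of
`S` has exactly one interval of occurrences, and which covers the edges `E`. The first bag, which is the
last entry of the list, is empty. -/
structure BagSeq (S : Finset V) (E : V → V → Prop) (K : ℕ) (l : List (Finset V)) : Prop where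
  sub : ∀ B ∈ l, B ⊆ S
  card : ∀ B ∈ l, B.card ≤ K
  runs : ∀ v ∈ S, runs (fun B => v ∈ B) l = 1
  edge : ∀ u v, E u v → ∃ B ∈ l, u ∈ B ∧ v ∈ B
  last : l.getLast? = some ∅

/-- What remains of a bag if only the vertices of `X` can be told apart. -/
def trace (X : Finset V) (sl : V → ℕ) (B : Finset V) : ℕ × ℕ := encP sl (B ∩ X, B.card)

/-- The nodes in `R` represent the sequences of bags, up to domination. -/
structure Good (K N : ℕ) (S : Finset V) (E : V → V → Prop) (X : Finset V) (sl : V → ℕ)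
    (R : ℕ → Prop) : Prop where
  sound : ∀ t, t ≠ 0 → t ≤ N → R t →
    ∃ l, BagSeq S E K l ∧ Dom PairLe (l.map (trace X sl)) (path t)
  complete : ∀ l, BagSeq S E K l →
    ∃ t, t ≠ 0 ∧ t ≤ N ∧ R t ∧ Dom PairLe (path t) (l.map (trace X sl))

/-- Since `X ⊆ S`, every vertex of `X` has exactly one run in the sequence of traces, so that
`Tree.exists_node` applies. -/
lemma BagSeq.exists_node {S : Finset V} {E : V → V → Prop} {K m : ℕ} {l : List (Finset V)}
    (h : BagSeq S E K l) {X : Finset V} (hX : X ⊆ S) {sl : V → ℕ} (hsl : ∀ v ∈ X, sl v < m)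
    (hm : X.card ≤ m) : ∃ t, t ≠ 0 ∧ t ≤ 2 ^ (91 * (m + K + 1) ^ 2) ∧
      Sim PairLe (l.map (trace X sl)) (path t) := by
  obtain ⟨t, h1, h2, h3⟩ := Tree.exists_node (K := K) sl hsl hm
    (l.map fun B => (B ∩ X, B.card)) (by simp [List.getLast?_map, h.last])
    (by
      intro y hy
      obtain ⟨B, _, rfl⟩ := List.mem_map.1 hy
      exact Finset.inter_subset_right)
    (by
      intro y hy
      obtain ⟨B, hB, rfl⟩ := List.mem_map.1 hy
      exact h.card B hB)
    (by
      intro v hv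
      rw [runs_map, ← h.runs v (hX hv)]
      exact runs_congr fun B _ => by simp [hv])
  refine ⟨t, by omega, h2, ?_⟩
  rwa [List.map_map] at h3

lemma Good.init {K N : ℕ} (hN : 1 ≤ N) (sl : V → ℕ) {R : ℕ → Prop} (hR : ∀ t, R t ↔ t = 1) :
    Good K N ∅ (fun _ _ => False) ∅ sl R := by
  constructor
  · intro t _ _ ht
    obtain rfl := (hR t).1 ht
    refine ⟨[∅], ⟨by simp, by simp, by simp, by simp, rfl⟩, ?_⟩
    rw [path_one]
    exact .both ⟨by simp [trace, encP, enc], by simp [trace, encP]⟩ .nil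
  · intro l hl
    refine ⟨1, one_ne_zero, hN, (hR 1).2 rfl, ?_⟩
    rw [path_one]
    have hall : ∀ B ∈ l, B = ∅ := fun B hB => Finset.subset_empty.1 (hl.sub B hB)
    have h0 : l ≠ [] := by rintro rfl; simpa using hl.last
    have aux : ∀ m : List (Finset V), m ≠ [] → (∀ B ∈ m, B = ∅) →
        Dom PairLe [((0 : ℕ), (0 : ℕ))] (m.map (trace ∅ sl)) := by
      intro m
      induction m with
      | nil => intro h; exact (h rfl).elim
      | cons B m ih =>
        intro _ hm
        have hB : PairLe ((0 : ℕ), (0 : ℕ)) (trace ∅ sl B) := ⟨by simp [trace, encP, enc], by simp⟩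
        by_cases hm0 : m = []
        · subst hm0; exact .both hB .nil
        · exact .right hB (ih hm0 fun C hC => hm C (List.mem_cons_of_mem _ hC))
    exact aux l h0 hall

lemma Good.congr {K N : ℕ} {S X : Finset V} {E E' : V → V → Prop} {sl : V → ℕ} {R R' : ℕ → Prop}
    (h : Good K N S E X sl R) (hR : ∀ t ≤ N, R t ↔ R' t)
    (hE : ∀ l, BagSeq S E K l ↔ BagSeq S E' K l) : Good K N S E' X sl R' := by
  constructor
  · intro t h0 ht hr
    obtain ⟨l, hl, hd⟩ := h.sound t h0 ht ((hR t ht).2 hr)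
    exact ⟨l, (hE l).1 hl, hd⟩
  · intro l hl
    obtain ⟨t, h0, ht, hr, hd⟩ := h.complete l ((hE l).2 hl)
    exact ⟨t, h0, ht, (hR t ht).1 hr, hd⟩

/-- The relation between entries before and after the introduction of a vertex with place value `b`. -/
def IntroRel (b K : ℕ) (x y : ℕ × ℕ) : Prop :=
  x.1 = clr b y.1 ∧ x.2 + digit b y.1 ≤ y.2 ∧ y.2 ≤ K

/-- The relation between entries before and after a vertex with place value `b` is forgotten. -/
def ForgetRel (b K : ℕ) (x y : ℕ × ℕ) : Prop :=
  clr b x.1 = y.1 ∧ x.2 ≤ y.2 ∧ y.2 ≤ K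

lemma trace_insert {X B : Finset V} {sl sl' : V → ℕ} {v : V}
    (hsl : ∀ u ∈ X, sl' u = sl u) : trace X sl (B.erase v) =
      (enc sl' ((B ∩ insert v X).erase v), (B.erase v).card) := by
  unfold trace encP
  refine Prod.ext ?_ rfl
  have : (B ∩ insert v X).erase v = B.erase v ∩ X := by
    ext x
    simp only [Finset.mem_erase, Finset.mem_inter, Finset.mem_insert]
    constructor
    · rintro ⟨h1, h2, h3 | h3⟩
      · exact absurd h3 h1
      · exact ⟨⟨h1, h2⟩, h3⟩
    · rintro ⟨⟨h1, h2⟩, h3⟩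
      exact ⟨h1, h2, Or.inr h3⟩
  simp only [this]
  exact Finset.sum_congr rfl fun u hu => by rw [hsl u (Finset.mem_inter.1 hu).2]

/-- The new vertex has no edges yet; these are added by `Good.edge`. A solution on `insert v S` is a
solution on `S`, with some repeated bags, to which `v` is added along one interval. The digit of `v`
in `path t` prescribes the interval, and the condition on `runs` says that it is one. -/
theorem Good.intro {K N m : ℕ} {S X : Finset V} {E : V → V → Prop} {sl sl' : V → ℕ} {R R' : ℕ → Prop}
    (h : Good K N S E X sl R) (hXS : X ⊆ S) {v : V} (hv : v ∉ S) (hE : ∀ u w, E u w → u ∈ S ∧ w ∈ S)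
    (hsl : ∀ u ∈ X, sl' u = sl u) (hinj : Set.InjOn sl' (insert v X : Finset V))
    (hm : ∀ u ∈ insert v X, sl' u < m) (hcard : (insert v X).card ≤ m)
    (hN : 2 ^ (91 * (m + K + 1) ^ 2) ≤ N)
    (hR : ∀ t, t ≠ 0 → t ≤ N → (R' t ↔ runs (fun y => digit (2 ^ sl' v) y.1 = 1) (path t) = 1 ∧
      ∃ s, s ≠ 0 ∧ s ≤ N ∧ R s ∧ Dom (IntroRel (2 ^ sl' v) K) (path s) (path t))) :
    Good K N (insert v S) E (insert v X) sl' R' := by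
  have hvX : v ∉ X := fun h' => hv (hXS h')
  set b := 2 ^ sl' v with hb
  have hvi : v ∈ insert v X := Finset.mem_insert_self _ _
  have hdig : ∀ B : Finset V, digit b (trace (insert v X) sl' B).1 = if v ∈ B then 1 else 0 := by
    intro B
    have := digit_enc hinj (C := B ∩ insert v X) Finset.inter_subset_right hvi
    simpa [trace, encP] using this
  have hclr : ∀ B : Finset V, clr b (trace (insert v X) sl' B).1 = (trace X sl (B.erase v)).1 := by
    intro B
    rw [trace_insert hsl]
    exact clr_enc hinj (C := B ∩ insert v X) Finset.inter_subset_right hvi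
  constructor
  · intro t h0 ht hr
    obtain ⟨hruns, s, hs0, hs, hRs, hd⟩ := (hR t h0 ht).1 hr
    obtain ⟨l, hl, hdl⟩ := h.sound s hs0 hs hRs
    have hd2 : Dom (IntroRel b K) (l.map (trace X sl)) (path t) :=
      hdl.trans hd fun x y z h1 h2 => ⟨h1.1.trans h2.1, by have := h1.2; have := h2.2.1; omega, h2.2.2⟩
    have hd3 : Dom (fun B y => IntroRel b K (trace X sl B) y) l (path t) := by
      rw [← List.map_id (path t)] at hd2; exact hd2.of_map
    obtain ⟨z, hz, z1, z2⟩ := hd3.zip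
    have hzl : ∀ p ∈ z, p.1 ∈ l := fun p hp => (z1.mem_iff _).1 (List.mem_map_of_mem hp)
    have hvp : ∀ p ∈ z, v ∉ p.1 := fun p hp hvp => hv (hl.sub _ (hzl p hp) hvp)
    -- The old bags are matched with the entries of `path t`, and `v` is inserted where the entry
    -- demands it.
    set f : Finset V × (ℕ × ℕ) → Finset V :=
      fun p => if digit b p.2.1 = 1 then insert v p.1 else p.1 with hf
    have hfv : ∀ p ∈ z, (v ∈ f p ↔ digit b p.2.1 = 1) := by
      intro p hp
      simp only [hf]; split_ifs with hh <;> simp [hh, hvp p hp]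
    have hfe : ∀ p ∈ z, (f p).erase v = p.1 := by
      intro p hp
      simp only [hf]; split_ifs with hh <;> simp [hvp p hp]
    have hfsub : ∀ p, p.1 ⊆ f p := by
      intro p; simp only [hf]; split_ifs <;> simp
    have hfcard : ∀ p ∈ z, (f p).card = p.1.card + digit b p.2.1 := by
      intro p hp
      have := digit_le b p.2.1
      simp only [hf]; split_ifs with hh
      · rw [Finset.card_insert_of_notMem (hvp p hp), hh]
      · omega
    refine ⟨z.map f, ⟨?_, ?_, ?_, ?_, ?_⟩, ?_⟩
    · intro B hB
      obtain ⟨p, hp, rfl⟩ := List.mem_map.1 hB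
      have := hl.sub _ (hzl p hp)
      simp only [hf]; split_ifs
      · exact Finset.insert_subset_insert _ this
      · exact this.trans (Finset.subset_insert _ _)
    · intro B hB
      obtain ⟨p, hp, rfl⟩ := List.mem_map.1 hB
      rw [hfcard p hp]
      have := hz p hp
      exact this.2.1.trans this.2.2
    · intro u hu
      rw [runs_map]
      rcases Finset.mem_insert.1 hu with rfl | hu
      · rw [← hruns, ← z2.runs_eq, runs_map]
        exact runs_congr hfv
      · rw [← hl.runs u hu, ← z1.runs_eq, runs_map]
        refine runs_congr fun p hp => ?_
        have huv : u ≠ v := fun e => hv (e ▸ hu)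
        simp only [hf]; split_ifs <;> simp [huv]
    · intro u w huw
      obtain ⟨B, hB, h1, h2⟩ := hl.edge u w huw
      obtain ⟨p, hp, rfl⟩ := List.mem_map.1 ((z1.mem_iff B).2 hB)
      exact ⟨f p, List.mem_map_of_mem hp, hfsub p h1, hfsub p h2⟩
    -- The last matched pair consists of `∅` and the root entry `(0, 0)`, whose digit is `0`; hence
    -- the last bag remains empty.
    · have e1 := z1.getLast?
      rw [hl.last, List.getLast?_map, Option.map_eq_some_iff] at e1
      obtain ⟨p, hp, hp1⟩ := e1
      have e2 := z2.getLast?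
      rw [path_getLast h0, List.getLast?_map, hp] at e2
      simp only [Option.map_some, Option.some_inj] at e2
      rw [List.getLast?_map, hp, Option.map_some]
      simp [hf, hp1, e2, digit]
    · refine Dom.of_zip (z := z.map fun p => (trace (insert v X) sl' (f p), p.2)) ?_ ?_ ?_
      · intro q hq
        obtain ⟨p, hp, rfl⟩ := List.mem_map.1 hq
        obtain ⟨h1, h2, h3⟩ := hz p hp
        constructor
        · have e1 := hclr (f p)
          have e2 := hdig (f p)
          rw [hfe p hp, h1] at e1
          have e3 := hfv p hp
          have hle := digit_le b p.2.1
          dsimp only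
          set Z := (trace (insert v X) sl' (f p)).1
          -- Two numbers that have the same digit and become equal after clearing it are equal. This
          -- fact makes the truncated subtraction in `clr` exact.
          have hge : ∀ z, digit b z = 1 → b ≤ z := by
            intro z hz
            by_contra hlt
            unfold digit at hz
            rw [Nat.div_eq_of_lt (by omega)] at hz
            omega
          by_cases hd : digit b p.2.1 = 1
          · rw [if_pos (e3.2 hd)] at e2
            have := hge _ hd
            have := hge _ e2
            unfold clr at e1
            rw [if_neg (by omega), if_neg (by omega)] at e1
            omega
          · rw [if_neg (fun hh => hd (e3.1 hh))] at e2
            unfold clr at e1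
            rw [if_pos (by omega), if_pos (by omega)] at e1
            exact e1
        · change (f p).card ≤ p.2.2
          rw [hfcard p hp]; exact h2
      · simpa [Function.comp_def] using Stretch.refl _
      · simpa [Function.comp_def] using z2
  · intro l' hl'
    -- For completeness `v` is erased from a given solution. A marked `s` for the rest and a node
    -- `t` similar to the trace of `l'` are then related through `l'` itself.
    have hl : BagSeq S E K (l'.map fun B => B.erase v) := by
      refine ⟨?_, ?_, ?_, ?_, ?_⟩
      · intro B hB
        obtain ⟨C, hC, rfl⟩ := List.mem_map.1 hB
        exact Finset.subset_insert_iff.1 (hl'.sub C hC)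
      · intro B hB
        obtain ⟨C, hC, rfl⟩ := List.mem_map.1 hB
        exact (Finset.card_erase_le).trans (hl'.card C hC)
      · intro u hu
        rw [runs_map, ← hl'.runs u (Finset.mem_insert_of_mem hu)]
        have huv : u ≠ v := fun e => hv (e ▸ hu)
        exact runs_congr fun B _ => by simp [huv]
      · intro u w huw
        obtain ⟨B, hB, h1, h2⟩ := hl'.edge u w huw
        obtain ⟨hu, hw⟩ := hE u w huw
        exact ⟨_, List.mem_map_of_mem hB, by simp [h1, show u ≠ v from fun e => hv (e ▸ hu)],
          by simp [h2, show w ≠ v from fun e => hv (e ▸ hw)]⟩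
      · rw [List.getLast?_map, hl'.last]; rfl
    obtain ⟨s, hs0, hs, hRs, hds⟩ := h.complete _ hl
    obtain ⟨t, ht0, ht, hdt⟩ := hl'.exists_node (Finset.insert_subset_insert v hXS) hm hcard
    refine ⟨t, ht0, ht.trans hN, (hR t ht0 (ht.trans hN)).2 ⟨?_, s, hs0, hs, hRs, ?_⟩, hdt.2⟩
    · refine Eq.trans ?_ (hl'.runs v (Finset.mem_insert_self _ _))
      rw [← hdt.1.runs_eq
        (p := fun x => digit b x.1 = 1) (fun x y hxy => by rw [hxy.1]), runs_map]
      refine runs_congr fun B _ => ?_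
      rw [hdig]; split_ifs with hh <;> simp [hh]
    · have h1 : Dom (fun x B => PairLe x (trace X sl (B.erase v))) (path s) l' := by
        rw [List.map_map, ← List.map_id (path s)] at hds
        exact hds.of_map
      have h2 : Dom (fun B y => PairLe (trace (insert v X) sl' B) y) l' (path t) := by
        have := hdt.1
        rw [← List.map_id (path t)] at this
        exact this.of_map
      have h3 : Dom (fun x y => x.1 = clr b y.1 ∧ x.2 + digit b y.1 ≤ y.2) (path s) (path t) := by
        refine h1.trans h2 fun x B y h1 h2 => ⟨?_, ?_⟩
        · rw [h1.1, ← h2.1, hclr]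
        · rw [← h2.1, hdig]
          have e1 : x.2 ≤ (B.erase v).card := h1.2
          have e2 : B.card ≤ y.2 := h2.2
          split_ifs with hh
          · rw [Finset.card_erase_of_mem hh] at e1
            have := Finset.card_pos.2 ⟨v, hh⟩
            omega
          · rw [Finset.erase_eq_of_notMem hh] at e1
            omega
      -- The bound `y.2 ≤ K` comes from the other half of the similarity: every entry of `path t` is
      -- below the size of a bag of `l'`.
      refine h3.mono fun x y _ hy hxy => ⟨hxy.1, hxy.2, ?_⟩
      obtain ⟨q, hq, hyq⟩ := hdt.2.exists_right hy
      obtain ⟨B, hB, rfl⟩ := List.mem_map.1 hq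
      exact hyq.2.trans (hl'.card B hB)

/-- Both ends lie in `X`, so the traces show whether some bag contains both. Domination does not
alter the first components; hence the condition can be tested on `path t`. -/
theorem Good.edge {K N : ℕ} {S X : Finset V} {E E' : V → V → Prop} {sl : V → ℕ} {R R' : ℕ → Prop}
    (h : Good K N S E X sl R) (hinj : Set.InjOn sl X) {u v : V} (hu : u ∈ X) (hv : v ∈ X)
    (hE : ∀ a b, E' a b ↔ E a b ∨ (a = v ∧ b = u))
    (hR : ∀ t, t ≠ 0 → t ≤ N → (R' t ↔ R t ∧
      ∃ y ∈ path t, digit (2 ^ sl v) y.1 = 1 ∧ digit (2 ^ sl u) y.1 = 1)) :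
    Good K N S E' X sl R' := by
  have hdig : ∀ w ∈ X, ∀ B : Finset V, digit (2 ^ sl w) (trace X sl B).1 = 1 ↔ w ∈ B := by
    intro w hw B
    have := digit_enc hinj (C := B ∩ X) Finset.inter_subset_right hw
    unfold trace encP
    rw [this]
    simp [hw]
  constructor
  · intro t h0 ht hr
    obtain ⟨hRt, y, hy, h1, h2⟩ := (hR t h0 ht).1 hr
    obtain ⟨l, hl, hd⟩ := h.sound t h0 ht hRt
    refine ⟨l, ⟨hl.sub, hl.card, hl.runs, ?_, hl.last⟩, hd⟩
    intro a b hab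
    rcases (hE a b).1 hab with hab | ⟨rfl, rfl⟩
    · exact hl.edge a b hab
    · obtain ⟨x, hx, hxy⟩ := hd.exists_left hy
      obtain ⟨B, hB, rfl⟩ := List.mem_map.1 hx
      rw [← hxy.1] at h1 h2
      exact ⟨B, hB, (hdig _ hv B).1 h1, (hdig _ hu B).1 h2⟩
  · intro l hl
    obtain ⟨t, h0, ht, hRt, hd⟩ := h.complete l ⟨hl.sub, hl.card, hl.runs,
      fun a b hab => hl.edge a b ((hE a b).2 (Or.inl hab)), hl.last⟩
    refine ⟨t, h0, ht, (hR t h0 ht).2 ⟨hRt, ?_⟩, hd⟩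
    obtain ⟨B, hB, h1, h2⟩ := hl.edge v u ((hE v u).2 (Or.inr ⟨rfl, rfl⟩))
    obtain ⟨y, hy, hyB⟩ := hd.exists_left (List.mem_map_of_mem hB)
    refine ⟨y, hy, ?_, ?_⟩
    · rw [hyB.1]; exact (hdig _ hv B).2 h1
    · rw [hyB.1]; exact (hdig _ hu B).2 h2

/-- The solutions remain the same and only their traces become coarser. Clearing the digit of `v`
can create similar sequences, and the tables have to contain a node of small number again;
`BagSeq.exists_node` for `X.erase v` provides it. -/
theorem Good.forget {K N m : ℕ} {S X : Finset V} {E : V → V → Prop} {sl : V → ℕ} {R R' : ℕ → Prop}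
    (h : Good K N S E X sl R) (hXS : X ⊆ S) (hinj : Set.InjOn sl X) {v : V} (hv : v ∈ X)
    (hm : ∀ u ∈ X, sl u < m) (hcard : X.card ≤ m) (hN : 2 ^ (91 * (m + K + 1) ^ 2) ≤ N)
    (hR : ∀ t, t ≠ 0 → t ≤ N → (R' t ↔
      ∃ s, s ≠ 0 ∧ s ≤ N ∧ R s ∧ Dom (ForgetRel (2 ^ sl v) K) (path s) (path t))) :
    Good K N S E (X.erase v) sl R' := by
  have hclr : ∀ B : Finset V, clr (2 ^ sl v) (trace X sl B).1 = (trace (X.erase v) sl B).1 := by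
    intro B
    have := clr_enc hinj (C := B ∩ X) Finset.inter_subset_right hv
    unfold trace encP
    rw [this]
    simp only
    rw [Finset.inter_erase]
  constructor
  · intro t h0 ht hr
    obtain ⟨s, hs0, hs, hRs, hd⟩ := (hR t h0 ht).1 hr
    obtain ⟨l, hl, hdl⟩ := h.sound s hs0 hs hRs
    refine ⟨l, hl, ?_⟩
    rw [← List.map_id (path s)] at hdl
    have h3 := hdl.of_map.trans hd (T := fun B y => PairLe (trace (X.erase v) sl B) y)
      fun B x y h1 h2 => ⟨by rw [← hclr, h1.1]; exact h2.1, h1.2.trans h2.2.1⟩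
    simpa using h3.map (trace (X.erase v) sl) id (S := PairLe) fun x y h => h
  · intro l hl
    obtain ⟨s, hs0, hs, hRs, hds⟩ := h.complete _ hl
    obtain ⟨t, ht0, ht, hdt⟩ := hl.exists_node (X := X.erase v) (sl := sl) (m := m)
      ((Finset.erase_subset _ _).trans hXS)
      (fun u hu => hm u (Finset.mem_of_mem_erase hu)) (Finset.card_erase_le.trans hcard)
    refine ⟨t, ht0, ht.trans hN, (hR t ht0 (ht.trans hN)).2 ⟨s, hs0, hs, hRs, ?_⟩, hdt.2⟩
    have h1 : Dom (fun x B => PairLe x (trace X sl B)) (path s) l := by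
      rw [← List.map_id (path s)] at hds
      exact hds.of_map
    have h2 : Dom (fun B y => PairLe (trace (X.erase v) sl B) y) l (path t) := by
      have := hdt.1
      rw [← List.map_id (path t)] at this
      exact this.of_map
    have h3 : Dom (fun x y => clr (2 ^ sl v) x.1 = y.1 ∧ x.2 ≤ y.2) (path s) (path t) :=
      h1.trans h2 fun x B y h1 h2 => ⟨by rw [h1.1, hclr, h2.1], h1.2.trans h2.2⟩
    refine h3.mono fun x y _ hy hxy => ⟨hxy.1, hxy.2, ?_⟩
    obtain ⟨q, hq, hyq⟩ := hdt.2.exists_right hy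
    obtain ⟨B, hB, rfl⟩ := List.mem_map.1 hq
    exact hyq.2.trans (hl.card B hB)

end PartialSolutions

/-! ### Path-width in terms of sequences of bags -/

/-- Among the first `m` nodes the introduce node `i` must occur and the forget node `j` must not. -/
lemma PathDec.mem_bagAfter {n : ℕ} {p : Fin (2 * n) → Fin n} {isIntro : Fin (2 * n) → Bool}
    {v : Fin n} {i j : Fin (2 * n)} (hij : i < j) (hi : p i = v) (hi' : isIntro i = true)
    (hj : p j = v) (hj' : isIntro j = false) (hl : ∀ l, p l = v → l = i ∨ l = j) :
    ∀ m : ℕ, v ∈ PathDec.bagAfter p isIntro m ↔ (i : ℕ) < m ∧ m ≤ j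
  | 0 => by simp [PathDec.bagAfter]
  | m + 1 => by
    have ih := PathDec.mem_bagAfter hij hi hi' hj hj' hl m
    have hij' : (i : ℕ) < j := hij
    rw [PathDec.bagAfter]
    split_ifs with h1 h2
    · rw [Finset.mem_insert, ih]
      constructor
      · rintro (h | h)
        · rcases hl _ h.symm with h | h
          · rw [← h] at hij' ⊢; simp at hij' ⊢; omega
          · rw [← h] at hj'; simp [hj'] at h2
        · have : m ≠ (j : ℕ) := by
            rintro rfl
            simp [hj'] at h2
          omega
      · intro h
        by_cases hm : m = (i : ℕ)
        · left; subst hm; exact hi.symm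
        · right; omega
    · rw [Finset.mem_erase, ih]
      constructor
      · rintro ⟨h, h3⟩
        have : m ≠ (j : ℕ) := by
          rintro rfl
          exact h hj.symm
        omega
      · intro h
        have hm : m ≠ (i : ℕ) := by
          rintro rfl
          exact h2 hi'
        refine ⟨fun e => ?_, by omega⟩
        rcases hl _ e.symm with h' | h'
        · rw [← h'] at hm; exact hm rfl
        · rw [← h'] at h; simp at h
    · rw [ih]
      have := j.2
      omega

namespace PathDecomposition

variable {n : ℕ} {G : SimpleGraph (Fin n)}

/-- The node that introduces a vertex. -/
noncomputable def inAt (P : PathDecomposition G) (v : Fin n) : Fin (2 * n) :=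
  (P.occurs_twice v).choose

/-- The node that forgets a vertex. -/
noncomputable def outAt (P : PathDecomposition G) (v : Fin n) : Fin (2 * n) :=
  (P.occurs_twice v).choose_spec.choose

lemma inAt_spec (P : PathDecomposition G) (v : Fin n) : P.inAt v < P.outAt v ∧ P.p (P.inAt v) = v ∧
    P.isIntro (P.inAt v) = true ∧ P.p (P.outAt v) = v ∧ P.isIntro (P.outAt v) = false ∧
    ∀ l, P.p l = v → l = P.inAt v ∨ l = P.outAt v :=
  (P.occurs_twice v).choose_spec.choose_spec

lemma mem_bagAfter (P : PathDecomposition G) (v : Fin n) (m : ℕ) :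
    v ∈ PathDec.bagAfter P.p P.isIntro m ↔ (P.inAt v : ℕ) < m ∧ m ≤ P.outAt v := by
  obtain ⟨h1, h2, h3, h4, h5, h6⟩ := P.inAt_spec v
  exact PathDec.mem_bagAfter h1 h2 h3 h4 h5 h6 m

lemma card_bagAfter_le (P : PathDecomposition G) (m : ℕ) :
    (PathDec.bagAfter P.p P.isIntro m).card ≤ P.width + 1 := by
  have key : ∀ j : Fin (2 * n), (P.bag j).card ≤ P.width + 1 := by
    intro j
    have := Finset.le_sup (f := fun j : Fin (2 * n) => (P.bag j).card) (Finset.mem_univ j)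
    unfold width
    omega
  induction m with
  | zero => simp [PathDec.bagAfter]
  | succ m ih =>
    by_cases h : m < 2 * n
    · exact key ⟨m, h⟩
    · rw [PathDec.bagAfter, dif_neg h]; exact ih

/-- The bags after the first `0, …, m` nodes, the last one first. -/
def bagList (P : PathDecomposition G) : ℕ → List (Finset (Fin n))
  | 0 => [∅]
  | m + 1 => PathDec.bagAfter P.p P.isIntro (m + 1) :: P.bagList m

lemma bagList_head (P : PathDecomposition G) (m : ℕ) :
    (P.bagList m).head? = some (PathDec.bagAfter P.p P.isIntro m) := by
  cases m <;> rfl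

lemma mem_bagList (P : PathDecomposition G) {m : ℕ} {B : Finset (Fin n)} :
    B ∈ P.bagList m ↔ ∃ i ≤ m, B = PathDec.bagAfter P.p P.isIntro i := by
  induction m with
  | zero => simp [bagList, PathDec.bagAfter]
  | succ m ih =>
    rw [bagList, List.mem_cons, ih]
    constructor
    · rintro (h | ⟨i, hi, h⟩)
      · exact ⟨_, le_rfl, h⟩
      · exact ⟨i, by omega, h⟩
    · rintro ⟨i, hi, h⟩
      rcases Nat.lt_or_ge i (m + 1) with h1 | h1
      · exact Or.inr ⟨i, by omega, h⟩
      · obtain rfl : i = m + 1 := by omega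
        exact Or.inl h

lemma runs_bagList (P : PathDecomposition G) (v : Fin n) (m : ℕ) :
    runs (fun B => v ∈ B) (P.bagList m) = if (P.inAt v : ℕ) < m then 1 else 0 := by
  induction m with
  | zero => simp [bagList, runs]
  | succ m ih =>
    have h := (P.inAt_spec v).1
    have h' : (P.inAt v : ℕ) < P.outAt v := h
    rw [bagList, runs, ih, P.bagList_head]
    simp only [Option.mem_def, Option.some.injEq, exists_eq_left', P.mem_bagAfter]
    split_ifs <;> omega

lemma bagSeq (P : PathDecomposition G) :
    BagSeq Finset.univ G.Adj (P.width + 1) (P.bagList (2 * n)) := by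
  refine ⟨fun B _ => Finset.subset_univ B, ?_, ?_, ?_, ?_⟩
  · intro B hB
    obtain ⟨i, _, rfl⟩ := P.mem_bagList.1 hB
    exact P.card_bagAfter_le i
  · intro v _
    rw [P.runs_bagList, if_pos (P.inAt v).2]
  · intro u v h
    obtain ⟨j, hu, hv⟩ := P.edge_covered u v h
    exact ⟨_, P.mem_bagList.2 ⟨j + 1, j.2, rfl⟩, hu, hv⟩
  · generalize 2 * n = m
    induction m with
    | zero => rfl
    | succ m ih => rw [bagList, List.getLast?_cons, ih]; rfl

end PathDecomposition

lemma exists_interval_of_runs {α : Type*} {p : α → Prop} {l : List α} (h : runs p l = 1) :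
    ∃ f g, f ≤ g ∧ g < l.length ∧ ∀ i (hi : i < l.length), p l[i] ↔ f ≤ i ∧ i ≤ g := by
  induction l with
  | nil => simp [runs] at h
  | cons x l ih =>
    rw [runs] at h
    split_ifs at h with hx
    · have h0 := runs_eq_zero.1 (show runs p l = 0 by omega)
      refine ⟨0, 0, le_rfl, by simp, fun i hi => ?_⟩
      cases i with
      | zero => simpa using hx.1
      | succ i =>
        simp only [List.getElem_cons_succ]
        have := h0 _ (List.getElem_mem (l := l) (n := i) (by simpa using hi))
        simp [this]
    · obtain ⟨f, g, hfg, hg, hi⟩ := ih (by omega)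
      by_cases hpx : p x
      · simp only [hpx, true_and, not_not] at hx
        obtain ⟨y, hy, hpy⟩ := hx
        obtain ⟨l, rfl⟩ : ∃ l', l = y :: l' := by
          cases l with
          | nil => simp at hy
          | cons z l' => simp at hy; exact ⟨l', by rw [hy]⟩
        have h0 := (hi 0 (by simp)).1 hpy
        refine ⟨0, g + 1, by omega, by simpa using hg, fun i hi' => ?_⟩
        cases i with
        | zero => simpa using hpx
        | succ i =>
          rw [List.getElem_cons_succ, hi i (by simpa using hi')]
          omega
      · refine ⟨f + 1, g + 1, by omega, by simpa using hg, fun i hi' => ?_⟩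
        cases i with
        | zero => simpa using hpx
        | succ i =>
          rw [List.getElem_cons_succ, hi i (by simpa using hi')]
          omega

/-- Every vertex occupies an interval of positions in `l`. Sorting the `2 * n` interval ends yields
the introduce and forget nodes. -/
theorem BagSeq.exists_pathDecomposition {n : ℕ} {G : SimpleGraph (Fin n)} {K : ℕ}
    {l : List (Finset (Fin n))} (h : BagSeq Finset.univ G.Adj K l) :
    ∃ P : PathDecomposition G, P.width ≤ K - 1 := by
  choose f g hfg hg hi using fun v => exists_interval_of_runs (h.runs v (Finset.mem_univ v))
  let e : Fin (2 * n) ≃ Fin n × Bool :=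
    Fintype.equivOfCardEq (by simp [mul_comm])
  -- Even keys for first positions and odd keys for last ones: at one position all introductions
  -- precede all forget nodes, so vertices that share a bag of `l` overlap.
  let key : Fin n × Bool → ℕ := fun x => if x.2 = true then 2 * f x.1 else 2 * g x.1 + 1
  let σ := Tuple.sort (key ∘ e)
  have hmono : Monotone (key ∘ e ∘ σ) := Tuple.monotone_sort (key ∘ e)
  let E : Fin (2 * n) ≃ Fin n × Bool := σ.trans e
  have hE : ∀ a b, a ≤ b → key (E a) ≤ key (E b) := fun a b hab => hmono hab
  have hlt : ∀ x y, key x < key y → E.symm x < E.symm y := by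
    intro x y hxy
    by_contra hle
    have := hE _ _ (not_lt.1 hle)
    simp only [Equiv.apply_symm_apply] at this
    omega
  have hocc : ∀ v : Fin n, E.symm (v, true) < E.symm (v, false) :=
    fun v => hlt _ _ (by have := hfg v; simp [key]; omega)
  have hmem : ∀ (v : Fin n) (m : ℕ), v ∈ PathDec.bagAfter (fun j => (E j).1) (fun j => (E j).2) m ↔
      (E.symm (v, true) : ℕ) < m ∧ m ≤ E.symm (v, false) := by
    intro v m
    refine PathDec.mem_bagAfter (hocc v) (by simp) (by simp) (by simp) (by simp) ?_ m
    intro j hj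
    rcases hb : (E j).2 with _ | _
    · right; rw [Equiv.eq_symm_apply]; exact Prod.ext hj hb
    · left; rw [Equiv.eq_symm_apply]; exact Prod.ext hj hb
  let P : PathDecomposition G :=
    { p := fun j => (E j).1
      isIntro := fun j => (E j).2
      occurs_twice := by
        intro v
        refine ⟨E.symm (v, true), E.symm (v, false), hocc v, by simp, by simp, by simp, by simp, ?_⟩
        intro j hj
        rcases hb : (E j).2 with _ | _
        · right; rw [Equiv.eq_symm_apply]; exact Prod.ext hj hb
        · left; rw [Equiv.eq_symm_apply]; exact Prod.ext hj hb
      edge_covered := by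
        intro u v huv
        obtain ⟨B, hB, hu, hv⟩ := h.edge u v huv
        obtain ⟨t, ht, rfl⟩ := List.getElem_of_mem hB
        have hu := (hi u t ht).1 hu
        have hv := (hi v t ht).1 hv
        have h1 : E.symm (u, true) < E.symm (v, false) := hlt _ _ (by simp [key]; omega)
        have h2 : E.symm (v, true) < E.symm (u, false) := hlt _ _ (by simp [key]; omega)
        have h3 := hocc u
        have h4 := hocc v
        simp only [hmem]
        simp only [Fin.lt_def] at h1 h2 h3 h4
        rcases le_total (E.symm (u, true)) (E.symm (v, true)) with hle | hle
        · refine ⟨E.symm (v, true), ?_⟩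
          rw [Fin.le_def] at hle
          omega
        · refine ⟨E.symm (u, true), ?_⟩
          rw [Fin.le_def] at hle
          omega }
  refine ⟨P, ?_⟩
  unfold PathDecomposition.width
  refine Nat.sub_le_sub_right ?_ 1
  refine Finset.sup_le fun j _ => ?_
  have hkey : key (E j) / 2 < l.length := by
    have h1 := hfg (E j).1
    have h2 := hg (E j).1
    simp only [key]; split_ifs <;> omega
  -- A vertex present after node `j` satisfies `2 * f v ≤ key (E j) ≤ 2 * g v + 1`, hence it belongs
  -- to the bag at position `key (E j) / 2` of `l`.
  refine (Finset.card_le_card ?_).trans (h.card l[key (E j) / 2] (List.getElem_mem hkey))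
  intro v hv
  have hv' := (hmem v (j + 1)).1 hv
  rw [hi v]
  have h1 := hE (E.symm (v, true)) j (by rw [Fin.le_def]; omega)
  have h2 := hE j (E.symm (v, false)) (by rw [Fin.le_def]; omega)
  simp only [Equiv.apply_symm_apply] at h1 h2
  have e1 : key (v, true) = 2 * f v := by simp [key]
  have e2 : key (v, false) = 2 * g v + 1 := by simp [key]
  omega

/-- The existence of `P` ensures that the infimum in `pathWidth` is attained. -/
lemma pathWidth_le_iff {n : ℕ} {G : SimpleGraph (Fin n)} (P : PathDecomposition G) (k : ℕ) :
    pathWidth G ≤ k ↔ ∃ l, BagSeq Finset.univ G.Adj (k + 1) l := by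
  constructor
  · intro h
    obtain ⟨Q, hQ⟩ : pathWidth G ∈ {w : ℕ | ∃ P : PathDecomposition G, P.width = w} :=
      Nat.sInf_mem ⟨_, P, rfl⟩
    have hb := Q.bagSeq
    exact ⟨_, hb.sub, fun B hB => (hb.card B hB).trans (by omega), hb.runs, hb.edge, hb.last⟩
  · rintro ⟨l, hl⟩
    obtain ⟨Q, hQ⟩ := hl.exists_pathDecomposition
    have : pathWidth G ≤ Q.width := Nat.sInf_le ⟨Q, rfl⟩
    omega

namespace Loop

/-! ### Reasoning about commands -/

/-- The execution of `c` from `σ` respects the bounds and establishes `Q`. -/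
def Tr (I : ℕ → ℕ) (β W D : ℕ) (c : Cm) (σ : St) (Q : St → Prop) : Prop :=
  c.ok I β W D σ ∧ Q (c.ev I σ)

variable {I : ℕ → ℕ} {β W D : ℕ}

lemma Tr.mono {c : Cm} {σ : St} {Q Q' : St → Prop} (h : Tr I β W D c σ Q) (hQ : ∀ τ, Q τ → Q' τ) :
    Tr I β W D c σ Q' := ⟨h.1, hQ _ h.2⟩

lemma Tr.seq {c d : Cm} {σ : St} {Q : St → Prop} (h : Tr I β W D c σ fun τ => Tr I β W D d τ Q) :
    Tr I β W D (c ;; d) σ Q := ⟨⟨h.1, h.2.1⟩, h.2.2⟩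

lemma Tr.set {x : ℕ} {e : Ex} {σ : St} {Q : St → Prop} (h : e.ev σ ≤ W)
    (hQ : Q (σ.setv x (e.ev σ))) : Tr I β W D (.set x e) σ Q := ⟨h, hQ⟩

lemma Tr.rd {x : ℕ} {e : Ex} {σ : St} {Q : St → Prop} (h : e.ev σ < β) (hI : I (e.ev σ) ≤ W)
    (hQ : Q (σ.setv x (I (e.ev σ)))) : Tr I β W D (.rd x e) σ Q := ⟨⟨h, hI⟩, hQ⟩

lemma Tr.put {A : Fin 32} {i e : Ex} {σ : St} {Q : St → Prop} (h : e.ev σ ≤ W)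
    (hQ : Q (σ.seta A (i.ev σ) (e.ev σ))) : Tr I β W D (.put A i e) σ Q := ⟨h, hQ⟩

lemma Tr.loop {x : ℕ} {e : Ex} {c : Cm} {σ : St} {Q : St → Prop} (Inv : ℕ → St → Prop)
    (h0 : Inv 0 σ) (hD : e.ev σ ≤ D)
    (hs : ∀ i < e.ev σ, ∀ τ, Inv i τ → Tr I β W D c (τ.setv x i) (Inv (i + 1)))
    (hQ : ∀ τ, Inv (e.ev σ) τ → Q τ) : Tr I β W D (.loop x e c) σ Q := by
  have key : ∀ i ≤ e.ev σ, Inv i (iter (fun i τ => c.ev I (τ.setv x i)) σ i) := by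
    intro i
    induction i with
    | zero => intro _; exact h0
    | succ i ih => intro hi; exact (hs i (by omega) _ (ih (by omega))).2
  exact ⟨⟨hD, fun i hi => (hs i hi _ (key i hi.le)).1⟩, hQ _ (key _ le_rfl)⟩

/-- Arrays written by a command. -/
def Cm.wa : Cm → List (Fin 32)
  | .put A _ _ => [A]
  | .seq c d => c.wa ++ d.wa
  | .loop _ _ c => c.wa
  | _ => []

/-- Variables written by a command. -/
def Cm.wv : Cm → List ℕ
  | .set x _ => [x]
  | .rd x _ => [x]
  | .seq c d => c.wv ++ d.wv
  | .loop x _ c => x :: c.wv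
  | _ => []

lemma Cm.frame_a (c : Cm) : ∀ (σ : St) (B : Fin 32), B ∉ c.wa → (c.ev I σ).a B = σ.a B := by
  induction c with
  | set x e => intro σ B _; rfl
  | rd x e => intro σ B _; rfl
  | put A i e =>
    intro σ B h
    funext j
    simp only [Cm.wa, List.mem_singleton] at h
    simp [Cm.ev, h]
  | seq c d ihc ihd =>
    intro σ B h
    simp only [Cm.wa, List.mem_append, not_or] at h
    rw [Cm.ev, ihd _ _ h.2, ihc _ _ h.1]
  | loop x e c ih =>
    intro σ B h
    rw [Cm.ev]
    generalize e.ev σ = N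
    induction N with
    | zero => rfl
    | succ N ihN => rw [iter, ih _ _ h, St.setv_a, ihN]

lemma Cm.frame_v (c : Cm) : ∀ (σ : St) (y : ℕ), y ∉ c.wv → (c.ev I σ).v y = σ.v y := by
  induction c with
  | set x e =>
    intro σ y h
    simp only [Cm.wv, List.mem_singleton] at h
    simp [Cm.ev, h]
  | rd x e =>
    intro σ y h
    simp only [Cm.wv, List.mem_singleton] at h
    simp [Cm.ev, h]
  | put A i e => intro σ y _; rfl
  | seq c d ihc ihd =>
    intro σ y h
    simp only [Cm.wv, List.mem_append, not_or] at h
    rw [Cm.ev, ihd _ _ h.2, ihc _ _ h.1]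
  | loop x e c ih =>
    intro σ y h
    simp only [Cm.wv, List.mem_cons, not_or] at h
    rw [Cm.ev]
    generalize e.ev σ = N
    induction N with
    | zero => rfl
    | succ N ihN => rw [iter, ih _ _ h.2, St.setv_v, if_neg h.1, ihN]

/-- Fills the array `A` with the values of `val` for `x = 0, …, e - 1`. -/
def fill (x : ℕ) (e : Ex) (A : Fin 32) (val : Ex) : Cm := .loop x e (.put A (.var x) val)

lemma Tr.fill {x : ℕ} {e : Ex} {A : Fin 32} {val : Ex} {σ : St} {Q : St → Prop} (g : ℕ → ℕ) (n : ℕ)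
    (he : e.ev σ = n) (hD : n ≤ D)
    (h : ∀ i < n, ∀ τ : St, (∀ y, y ≠ x → τ.v y = σ.v y) → τ.v x = i →
      (∀ B, B ≠ A → τ.a B = σ.a B) → (∀ j < i, τ.a A j = g j) →
      (∀ j, i ≤ j → τ.a A j = σ.a A j) → val.ev τ = g i ∧ g i ≤ W)
    (hQ : ∀ τ : St, (∀ y, y ≠ x → τ.v y = σ.v y) → (∀ B, B ≠ A → τ.a B = σ.a B) →
      (∀ j < n, τ.a A j = g j) → Q τ) : Tr I β W D (Loop.fill x e A val) σ Q := by
  refine Tr.loop (fun i τ => (∀ y, y ≠ x → τ.v y = σ.v y) ∧ (∀ B, B ≠ A → τ.a B = σ.a B) ∧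
    (∀ j < i, τ.a A j = g j) ∧ (∀ j, i ≤ j → τ.a A j = σ.a A j)) ?_ (he ▸ hD) ?_ ?_
  · exact ⟨fun _ _ => rfl, fun _ _ => rfl, fun j hj => absurd hj (by omega), fun _ _ => rfl⟩
  · intro i hi τ ⟨h1, h2, h3, h4⟩
    obtain ⟨e1, e2⟩ := h i (he ▸ hi) (τ.setv x i) (fun y hy => by simp [hy, h1 y hy]) (by simp)
      h2 h3 h4
    refine Tr.put (by rw [e1]; exact e2) ⟨?_, ?_, ?_, ?_⟩
    · intro y hy; simp [hy, h1 y hy]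
    · intro B hB
      funext j
      simp [hB, h2 B hB]
    · intro j hj
      simp only [St.seta_a, true_and, Ex.ev, St.setv_v, if_true, e1, St.setv_a]
      split_ifs with hji
      · rw [hji]
      · exact h3 j (by omega)
    · intro j hj
      simp only [St.seta_a, true_and, Ex.ev, St.setv_v, if_true, e1, St.setv_a]
      rw [if_neg (by omega)]
      exact h4 j (by omega)
  · intro τ ⟨h1, h2, h3, _⟩
    exact hQ τ h1 h2 (he ▸ h3)

/-- Case distinction on equality. -/
def eqE (a b x y : Ex) : Ex := .ite a b y (.ite b a y x)

@[simp] lemma ev_eqE (σ : St) (a b x y : Ex) :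
    (eqE a b x y).ev σ = if a.ev σ = b.ev σ then x.ev σ else y.ev σ := by
  simp only [eqE, Ex.ev]
  split_ifs <;> first | rfl | omega

/-! ### The tables of the tree -/

section Vars

/-! The variables and arrays of the program. -/

abbrev xn : ℕ := 0
abbrev xmx : ℕ := 1
abbrev xcur : ℕ := 2
abbrev xfound : ℕ := 3
abbrev xans : ℕ := 4
abbrev xk : ℕ := 5
abbrev xK : ℕ := 6
abbrev xN : ℕ := 7
abbrev xj : ℕ := 8
abbrev xv : ℕ := 9
abbrev xq : ℕ := 10
abbrev xb : ℕ := 11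
abbrev xi : ℕ := 12
abbrev xi' : ℕ := 13
abbrev xe : ℕ := 14
abbrev xu : ℕ := 15
abbrev xb' : ℕ := 16
abbrev xt : ℕ := 17
abbrev xs : ℕ := 18
abbrev xlo : ℕ := 19
abbrev xhi : ℕ := 20
abbrev xc : ℕ := 21
abbrev aPar : Fin 32 := 0
abbrev aDig : Fin 32 := 1
abbrev aSel : Fin 32 := 2
abbrev aB : Fin 32 := 3
abbrev aZ0 : Fin 32 := 4
abbrev aZ1 : Fin 32 := 5
abbrev aA0 : Fin 32 := 6
abbrev aA1 : Fin 32 := 7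
abbrev aZ : Fin 32 := 8
abbrev aA : Fin 32 := 9
abbrev aH : Fin 32 := 10
abbrev aH' : Fin 32 := 11
abbrev aRun : Fin 32 := 12
abbrev aCov : Fin 32 := 13
abbrev aRow : Fin 32 := 14
abbrev aD : Fin 32 := 15
abbrev aR : Fin 32 := 16
abbrev aR' : Fin 32 := 17
abbrev aSl : Fin 32 := 18
abbrev aUs : Fin 32 := 19
end Vars

/-- The number of table entries, `N + 1`. -/
def szE : Ex := .add (.var xN) (.lit 1)

def tE : Ex := .var xt
def parE (A : Fin 32) : Ex := .get A (.get aPar tE)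
def digE : Ex := .get aDig tE

/-- Computes the tables for the nodes of the tree. -/
def treeCm : Cm :=
  fill xt szE aPar (.ite tE (.lit 2) (.lit 0)
    (.ite tE (.lit 8) (.lit 1) (.add (.get aPar (.sub tE (.lit 6))) (.lit 1)))) ;;
  fill xt szE aDig (.ite tE (.lit 8) (.sub tE (.lit 2)) (.get aDig (.sub tE (.lit 6)))) ;;
  fill xt szE aSel (.ite tE (.lit 2) (.lit 0)
    (eqE digE (.lit 2) (.sub (.lit 1) (parE aSel)) (parE aSel))) ;;
  fill xt szE aB (.ite tE (.lit 2) (.lit 1) (eqE digE (.lit 3) (.add (parE aB) (parE aB))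
    (.ite digE (.lit 3) (parE aB) (.lit 1)))) ;;
  fill xt szE aZ0 (.ite tE (.lit 2) (.lit 0) (eqE (parE aSel) (.lit 0) (parE aZ0)
    (.ite digE (.lit 4) (parE aZ0) (eqE digE (.lit 4) (.add (parE aZ0) (parE aB))
      (.sub (parE aZ0) (parE aB)))))) ;;
  fill xt szE aZ1 (.ite tE (.lit 2) (.lit 0) (eqE (parE aSel) (.lit 0)
    (.ite digE (.lit 4) (parE aZ1) (eqE digE (.lit 4) (.add (parE aZ1) (parE aB))
      (.sub (parE aZ1) (parE aB)))) (parE aZ1))) ;;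
  fill xt szE aA0 (.ite tE (.lit 2) (.lit 0) (eqE (parE aSel) (.lit 0) (parE aA0)
    (eqE digE (.lit 0) (.add (parE aA0) (.lit 1)) (eqE digE (.lit 1) (.sub (parE aA0) (.lit 1))
      (parE aA0))))) ;;
  fill xt szE aA1 (.ite tE (.lit 2) (.lit 0) (eqE (parE aSel) (.lit 0)
    (eqE digE (.lit 0) (.add (parE aA1) (.lit 1)) (eqE digE (.lit 1) (.sub (parE aA1) (.lit 1))
      (parE aA1))) (parE aA1))) ;;
  fill xt szE aZ (eqE (.get aSel tE) (.lit 0) (.get aZ0 tE) (.get aZ1 tE)) ;;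
  fill xt szE aA (eqE (.get aSel tE) (.lit 0) (.get aA0 tE) (.get aA1 tE)) ;;
  fill xt szE aRow (.ite tE (.lit 1) (.lit 0) (.add (.get aRow (.sub tE (.lit 1))) szE))

/-- The tables describe the tree. -/
structure TreeTab (N : ℕ) (σ : St) : Prop where
  size : σ.v xN = N
  par : ∀ w ≤ N, σ.a aPar w = Tree.par w
  z : ∀ w ≤ N, σ.a aZ w = (Tree.nd w).cur.1
  a : ∀ w ≤ N, σ.a aA w = (Tree.nd w).cur.2
  row : ∀ w ≤ N, σ.a aRow w = w * (N + 1)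

lemma TreeTab.congr {N : ℕ} {σ τ : St} (h : TreeTab N σ) (hN : τ.v xN = σ.v xN)
    (ha : ∀ B ∈ [aPar, aZ, aA, aRow], τ.a B = σ.a B) : TreeTab N τ := by
  refine ⟨by rw [hN, h.size], ?_, ?_, ?_, ?_⟩
  · rw [ha aPar (by simp)]; exact h.par
  · rw [ha aZ (by simp)]; exact h.z
  · rw [ha aA (by simp)]; exact h.a
  · rw [ha aRow (by simp)]; exact h.row

-- All components of a machine state are bounded by about the number of the node, because a single
-- operation at most doubles a component while the node number grows by a factor of about six. So
-- they can serve as indices of the tables.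
open Tree in
lemma nd_le (w : ℕ) : (nd w).sel ≤ 1 ∧ (nd w).b ≤ w + 1 ∧ (nd w).z₀ ≤ w ∧ (nd w).z₁ ≤ w ∧
    (nd w).a₀ ≤ w ∧ (nd w).a₁ ≤ w := by
  induction w using Nat.strong_induction_on with
  | _ w ih =>
    by_cases hw : w < 2
    · simp [nd_small hw]
    · obtain ⟨h1, h2, h3, h4, h5, h6⟩ := ih _ (par_lt (by omega))
      rw [nd_big (by omega)]
      have hp : w = 6 * (par w - 1) + dig w + 2 ∧ 1 ≤ par w ∧ dig w < 6 := by
        unfold par dig; rw [if_neg hw]; omega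
      simp only [Nd.step]
      refine ⟨?_, ?_, ?_, ?_, ?_, ?_⟩ <;> split_ifs <;> omega

/-- The machine can neither divide nor multiply. Parents and digits are obtained from the entries
six places before, the multiples of `N + 1` by repeated addition, and the machine states from those
of the parents, which have smaller numbers. -/
lemma tree_spec {σ : St} {N : ℕ} {Q : St → Prop} (hN : σ.v xN = N) (hD : N + 1 ≤ D)
    (hW : (N + 2) * (N + 2) ≤ W)
    (hQ : ∀ τ, TreeTab N τ → Q τ) : Tr I β W D treeCm σ Q := by
  have hNW : N + 2 ≤ W := by nlinarith
  have bd := nd_le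
  refine Tr.seq (Tr.fill Tree.par (N + 1) (by simp [szE, Ex.ev, hN]) hD ?_ ?_)
  · intro i hi τ hv hx ha hg _
    have : Tree.par i ≤ i := Tree.par_le i
    refine ⟨?_, by omega⟩
    simp only [Ex.ev, tE, hx]
    split_ifs with h1 h2
    · simp [Tree.par, h1]
    · simp only [Tree.par]; split_ifs; omega
    · rw [hg _ (by omega)]; simp only [Tree.par]; split_ifs <;> omega
  intro σ1 v1 a1 g1
  refine Tr.seq (Tr.fill Tree.dig (N + 1) (by simp [szE, Ex.ev, hN, v1]) hD ?_ ?_)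
  · intro i hi τ hv hx ha hg _
    have : Tree.dig i ≤ i := by unfold Tree.dig; omega
    refine ⟨?_, by omega⟩
    simp only [Ex.ev, tE, hx]
    split_ifs with h1
    · unfold Tree.dig; omega
    · rw [hg _ (by omega)]; unfold Tree.dig; omega
  intro σ2 v2 a2 g2
  refine Tr.seq (Tr.fill (fun w => (Tree.nd w).sel) (N + 1) (by simp [szE, Ex.ev, hN, v1, v2]) hD ?_ ?_)
  · intro i hi τ hv hx ha hg _
    refine ⟨?_, by have := bd i; omega⟩
    simp only [Ex.ev, ev_eqE, tE, parE, digE, hx]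
    by_cases h2 : i < 2
    · simp [h2, Tree.nd_small]
    · have hp : Tree.par i < i := Tree.par_lt (by omega)
      simp (decide := true) only [ha, a2, g1 i hi, g2 i hi, ne_eq, h2, if_false]
      rw [hg _ hp, Tree.nd_big (w := i) (by omega)]
      rfl
  intro σ3 v3 a3 g3
  refine Tr.seq (Tr.fill (fun w => (Tree.nd w).b) (N + 1) (by simp [szE, Ex.ev, hN, v1, v2, v3]) hD ?_ ?_)
  · intro i hi τ hv hx ha hg _
    refine ⟨?_, by have := bd i; omega⟩
    simp only [Ex.ev, ev_eqE, tE, parE, digE, hx]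
    by_cases h2 : i < 2
    · simp [h2, Tree.nd_small]
    · have hp : Tree.par i < i := Tree.par_lt (by omega)
      simp (decide := true) only [ha, a3, a2, g1 i hi, g2 i hi, ne_eq, h2, if_false]
      rw [hg _ hp, Tree.nd_big (w := i) (by omega)]
      rfl
  intro σ4 v4 a4 g4
  refine Tr.seq (Tr.fill (fun w => (Tree.nd w).z₀) (N + 1) (by simp [szE, Ex.ev, hN, v1, v2, v3, v4]) hD ?_ ?_)
  · intro i hi τ hv hx ha hg _
    refine ⟨?_, by have := bd i; omega⟩
    simp only [Ex.ev, ev_eqE, tE, parE, digE, hx]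
    by_cases h2 : i < 2
    · simp [h2, Tree.nd_small]
    · have hp : Tree.par i < i := Tree.par_lt (by omega)
      simp (decide := true) only [ha, a4, a3, a2, g1 i hi, g2 i hi, ne_eq, h2, if_false]
      rw [hg _ hp, g3 _ (by omega), g4 _ (by omega), Tree.nd_big (w := i) (by omega)]
      rfl
  intro σ5 v5 a5 g5
  refine Tr.seq (Tr.fill (fun w => (Tree.nd w).z₁) (N + 1) (by simp [szE, Ex.ev, hN, v1, v2, v3, v4, v5]) hD ?_ ?_)
  · intro i hi τ hv hx ha hg _
    refine ⟨?_, by have := bd i; omega⟩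
    simp only [Ex.ev, ev_eqE, tE, parE, digE, hx]
    by_cases h2 : i < 2
    · simp [h2, Tree.nd_small]
    · have hp : Tree.par i < i := Tree.par_lt (by omega)
      simp (decide := true) only [ha, a5, a4, a3, a2, g1 i hi, g2 i hi, ne_eq, h2, if_false]
      rw [hg _ hp, g3 _ (by omega), g4 _ (by omega), Tree.nd_big (w := i) (by omega)]
      rfl
  intro σ6 v6 a6 g6
  refine Tr.seq (Tr.fill (fun w => (Tree.nd w).a₀) (N + 1) (by simp [szE, Ex.ev, hN, v1, v2, v3, v4, v5, v6]) hD ?_ ?_)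
  · intro i hi τ hv hx ha hg _
    refine ⟨?_, by have := bd i; omega⟩
    simp only [Ex.ev, ev_eqE, tE, parE, digE, hx]
    by_cases h2 : i < 2
    · simp [h2, Tree.nd_small]
    · have hp : Tree.par i < i := Tree.par_lt (by omega)
      simp (decide := true) only [ha, a6, a5, a4, a3, a2, g1 i hi, g2 i hi, ne_eq, h2, if_false]
      rw [hg _ hp, g3 _ (by omega), Tree.nd_big (w := i) (by omega)]
      rfl
  intro σ7 v7 a7 g7
  refine Tr.seq (Tr.fill (fun w => (Tree.nd w).a₁) (N + 1) (by simp [szE, Ex.ev, hN, v1, v2, v3, v4, v5, v6, v7]) hD ?_ ?_)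
  · intro i hi τ hv hx ha hg _
    refine ⟨?_, by have := bd i; omega⟩
    simp only [Ex.ev, ev_eqE, tE, parE, digE, hx]
    by_cases h2 : i < 2
    · simp [h2, Tree.nd_small]
    · have hp : Tree.par i < i := Tree.par_lt (by omega)
      simp (decide := true) only [ha, a7, a6, a5, a4, a3, a2, g1 i hi, g2 i hi, ne_eq, h2, if_false]
      rw [hg _ hp, g3 _ (by omega), Tree.nd_big (w := i) (by omega)]
      rfl
  intro σ8 v8 a8 g8
  refine Tr.seq (Tr.fill (fun w => (Tree.nd w).cur.1) (N + 1)
    (by simp [szE, Ex.ev, hN, v1, v2, v3, v4, v5, v6, v7, v8]) hD ?_ ?_)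
  · intro i hi τ hv hx ha hg _
    refine ⟨?_, by have := bd i; simp only [Tree.Nd.cur]; split_ifs <;> dsimp only <;> omega⟩
    simp only [Ex.ev, ev_eqE, tE, hx]
    simp (decide := true) only [ha, a8, a7, a6, a5, a4, g3 i hi, g5 i hi, g6 i hi, ne_eq]
    simp only [Tree.Nd.cur]; split_ifs <;> rfl
  intro σ9 v9 a9 g9
  refine Tr.seq (Tr.fill (fun w => (Tree.nd w).cur.2) (N + 1)
    (by simp [szE, Ex.ev, hN, v1, v2, v3, v4, v5, v6, v7, v8, v9]) hD ?_ ?_)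
  · intro i hi τ hv hx ha hg _
    refine ⟨?_, by have := bd i; simp only [Tree.Nd.cur]; split_ifs <;> dsimp only <;> omega⟩
    simp only [Ex.ev, ev_eqE, tE, hx]
    simp (decide := true) only [ha, a9, a8, a7, a6, a5, a4, g3 i hi, g7 i hi, g8 i hi, ne_eq]
    simp only [Tree.Nd.cur]; split_ifs <;> rfl
  intro σ10 v10 a10 g10
  have h10 : σ10.v xN = N := by simp [hN, v1, v2, v3, v4, v5, v6, v7, v8, v9, v10]
  refine Tr.fill (fun w => w * (N + 1)) (N + 1) (by simp [szE, Ex.ev, h10]) hD ?_ ?_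
  · intro i hi τ hv hx ha hg _
    refine ⟨?_, by nlinarith⟩
    simp only [Ex.ev, tE, szE, hx, hv xN (by decide), h10]
    split_ifs with h1
    · simp [show i = 0 by omega]
    · rw [hg _ (by omega), Nat.sub_mul]; have : N + 1 ≤ i * (N + 1) := by nlinarith
      omega
  intro σ11 v11 a11 g11
  apply hQ
  refine ⟨by rw [v11 _ (by decide), h10], ?_, ?_, ?_, fun w hw => g11 w (by omega)⟩
  · intro w hw
    simp (decide := true) only [a11, a10, a9, a8, a7, a6, a5, a4, a3, a2, ne_eq]
    exact g1 w (by omega)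
  · intro w hw
    simp (decide := true) only [a11, a10, ne_eq]
    exact g9 w (by omega)
  · intro w hw
    simp (decide := true) only [a11, ne_eq]
    exact g10 w (by omega)

end Loop

namespace Loop
open Tree

/-! ### Transitions between tables -/

/-- Variables outside `xs` and arrays outside `as` have the same values in both states. -/
def Fr (xs : List ℕ) (as : List (Fin 32)) (σ τ : St) : Prop :=
  (∀ y ∉ xs, τ.v y = σ.v y) ∧ ∀ B ∉ as, τ.a B = σ.a B

lemma Fr.refl (xs : List ℕ) (as : List (Fin 32)) (σ : St) : Fr xs as σ σ :=
  ⟨fun _ _ => rfl, fun _ _ => rfl⟩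

lemma Fr.trans {xs xs' ys : List ℕ} {as as' bs : List (Fin 32)} {σ τ υ : St} (h : Fr xs as σ τ)
    (h' : Fr xs' as' τ υ) (hx : xs ⊆ ys := by decide) (hx' : xs' ⊆ ys := by decide)
    (ha : as ⊆ bs := by decide) (ha' : as' ⊆ bs := by decide) : Fr ys bs σ υ :=
  ⟨fun y hy => (h'.1 y fun e => hy (hx' e)).trans (h.1 y fun e => hy (hx e)),
    fun B hB => (h'.2 B fun e => hB (ha' e)).trans (h.2 B fun e => hB (ha e))⟩

lemma Fr.setv {xs : List ℕ} {as : List (Fin 32)} {σ τ : St} (h : Fr xs as σ τ) {x : ℕ} (n : ℕ)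
    (hx : x ∈ xs := by decide) : Fr xs as σ (τ.setv x n) := by
  refine ⟨fun y hy => ?_, h.2⟩
  rw [St.setv_v, if_neg (by rintro rfl; exact hy hx), h.1 y hy]

lemma Fr.seta {xs : List ℕ} {as : List (Fin 32)} {σ τ : St} (h : Fr xs as σ τ) {A : Fin 32} (i n : ℕ)
    (hA : A ∈ as := by decide) : Fr xs as σ (τ.seta A i n) := by
  refine ⟨h.1, fun B hB => ?_⟩
  funext j
  rw [St.seta_a, if_neg (by rintro ⟨rfl, -⟩; exact hB hA), h.2 B hB]

lemma Tr.and_frame {I : ℕ → ℕ} {β W D : ℕ} {c : Cm} {σ : St} {Q : St → Prop} (h : Tr I β W D c σ Q)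
    {xs : List ℕ} {as : List (Fin 32)} (hx : c.wv ⊆ xs) (ha : c.wa ⊆ as) :
    Tr I β W D c σ fun τ => Q τ ∧ Fr xs as σ τ :=
  ⟨h.1, h.2, fun y hy => c.frame_v σ y fun e => hy (hx e),
    fun B hB => c.frame_a σ B fun e => hB (ha e)⟩

lemma TreeTab.fr {N : ℕ} {σ τ : St} (h : TreeTab N σ) {xs : List ℕ} {as : List (Fin 32)}
    (hf : Fr xs as σ τ) (hx : xN ∉ xs := by decide)
    (ha : ∀ B ∈ [aPar, aZ, aA, aRow], B ∉ as := by decide) : TreeTab N τ :=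
  h.congr (hf.1 _ hx) fun B hB => hf.2 B (ha B hB)

/-- The truth value of a proposition as a number. -/
noncomputable def ind (p : Prop) : ℕ := open Classical in if p then 1 else 0

lemma ind_le (p : Prop) : ind p ≤ 1 := by unfold ind; split_ifs <;> omega

@[simp] lemma ind_pos {p : Prop} : 0 < ind p ↔ p := by unfold ind; split_ifs with h <;> simp [h]

lemma ind_eq_one {p : Prop} : ind p = 1 ↔ p := by unfold ind; split_ifs with h <;> simp [h]

lemma ind_true {p : Prop} (h : p) : ind p = 1 := ind_eq_one.2 h

lemma ind_false {p : Prop} (h : ¬ p) : ind p = 0 := by simp [ind, h]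

lemma ind_congr {p q : Prop} (h : p ↔ q) : ind p = ind q := by rw [propext h]

lemma ite_eq_ind {p q : Prop} [Decidable p] (h : p ↔ q) : (if p then 1 else 0) = ind q := by
  unfold ind; split_ifs <;> tauto

variable {I : ℕ → ℕ} {β W D : ℕ}

/-- `Tr.fill` for the full range of the tables. -/
lemma Tr.tab {A : Fin 32} {val : Ex} {σ : St} {N : ℕ} {Q : St → Prop} (g : ℕ → ℕ)
    (hN : σ.v xN = N) (hD : N + 1 ≤ D)
    (h : ∀ i ≤ N, ∀ τ : St, Fr [xt] [A] σ τ → τ.v xt = i → (∀ j < i, τ.a A j = g j) →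
      (∀ j, i ≤ j → τ.a A j = σ.a A j) → val.ev τ = g i ∧ g i ≤ W)
    (hQ : ∀ τ : St, Fr [xt] [A] σ τ → (∀ j ≤ N, τ.a A j = g j) → Q τ) :
    Tr I β W D (Loop.fill xt szE A val) σ Q := by
  refine Tr.fill g (N + 1) (by simp [szE, Ex.ev, hN]) hD ?_ ?_
  · intro i hi τ h1 h2 h3 h4 h5
    exact h i (by omega) τ ⟨fun y hy => h1 y (by simpa using hy), fun B hB => h3 B (by simpa using hB)⟩
      h2 h4 h5
  · intro τ h1 h2 h3
    exact hQ τ ⟨fun y hy => h1 y (by simpa using hy), fun B hB => h2 B (by simpa using hB)⟩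
      fun j hj => h3 j (by omega)

/-- Tabulates the digits with place value `x`. -/
def digCm (A : Fin 32) (x : ℕ) : Cm :=
  fill xt szE A (.ite tE (.var x) (.lit 0) (.ite tE (.add (.var x) (.var x)) (.lit 1)
    (.get A (.sub tE (.add (.var x) (.var x))))))

lemma digit_of_lt {b z : ℕ} (h : z < b) : digit b z = 0 := by
  unfold digit; rw [Nat.div_eq_of_lt h]

lemma digit_of_mid {b z : ℕ} (h : b ≤ z) (h' : z < b + b) : digit b z = 1 := by
  unfold digit
  rw [Nat.div_eq_of_lt_le (k := 1) (by omega) (by omega)]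

/-- Digits have period `2 * b`, which permits tabulating them without division. -/
lemma digit_sub {b z : ℕ} (h : b + b ≤ z) : digit b (z - (b + b)) = digit b z := by
  unfold digit
  rcases Nat.eq_zero_or_pos b with rfl | hb
  · simp
  · obtain ⟨y, rfl⟩ := Nat.exists_eq_add_of_le h
    rw [Nat.add_sub_cancel_left, show b + b + y = y + b * 2 by omega, Nat.add_mul_div_left _ _ hb]
    omega

lemma dig_spec {A : Fin 32} {x b N : ℕ} {σ : St} {Q : St → Prop} (hx : x ≠ xt) (hb : σ.v x = b)
    (hb0 : 0 < b) (hN : σ.v xN = N) (hD : N + 1 ≤ D) (hW : 1 ≤ W)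
    (hQ : ∀ τ, Fr [xt] [A] σ τ → (∀ t ≤ N, τ.a A t = digit b t) → Q τ) :
    Tr I β W D (digCm A x) σ Q := by
  refine Tr.tab (digit b) hN hD ?_ hQ
  intro i hi τ hf ht hg _
  refine ⟨?_, (digit_le _ _).trans hW⟩
  simp only [Ex.ev, tE, ht, hf.1 x (by simpa using hx), hb]
  split_ifs with h1 h2
  · rw [digit_of_lt h1]
  · rw [digit_of_mid (by omega) h2]
  · rw [hg _ (by omega), digit_sub (by omega)]

/-- Computes which nodes are related to a node in `aR` by domination, for the relation that `cell`
expresses, and satisfy `valid`. -/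
def transCm (cell valid : Ex) : Cm :=
  .loop xs szE (.loop xt szE (.put aD (.add (.get aRow (.var xs)) tE)
    (.ite (.var xs) (.lit 1) (.ite tE (.lit 1) (.lit 1) (.lit 0)) (.ite tE (.lit 1) (.lit 0)
      (.ite (.lit 0) cell
        (.ite (.lit 0) (.add (.get aD (.add (.get aRow (.get aPar (.var xs))) tE))
          (.add (.get aD (.add (.get aRow (.var xs)) (.get aPar tE)))
            (.get aD (.add (.get aRow (.get aPar (.var xs))) (.get aPar tE))))) (.lit 1) (.lit 0))
        (.lit 0)))))) ;;
  .loop xt szE (.set xc (.lit 0) ;;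
    .loop xs szE (.set xc (.ite (.lit 0) (.get aR (.var xs))
      (.ite (.lit 0) (.get aD (.add (.get aRow (.var xs)) tE)) (.lit 1) (.var xc)) (.var xc))) ;;
    .put aR' tE (.ite tE (.lit 1) (.lit 0) (.ite (.lit 0) valid (.var xc) (.lit 0)))) ;;
  fill xt szE aR (.get aR' tE)

/-- Paths share their tails with the paths of the parents, so the three rules of `Dom` become a
recursion on pairs of nodes. Its boundary is node `0`, whose path is empty. -/
lemma dom_path {R : ℕ × ℕ → ℕ × ℕ → Prop} {s t : ℕ} (hs : s ≠ 0) (ht : t ≠ 0) :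
    Dom R (path s) (path t) ↔ R (nd s).cur (nd t).cur ∧ (Dom R (path (par s)) (path t) ∨
      Dom R (path s) (path (par t)) ∨ Dom R (path (par s)) (path (par t))) := by
  rw [path_pos hs, path_pos ht]
  constructor
  · intro h
    cases h with
    | left h1 h2 => exact ⟨h1, Or.inl h2⟩
    | right h1 h2 => exact ⟨h1, Or.inr (Or.inl h2)⟩
    | both h1 h2 => exact ⟨h1, Or.inr (Or.inr h2)⟩
  · rintro ⟨h1, h2 | h2 | h2⟩
    · exact .left h1 h2
    · exact .right h1 h2
    · exact .both h1 h2

lemma dom_path_zero {R : ℕ × ℕ → ℕ × ℕ → Prop} {s t : ℕ} (h : s = 0 ∨ t = 0) :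
    Dom R (path s) (path t) ↔ s = 0 ∧ t = 0 := by
  constructor
  · intro hd
    by_contra hne
    rcases h with rfl | rfl
    · rw [path_zero, path_pos (w := t) (by omega)] at hd; cases hd
    · rw [path_zero, path_pos (w := s) (by omega)] at hd; cases hd
  · rintro ⟨rfl, rfl⟩
    rw [path_zero]; exact .nil

lemma idx_inj {n s t s' t' : ℕ} (ht : t < n) (ht' : t' < n) (h : s * n + t = s' * n + t') :
    s = s' ∧ t = t' := by
  have h1 := congrArg (· % n) h
  simp only [Nat.mul_add_mod_self_right, Nat.mod_eq_of_lt ht,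
    Nat.mod_eq_of_lt ht'] at h1
  subst h1
  exact ⟨Nat.eq_of_mul_eq_mul_right (by omega) (by omega : s * n = s' * n), rfl⟩

/-- The array `aD` holds the truth values of domination for all pairs, stored by rows of length `N +
1`. It is filled in lexicographic order, so the entries needed by `dom_path` are present as soon as
they are used. -/
lemma trans_spec {cell valid : Ex} {σ : St} {N : ℕ} {Q : St → Prop} (Rel : ℕ × ℕ → ℕ × ℕ → Prop)
    (Vd : ℕ → Prop) (hT : TreeTab N σ) (hD : N + 1 ≤ D) (hW : 1 ≤ W)
    (hcell : ∀ τ, Fr [xs, xt, xc] [aD, aR', aR] σ τ → τ.v xs ≤ N → τ.v xt ≤ N →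
      (0 < cell.ev τ ↔ Rel (nd (τ.v xs)).cur (nd (τ.v xt)).cur))
    (hvalid : ∀ τ, Fr [xs, xt, xc] [aD, aR', aR] σ τ → τ.v xt ≤ N → (0 < valid.ev τ ↔ Vd (τ.v xt)))
    (hQ : ∀ τ, Fr [xs, xt, xc] [aD, aR', aR] σ τ → (∀ t ≤ N, τ.a aR t = ind (t ≠ 0 ∧ Vd t ∧
      ∃ s, s ≠ 0 ∧ s ≤ N ∧ 0 < σ.a aR s ∧ Dom Rel (path s) (path t))) → Q τ)
    (hR0 : σ.a aR 0 = 0) :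
    Tr I β W D (transCm cell valid) σ Q := by
  set dm : ℕ → ℕ → ℕ := fun s t => ind (Dom Rel (path s) (path t)) with hdm
  have hz : ∀ τ : St, τ.v xN = N → szE.ev τ = N + 1 := fun τ h => by simp [szE, Ex.ev, h]
  refine Tr.seq (Tr.loop (fun i τ => Fr [xs, xt] [aD] σ τ ∧
    ∀ s < i, ∀ t ≤ N, τ.a aD (s * (N + 1) + t) = dm s t) ?_ ?_ ?_ ?_)
  · exact ⟨Fr.refl _ _ _, fun s hs => absurd hs (by omega)⟩
  · rw [hz _ hT.size]; exact hD
  · rw [hz _ hT.size]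
    intro s hs τ ⟨hf, hd⟩
    have hN1 : (τ.setv xs s).v xN = N := by
      rw [(hf.setv s).1 xN (by decide), hT.size]
    refine Tr.loop (fun j υ => (Fr [xs, xt] [aD] σ υ ∧ υ.v xs = s) ∧
      (∀ s' < s, ∀ t ≤ N, υ.a aD (s' * (N + 1) + t) = dm s' t) ∧
      ∀ t < j, υ.a aD (s * (N + 1) + t) = dm s t) ?_ ?_ ?_ ?_
    · exact ⟨⟨hf.setv s, by simp⟩, hd, fun t ht => absurd ht (by omega)⟩
    · rw [hz _ hN1]; exact hD
    · rw [hz _ hN1]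
      intro t ht υ ⟨⟨hf1, hs1⟩, hd1, hd2⟩
      have hf2 : Fr [xs, xt] [aD] σ (υ.setv xt t) := hf1.setv t
      set υ' := υ.setv xt t with hυ'
      have hT2 : TreeTab N υ' := hT.fr hf2
      have e1 : υ'.v xs = s := by simp [hυ', hs1]
      have e2 : υ'.v xt = t := by simp [hυ']
      have e3 : υ'.a aD = υ.a aD := rfl
      have hc := hcell υ' (hf2.trans (Fr.refl [] [] _)) (by omega) (by omega)
      rw [e1, e2] at hc
      have hps := Tree.par_le s
      have hpt := Tree.par_le t
      have key : (Ex.ite (.var xs) (.lit 1) (.ite tE (.lit 1) (.lit 1) (.lit 0))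
          (.ite tE (.lit 1) (.lit 0)
          (.ite (.lit 0) cell
          (.ite (.lit 0) (.add (.get aD (.add (.get aRow (.get aPar (.var xs))) tE))
          (.add (.get aD (.add (.get aRow (.var xs)) (.get aPar tE)))
            (.get aD (.add (.get aRow (.get aPar (.var xs))) (.get aPar tE))))) (.lit 1) (.lit 0))
          (.lit 0)))).ev υ' = dm s t := by
        simp only [Ex.ev, tE, e1, e2]
        by_cases hs0 : s = 0
        · subst hs0
          rw [if_pos (by omega)]
          exact ite_eq_ind (by rw [dom_path_zero (Or.inl rfl)]; omega)
        by_cases ht0 : t = 0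
        · subst ht0
          rw [if_neg (by omega), if_pos (by omega)]
          exact (ind_false (by rw [dom_path_zero (Or.inr rfl)]; omega)).symm
        have hps' := Tree.par_lt hs0
        have hpt' := Tree.par_lt ht0
        rw [if_neg (by omega), if_neg (by omega), hT2.par s (by omega), hT2.par t (by omega),
          hT2.row s (by omega), hT2.row _ (by omega), e3, hd1 _ hps' _ (by omega),
          hd1 _ hps' _ (by omega), hd2 _ hpt']
        simp only [hdm]
        rw [ind_congr (dom_path hs0 ht0)]
        by_cases hcc : Rel (nd s).cur (nd t).cur
        · rw [if_pos (hc.2 hcc)]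
          refine ite_eq_ind ?_
          rw [Nat.add_pos_iff_pos_or_pos, Nat.add_pos_iff_pos_or_pos, ind_pos, ind_pos, ind_pos]
          tauto
        · rw [if_neg (fun h => hcc (hc.1 h)), ind_false (by tauto)]
      have hidx : (Ex.add (.get aRow (.var xs)) tE).ev υ' = s * (N + 1) + t := by
        simp only [Ex.ev, tE, e1, e2]; rw [hT2.row s (by omega)]
      refine Tr.put (by rw [key]; exact (ind_le _).trans hW) ?_
      rw [key, hidx]
      refine ⟨⟨hf2.seta _ _, e1⟩, ?_, ?_⟩
      · intro s' hs' t' ht'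
        rw [St.seta_a, if_neg, e3, hd1 s' hs' t' ht']
        rintro ⟨-, h⟩
        have := idx_inj (by omega) (by omega) h
        omega
      · intro t' ht'
        rw [St.seta_a]
        split_ifs with h
        · rw [(idx_inj (n := N + 1) (by omega) (by omega) h.2).2]
        · refine hd2 t' ?_
          by_contra hlt
          exact h ⟨rfl, by rw [show t' = t by omega]⟩
    · rw [hz _ hN1]
      intro υ ⟨⟨hf1, _⟩, hd1, hd2⟩
      refine ⟨hf1, fun s' hs' t ht => ?_⟩
      by_cases h : s' = s
      · subst h; exact hd2 t (by omega)
      · exact hd1 s' (by omega) t ht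
  intro σ1 ⟨f1, d1⟩
  rw [hz _ hT.size] at d1
  have hT1 : TreeTab N σ1 := hT.fr f1
  set g : ℕ → ℕ := fun t => ind (t ≠ 0 ∧ Vd t ∧
      ∃ s, s ≠ 0 ∧ s ≤ N ∧ 0 < σ.a aR s ∧ Dom Rel (path s) (path t)) with hg
  refine Tr.seq (Tr.loop (fun i τ => Fr [xs, xt, xc] [aR'] σ1 τ ∧ ∀ t < i, τ.a aR' t = g t)
    ⟨Fr.refl _ _ _, fun t ht => absurd ht (by omega)⟩ (by rw [hz _ hT1.size]; exact hD) ?_ ?_)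
  · rw [hz _ hT1.size]
    intro t ht τ ⟨hf, hd⟩
    refine Tr.seq (Tr.set (by simp [Ex.ev]) ?_)
    have hf2 : Fr [xs, xt, xc] [aR'] σ1 ((τ.setv xt t).setv xc ((Ex.lit 0).ev (τ.setv xt t))) :=
      (hf.setv t).setv _
    set τ2 := (τ.setv xt t).setv xc ((Ex.lit 0).ev (τ.setv xt t)) with hτ2
    have hz2 : szE.ev τ2 = N + 1 := hz _ (hT1.fr hf2).size
    -- The variable `xc` accumulates the disjunction over all marked nodes `s`. Results go to `aR'`,
    -- since each of them depends on the whole old table `aR`.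
    refine Tr.seq (Tr.loop (fun i υ => Fr [xs, xt, xc] [aR'] σ1 υ ∧ υ.v xt = t ∧
      υ.a aR' = τ.a aR' ∧
      υ.v xc = ind (∃ s < i, 0 < σ.a aR s ∧ Dom Rel (path s) (path t))) ?_ (by rw [hz2]; exact hD)
      ?_ ?_)
    · refine ⟨hf2, by simp [hτ2], rfl, ?_⟩
      rw [ind_false (by simp)]; simp [hτ2, Ex.ev]
    · rw [hz2]
      intro s hs υ ⟨h1, h2, h3, h4⟩
      have key : (Ex.ite (.lit 0) (.get aR (.var xs))
          (.ite (.lit 0) (.get aD (.add (.get aRow (.var xs)) tE)) (.lit 1) (.var xc))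
          (.var xc)).ev (υ.setv xs s) = ind (∃ s' < s + 1, 0 < σ.a aR s' ∧
            Dom Rel (path s') (path t)) := by
        have hT3 : TreeTab N υ := hT1.fr h1
        simp (decide := true) only [Ex.ev, tE, St.setv_v, St.setv_a, if_true, if_false, h2, h4]
        rw [h1.2 aR (by decide), f1.2 aR (by decide), hT3.row s (by omega), h1.2 aD (by decide),
          d1 s hs t (by omega)]
        by_cases hh : 0 < σ.a aR s ∧ Dom Rel (path s) (path t)
        · rw [if_pos hh.1, if_pos (ind_pos.2 hh.2), ind_true ⟨s, by omega, hh⟩]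
        · have : (∃ s' < s + 1, 0 < σ.a aR s' ∧ Dom Rel (path s') (path t)) ↔
              ∃ s' < s, 0 < σ.a aR s' ∧ Dom Rel (path s') (path t) := by
            constructor
            · rintro ⟨s', hs', h⟩
              refine ⟨s', ?_, h⟩
              by_contra hn
              rw [show s' = s by omega] at h
              exact hh h
            · rintro ⟨s', hs', h⟩
              exact ⟨s', by omega, h⟩
          rw [ind_congr this]
          split_ifs with a1 a2
          · exact absurd ⟨a1, ind_pos.1 a2⟩ hh
          · rfl
          · rfl
      refine Tr.set (by rw [key]; exact (ind_le _).trans hW) ?_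
      rw [key]
      exact ⟨(h1.setv _).setv _, by simp (decide := true) [h2], h3, by simp⟩
    rw [hz2]
    intro υ ⟨h1, h2, h3, h4⟩
    have hv := hvalid υ (f1.trans h1) (by omega)
    have key : (Ex.ite tE (.lit 1) (.lit 0) (.ite (.lit 0) valid (.var xc) (.lit 0))).ev υ = g t := by
      simp only [Ex.ev, tE, h2, h4]
      rw [h2] at hv
      simp only [hg]
      by_cases ht0 : t = 0
      · rw [if_pos (by omega), ind_false (by tauto)]
      rw [if_neg (by omega)]
      by_cases hvd : Vd t
      · rw [if_pos (hv.2 hvd)]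
        refine ind_congr ⟨?_, ?_⟩
        · rintro ⟨s, hs, h5, h6⟩
          refine ⟨ht0, hvd, s, ?_, by omega, h5, h6⟩
          rintro rfl
          omega
        · rintro ⟨_, _, s, _, hs, h5, h6⟩
          exact ⟨s, by omega, h5, h6⟩
      · rw [if_neg (fun h => hvd (hv.1 h)), ind_false (by tauto)]
    refine Tr.put (by rw [key]; exact (ind_le _).trans hW) ?_
    rw [key]
    have hix : tE.ev υ = t := by simp [tE, Ex.ev, h2]
    rw [hix]
    refine ⟨h1.seta _ _, fun t' ht' => ?_⟩
    rw [St.seta_a]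
    split_ifs with h
    · rw [h.2]
    · rw [h3]
      refine hd t' ?_
      by_contra hn
      exact h ⟨rfl, by omega⟩
  intro σ2 ⟨f2, d2⟩
  rw [hz _ hT1.size] at d2
  refine Tr.tab g (hT1.fr f2).size hD ?_ ?_
  · intro i hi τ hf ht _ _
    refine ⟨?_, (ind_le _).trans hW⟩
    simp only [Ex.ev, tE, ht]
    rw [hf.2 aR' (by decide)]
    exact d2 i (by omega)
  · intro τ hf hr
    exact hQ τ ((f1.trans f2 (ys := [xs, xt, xc]) (bs := [aD, aR'])).trans hf) hr

end Loop

/-! ### Transitions for introducing a vertex, forgetting a vertex and adding an edge -/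

namespace Loop
open Tree

variable {I : ℕ → ℕ} {β W D : ℕ}

/-- `clr` with place value `xb`, for digits that are tabulated in `aH`. -/
def clrE (z : Ex) : Ex := .ite (.lit 0) (.get aH z) (.sub z (.var xb)) z

def zE (x : ℕ) : Ex := .get aZ (.var x)
def cardE (x : ℕ) : Ex := .get aA (.var x)

def introCell : Ex :=
  eqE (zE xs) (clrE (zE xt)) (.ite (cardE xt) (.add (cardE xs) (.get aH (zE xt))) (.lit 0)
    (.ite (.var xK) (cardE xt) (.lit 0) (.lit 1))) (.lit 0)

def forgetCell : Ex :=
  eqE (clrE (zE xs)) (zE xt) (.ite (cardE xt) (cardE xs) (.lit 0)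
    (.ite (.var xK) (cardE xt) (.lit 0) (.lit 1))) (.lit 0)

/-- Counts the intervals of the path of a node in which the digit is set. -/
def runCm : Cm :=
  fill xt szE aRun (.ite tE (.lit 1) (.lit 0) (.add (parE aRun)
    (.ite (.lit 0) (.get aH (zE xt)) (.ite (.lit 0) (.get aH (parE aZ)) (.lit 0) (.lit 1)) (.lit 0))))

def introTab : Cm :=
  digCm aH xb ;; runCm ;; transCm introCell (eqE (.get aRun tE) (.lit 1) (.lit 1) (.lit 0))

def forgetTab : Cm := digCm aH xb ;; transCm forgetCell (.lit 1)

def edgeTab : Cm :=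
  digCm aH xb ;; digCm aH' xb' ;;
  fill xt szE aCov (.ite tE (.lit 1) (.lit 0) (.ite (.lit 0) (parE aCov) (.lit 1)
    (.ite (.lit 0) (.get aH (zE xt)) (.ite (.lit 0) (.get aH' (zE xt)) (.lit 1) (.lit 0)) (.lit 0)))) ;;
  fill xt szE aR (.ite (.lit 0) (.get aCov tE) (.get aR tE) (.lit 0))

/-- Ensures that looking up a digit of an encoded set in `aH` stays within the tabulated range. -/
lemma cur_le (w : ℕ) : (nd w).cur.1 ≤ w ∧ (nd w).cur.2 ≤ w := by
  have := nd_le w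
  simp only [Nd.cur]; split_ifs <;> dsimp only <;> omega

lemma ev_clrE {τ : St} {z : Ex} {b : ℕ} (hb : τ.v xb = b) (hz : τ.a aH (z.ev τ) = digit b (z.ev τ)) :
    (clrE z).ev τ = clr b (z.ev τ) := by
  simp only [clrE, Ex.ev, hb, hz, clr]
  split_ifs <;> first | rfl | omega

lemma introCell_spec {τ : St} {N b K : ℕ} (hT : TreeTab N τ) (hH : ∀ t ≤ N, τ.a aH t = digit b t)
    (hb : τ.v xb = b) (hK : τ.v xK = K) (hs : τ.v xs ≤ N) (ht : τ.v xt ≤ N) :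
    0 < introCell.ev τ ↔ IntroRel b K (nd (τ.v xs)).cur (nd (τ.v xt)).cur := by
  have h1 := hT.z _ hs
  have h2 := hT.z _ ht
  have h3 := hT.a _ hs
  have h4 := hT.a _ ht
  have hl := cur_le (τ.v xt)
  have hz : (zE xt).ev τ = (nd (τ.v xt)).cur.1 := by simp [zE, Ex.ev, h2]
  have h5 := hH _ (hl.1.trans ht)
  have hc := ev_clrE (z := zE xt) hb (by rw [hz, h5])
  rw [hz] at hc
  simp only [introCell, ev_eqE, hc, Ex.ev, hz, h5, cardE, h3, h4, hK, IntroRel]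
  have e : (zE xs).ev τ = (nd (τ.v xs)).cur.1 := by simp [zE, Ex.ev, h1]
  rw [e]
  split_ifs <;> omega

lemma forgetCell_spec {τ : St} {N b K : ℕ} (hT : TreeTab N τ) (hH : ∀ t ≤ N, τ.a aH t = digit b t)
    (hb : τ.v xb = b) (hK : τ.v xK = K) (hs : τ.v xs ≤ N) (ht : τ.v xt ≤ N) :
    0 < forgetCell.ev τ ↔ ForgetRel b K (nd (τ.v xs)).cur (nd (τ.v xt)).cur := by
  have h1 := hT.z _ hs
  have h2 := hT.z _ ht
  have h3 := hT.a _ hs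
  have h4 := hT.a _ ht
  have hl := cur_le (τ.v xs)
  have hz : (zE xs).ev τ = (nd (τ.v xs)).cur.1 := by simp [zE, Ex.ev, h1]
  have h5 := hH _ (hl.1.trans hs)
  have hc := ev_clrE (z := zE xs) hb (by rw [hz, h5])
  rw [hz] at hc
  have e : (zE xt).ev τ = (nd (τ.v xt)).cur.1 := by simp [zE, Ex.ev, h2]
  simp only [forgetCell, ev_eqE, hc, Ex.ev, e, cardE, h3, h4, hK, ForgetRel]
  split_ifs <;> omega

/-- A run starts at `t` iff the digit is set there and not at the parent. The root needs no special
treatment, because the state assigned to node `0` encodes the empty set and has digit `0`. -/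
lemma runs_path {b t : ℕ} (ht : t ≠ 0) : runs (fun y => digit b y.1 = 1) (path t) =
    runs (fun y => digit b y.1 = 1) (path (par t)) +
      if 0 < digit b (nd t).cur.1 then if 0 < digit b (nd (par t)).cur.1 then 0 else 1 else 0 := by
  rw [path_pos ht, runs]
  congr 1
  have h1 := digit_le b (nd t).cur.1
  have h2 := digit_le b (nd (par t)).cur.1
  have h3 : (∃ y ∈ (path (par t)).head?, digit b y.1 = 1) ↔ 0 < digit b (nd (par t)).cur.1 := by
    by_cases hp : par t = 0
    · rw [hp, path_zero, nd_small (by omega)]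
      simp [Nd.cur, digit]
    · rw [path_pos hp]
      simp only [List.head?_cons, Option.mem_def, Option.some.injEq, exists_eq_left']
      omega
  simp only [h3]
  split_ifs <;> first | rfl | omega

lemma runs_path_le (b t : ℕ) : runs (fun y => digit b y.1 = 1) (path t) ≤ t := by
  induction t using Nat.strong_induction_on with
  | _ t ih =>
    by_cases h : t = 0
    · subst h; rw [path_zero]; simp [runs]
    · have := par_lt h
      have := ih _ this
      rw [runs_path h]
      split_ifs <;> omega

lemma run_spec {σ : St} {N b : ℕ} {Q : St → Prop} (hT : TreeTab N σ)
    (hH : ∀ t ≤ N, σ.a aH t = digit b t) (hD : N + 1 ≤ D) (hW : N ≤ W)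
    (hQ : ∀ τ, Fr [xt] [aRun] σ τ →
      (∀ t ≤ N, τ.a aRun t = runs (fun y => digit b y.1 = 1) (path t)) → Q τ) :
    Tr I β W D runCm σ Q := by
  refine Tr.tab _ hT.size hD ?_ hQ
  intro i hi τ hf ht hg _
  refine ⟨?_, (runs_path_le _ _).trans (hi.trans hW)⟩
  have hT' : TreeTab N τ := hT.fr hf
  simp only [Ex.ev, tE, zE, parE, ht]
  by_cases h0 : i = 0
  · subst h0; rw [path_zero]; simp [runs]
  have hp := par_lt h0
  rw [if_neg (by omega), hT'.par i hi, hg _ hp, hT'.z i hi, hT'.z _ (by omega), hf.2 aH (by decide),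
    hH _ (by have := cur_le i; omega), hH _ (by have := cur_le (par i); omega), runs_path h0]

lemma introTab_spec {σ : St} {N b K : ℕ} {Q : St → Prop} (hT : TreeTab N σ) (hb : σ.v xb = b)
    (hb0 : 0 < b) (hK : σ.v xK = K) (hD : N + 1 ≤ D) (hW : N + 1 ≤ W) (hR0 : σ.a aR 0 = 0)
    (hQ : ∀ τ, Fr [xs, xt, xc] [aH, aRun, aD, aR', aR] σ τ → (∀ t ≤ N, τ.a aR t = ind (t ≠ 0 ∧
      runs (fun y => digit b y.1 = 1) (path t) = 1 ∧
      ∃ s, s ≠ 0 ∧ s ≤ N ∧ 0 < σ.a aR s ∧ Dom (IntroRel b K) (path s) (path t))) → Q τ) :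
    Tr I β W D introTab σ Q := by
  refine Tr.seq (dig_spec (by decide) hb hb0 hT.size hD (by omega) fun σ1 f1 h1 => ?_)
  refine Tr.seq (run_spec (hT.fr f1) h1 hD (by omega) fun σ2 f2 h2 => ?_)
  have f12 : Fr [xt] [aH, aRun] σ σ2 := f1.trans f2
  refine trans_spec (IntroRel b K) (fun t => runs (fun y => digit b y.1 = 1) (path t) = 1)
    (hT.fr f12) hD (by omega) ?_ ?_ ?_ (by rw [f12.2 aR (by decide), hR0])
  · intro τ hf hs ht
    have f : Fr [xs, xt, xc] [aH, aRun, aD, aR', aR] σ τ := f12.trans hf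
    refine introCell_spec (hT.fr f) ?_ (by rw [f.1 _ (by decide), hb]) (by rw [f.1 _ (by decide), hK])
      hs ht
    intro t ht
    rw [hf.2 aH (by decide), f2.2 aH (by decide), h1 t ht]
  · intro τ hf ht
    simp only [ev_eqE, Ex.ev, tE]
    have e : τ.a aRun (τ.v xt) = runs (fun y => digit b y.1 = 1) (path (τ.v xt)) := by
      rw [hf.2 aRun (by decide), h2 _ ht]
    rw [← e]
    split_ifs with h <;> simp [h]
  · intro τ hf hR
    refine hQ τ (f12.trans hf) ?_
    rwa [f12.2 aR (by decide)] at hR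

lemma forgetTab_spec {σ : St} {N b K : ℕ} {Q : St → Prop} (hT : TreeTab N σ) (hb : σ.v xb = b)
    (hb0 : 0 < b) (hK : σ.v xK = K) (hD : N + 1 ≤ D) (hW : N + 1 ≤ W) (hR0 : σ.a aR 0 = 0)
    (hQ : ∀ τ, Fr [xs, xt, xc] [aH, aD, aR', aR] σ τ → (∀ t ≤ N, τ.a aR t = ind (t ≠ 0 ∧
      ∃ s, s ≠ 0 ∧ s ≤ N ∧ 0 < σ.a aR s ∧ Dom (ForgetRel b K) (path s) (path t))) → Q τ) :
    Tr I β W D forgetTab σ Q := by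
  refine Tr.seq (dig_spec (by decide) hb hb0 hT.size hD (by omega) fun σ1 f1 h1 => ?_)
  refine trans_spec (ForgetRel b K) (fun _ => True)
    (hT.fr f1) hD (by omega) ?_ ?_ ?_ (by rw [f1.2 aR (by decide), hR0])
  · intro τ hf hs ht
    have f : Fr [xs, xt, xc] [aH, aD, aR', aR] σ τ := f1.trans hf
    refine forgetCell_spec (hT.fr f) ?_ (by rw [f.1 _ (by decide), hb]) (by rw [f.1 _ (by decide), hK])
      hs ht
    intro t ht
    rw [hf.2 aH (by decide), h1 t ht]
  · intro τ hf ht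
    simp [Ex.ev]
  · intro τ hf hR
    refine hQ τ (f1.trans hf) ?_
    rw [f1.2 aR (by decide)] at hR
    simpa using hR

lemma edgeTab_spec {σ : St} {N b b' : ℕ} {Q : St → Prop} (hT : TreeTab N σ) (hb : σ.v xb = b)
    (hb0 : 0 < b) (hb' : σ.v xb' = b') (hb0' : 0 < b') (hD : N + 1 ≤ D) (hW : N + 1 ≤ W)
    (hRW : ∀ t ≤ N, σ.a aR t ≤ 1)
    (hQ : ∀ τ, Fr [xt] [aH, aH', aCov, aR] σ τ → (∀ t ≤ N, τ.a aR t =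
      if ∃ y ∈ path t, digit b y.1 = 1 ∧ digit b' y.1 = 1 then σ.a aR t else 0) → Q τ) :
    Tr I β W D edgeTab σ Q := by
  refine Tr.seq (dig_spec (by decide) hb hb0 hT.size hD (by omega) fun σ1 f1 h1 => ?_)
  refine Tr.seq (dig_spec (by decide) (b := b') (by rw [f1.1 _ (by decide), hb']) hb0' (hT.fr f1).size
    hD (by omega) fun σ2 f2 h2 => ?_)
  have f12 : Fr [xt] [aH, aH'] σ σ2 := f1.trans f2
  have hT2 : TreeTab N σ2 := hT.fr f12
  set g : ℕ → ℕ := fun t => ind (∃ y ∈ path t, digit b y.1 = 1 ∧ digit b' y.1 = 1) with hg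
  refine Tr.seq (Tr.tab g hT2.size hD ?_ fun σ3 f3 h3 => ?_)
  · intro i hi τ hf ht hgi _
    refine ⟨?_, (ind_le _).trans (by omega)⟩
    have hT' : TreeTab N τ := hT2.fr hf
    simp only [Ex.ev, tE, zE, parE, ht]
    by_cases h0 : i = 0
    · subst h0
      rw [if_pos (by omega)]
      exact (ind_false (by rw [path_zero]; simp)).symm
    have hp := par_lt h0
    have hc := cur_le i
    rw [if_neg (by omega), hT'.par i hi, hgi _ hp, hT'.z i hi, hf.2 aH (by decide),
      hf.2 aH' (by decide), f2.2 aH (by decide), h1 _ (by omega), h2 _ (by omega)]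
    simp only [hg, ind_pos]
    rw [path_pos h0]
    simp only [List.mem_cons, exists_eq_or_imp]
    have e1 := digit_le b (nd i).cur.1
    have e2 := digit_le b' (nd i).cur.1
    by_cases hh : ∃ y ∈ path (par i), digit b y.1 = 1 ∧ digit b' y.1 = 1
    · rw [if_pos hh, ind_true (Or.inr hh)]
    · rw [if_neg hh]
      simp only [hh, or_false]
      split_ifs with a1 a2
      · exact (ind_true ⟨by omega, by omega⟩).symm
      · exact (ind_false (by omega)).symm
      · exact (ind_false (by omega)).symm
  have f13 : Fr [xt] [aH, aH', aCov] σ σ3 := f12.trans f3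
  refine Tr.tab (fun t => if ∃ y ∈ path t, digit b y.1 = 1 ∧ digit b' y.1 = 1 then σ.a aR t else 0)
    (hT.fr f13).size hD ?_ fun τ hf h => hQ τ (f13.trans hf) h
  intro i hi τ hf ht _ hR
  have hR1 := hRW i hi
  refine ⟨?_, by split_ifs <;> omega⟩
  simp only [Ex.ev, tE, ht]
  rw [hf.2 aCov (by decide), h3 i hi, hR i le_rfl, f13.2 aR (by decide)]
  simp only [hg, ind_pos]

end Loop

namespace Loop
open Tree

variable {I : ℕ → ℕ} {β W D D' : ℕ}

/-! ### Execution with time bounds -/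

/-- The execution of `c` from `σ` respects the bounds, takes time at most `T` and establishes `Q`. -/
def Tm (I : ℕ → ℕ) (β W D : ℕ) (c : Cm) (σ : St) (T : ℕ) (Q : St → Prop) : Prop :=
  c.ok I β W D σ ∧ c.time I σ ≤ T ∧ Q (c.ev I σ)

lemma Tr.timed {c : Cm} {σ : St} {Q : St → Prop} (h : Tr I β W D c σ Q) (hD : D ≤ D') :
    Tm I β W D' c σ (2 * c.len * (D + 1) ^ c.depth) Q :=
  ⟨c.ok_mono le_rfl hD σ h.1, c.time_le σ h.1, h.2⟩

lemma Tm.mono {c : Cm} {σ : St} {Q Q' : St → Prop} {T T' : ℕ} (h : Tm I β W D c σ T Q) (hT : T ≤ T')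
    (hQ : ∀ τ, Q τ → Q' τ) : Tm I β W D c σ T' Q' := ⟨h.1, h.2.1.trans hT, hQ _ h.2.2⟩

lemma Tm.seq {c d : Cm} {σ : St} {Q : St → Prop} {T T' : ℕ}
    (h : Tm I β W D c σ T fun τ => Tm I β W D d τ T' Q) : Tm I β W D (c ;; d) σ (T + T') Q :=
  ⟨⟨h.1, h.2.2.1⟩, by rw [Cm.time]; exact Nat.add_le_add h.2.1 h.2.2.2.1, h.2.2.2.2⟩

lemma Tm.loop {x : ℕ} {e : Ex} {c : Cm} {σ : St} {Q : St → Prop} (T : ℕ → ℕ) (Inv : ℕ → St → Prop)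
    (h0 : Inv 0 σ) (hD : e.ev σ ≤ D)
    (hs : ∀ i < e.ev σ, ∀ τ, Inv i τ → Tm I β W D c (τ.setv x i) (T i) (Inv (i + 1)))
    (hQ : ∀ τ, Inv (e.ev σ) τ → Q τ) :
    Tm I β W D (.loop x e c) σ (e.len + 8 + ∑ i ∈ Finset.range (e.ev σ), (T i + 8)) Q := by
  have key : ∀ i ≤ e.ev σ, Inv i (iter (fun i τ => c.ev I (τ.setv x i)) σ i) := by
    intro i
    induction i with
    | zero => intro _; exact h0
    | succ i ih => intro hi; exact (hs i (by omega) _ (ih (by omega))).2.2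
  refine ⟨⟨hD, fun i hi => (hs i hi _ (key i hi.le)).1⟩, ?_, hQ _ (key _ le_rfl)⟩
  rw [Cm.time]
  refine Nat.add_le_add_left (Finset.sum_le_sum fun i hi => Nat.add_le_add_right ?_ _) _
  have hi := Finset.mem_range.1 hi
  exact (hs i hi _ (key i hi.le)).2.1

lemma Tm.and_frame {c : Cm} {σ : St} {Q : St → Prop} {T : ℕ} (h : Tm I β W D c σ T Q)
    {xs : List ℕ} {as : List (Fin 32)} (hx : c.wv ⊆ xs) (ha : c.wa ⊆ as) :
    Tm I β W D c σ T fun τ => Q τ ∧ Fr xs as σ τ :=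
  ⟨h.1, h.2.1, h.2.2, fun y hy => c.frame_v σ y fun e => hy (hx e),
    fun B hB => c.frame_a σ B fun e => hB (ha e)⟩

/-- Runs `c` if the value of `e` is `1` and does nothing if it is `0`. -/
lemma Tr.when {x : ℕ} {e : Ex} {c : Cm} {σ : St} {Q : St → Prop} {p : Prop} (he : e.ev σ = ind p)
    (hD : 1 ≤ D) (h1 : p → Tr I β W D c (σ.setv x 0) Q) (h0 : ¬ p → Q σ) :
    Tr I β W D (.loop x e c) σ Q := by
  by_cases hp : p
  · rw [ind_true hp] at he
    refine Tr.loop (fun i τ => (i = 0 → τ = σ) ∧ (i = 1 → Q τ)) (by simp) (he ▸ hD) ?_ ?_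
    · intro i hi τ h
      obtain rfl : i = 0 := by omega
      rw [h.1 rfl]
      exact (h1 hp).mono fun τ h => by simp [h]
    · rw [he]; intro τ h; exact h.2 rfl
  · rw [ind_false hp] at he
    refine Tr.loop (fun _ τ => τ = σ) rfl (by omega) (fun i hi => by omega) ?_
    rintro τ rfl; exact h0 hp

/-- A loop with at most one pass serves as a conditional. The overhead is `8` for the loop and `8`
for its pass. -/
lemma Tm.when {x : ℕ} {e : Ex} {c : Cm} {σ : St} {Q : St → Prop} {p : Prop} {T T' : ℕ}
    (he : e.ev σ = ind p)
    (hD : 1 ≤ D) (h1 : p → Tm I β W D c (σ.setv x 0) T Q) (h0 : ¬ p → Q σ)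
    (hT : e.len + 16 + (if ind p = 1 then T else 0) ≤ T') :
    Tm I β W D (.loop x e c) σ T' Q := by
  by_cases hp : p
  · rw [ind_true hp] at he
    rw [if_pos (ind_true hp)] at hT
    have := Tm.loop (I := I) (β := β) (W := W) (D := D) (x := x) (e := e) (c := c) (σ := σ) (Q := Q)
      (fun _ => T) (fun i τ => (i = 0 → τ = σ) ∧ (i = 1 → Q τ)) (by simp) (he ▸ hD) ?_ ?_
    · exact this.mono (by rw [he]; simp; omega) fun _ h => h
    · intro i hi τ h
      obtain rfl : i = 0 := by omega
      rw [h.1 rfl]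
      exact (h1 hp).mono le_rfl fun τ h => by simp [h]
    · rw [he]; intro τ h; exact h.2 rfl
  · rw [ind_false hp] at he
    have := Tm.loop (I := I) (β := β) (W := W) (D := D) (x := x) (e := e) (c := c) (σ := σ) (Q := Q)
      (fun _ => T) (fun _ τ => τ = σ) rfl (by omega) (fun i hi => by omega) ?_
    · exact this.mono (by rw [he]; simp; omega) fun _ h => h
    · rintro τ rfl; exact h0 hp

lemma Tm.set {x : ℕ} {e : Ex} {σ : St} {Q : St → Prop} (h : e.ev σ ≤ W)
    (hQ : Q (σ.setv x (e.ev σ))) : Tm I β W D (.set x e) σ (e.len + 1) Q := ⟨h, le_rfl, hQ⟩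

lemma Tm.rd {x : ℕ} {e : Ex} {σ : St} {Q : St → Prop} (h : e.ev σ < β) (hI : I (e.ev σ) ≤ W)
    (hQ : Q (σ.setv x (I (e.ev σ)))) : Tm I β W D (.rd x e) σ (e.len + 1) Q := ⟨⟨h, hI⟩, le_rfl, hQ⟩

lemma Tm.put {A : Fin 32} {i e : Ex} {σ : St} {Q : St → Prop} (h : e.ev σ ≤ W)
    (hQ : Q (σ.seta A (i.ev σ) (e.ev σ))) : Tm I β W D (.put A i e) σ (i.len + e.len + 9) Q :=
  ⟨h, le_rfl, hQ⟩

/-! ### The input -/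

/-- The input words describe the adjacency lists and the path decomposition. -/
structure Inp {n : ℕ} {G : SimpleGraph (Fin n)} (A : AdjacencyLists G) (P : PathDecomposition G)
    (I : ℕ → ℕ) (β W : ℕ) : Prop where
  size : I 0 = n
  vert : ∀ j : Fin (2 * n), I (1 + (j + j)) = P.p j
  kind : ∀ j : Fin (2 * n), I (2 + (j + j)) = if P.isIntro j = true then 1 else 0
  deg : ∀ v : Fin n, I (4 * n + 1 + v) + (A.nbrs v).length = I (4 * n + 2 + v)
  nbr : ∀ v : Fin n, ∀ e (h : e < (A.nbrs v).length),
    I (5 * n + 2 + I (4 * n + 1 + v) + e) = (A.nbrs v)[e]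
  le : ∀ v : Fin n, 5 * n + 2 + I (4 * n + 1 + v) + (A.nbrs v).length ≤ β
  len : 5 * n + 2 ≤ β
  val : ∀ i < β, I i ≤ W

/-! ### Nodes of the path decomposition -/

/-- Registration of the vertices of the bag `X` in slots: `aSl` holds the place value for each vertex, and
`aUs` marks the place values in use. -/
structure Slots {n : ℕ} (X : Finset (Fin n)) (m : ℕ) (sl : Fin n → ℕ) (σ : St) : Prop where
  inj : Set.InjOn sl X
  lt : ∀ u ∈ X, sl u < m
  val : ∀ u : Fin n, σ.a aSl u = if u ∈ X then 2 ^ sl u else 0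
  us : ∀ i < m, σ.a aUs (2 ^ i) = ind (∃ u ∈ X, sl u = i)

lemma Slots.congr {n : ℕ} {X : Finset (Fin n)} {m : ℕ} {sl : Fin n → ℕ} {σ τ : St}
    (h : Slots X m sl σ) (h1 : τ.a aSl = σ.a aSl) (h2 : τ.a aUs = σ.a aUs) : Slots X m sl τ :=
  ⟨h.inj, h.lt, by rw [h1]; exact h.val, by rw [h2]; exact h.us⟩

/-- The table `aR` is correct. -/
structure Dp {n : ℕ} (K N m : ℕ) (S : Finset (Fin n)) (E : Fin n → Fin n → Prop)
    (X : Finset (Fin n)) (σ : St) : Prop where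
  good : ∃ sl, Slots X m sl σ ∧ Good K N S E X sl fun t => 0 < σ.a aR t
  zero : σ.a aR 0 = 0
  le : ∀ t ≤ N, σ.a aR t ≤ 1

/-- The parameters in the variables. -/
structure Par (n m K N : ℕ) (σ : St) : Prop where
  size : σ.v xn = n
  mx : σ.v xmx = m
  bd : σ.v xK = K
  tab : TreeTab N σ

lemma Par.fr {n m K N : ℕ} {σ τ : St} (h : Par n m K N σ) {xs : List ℕ} {as : List (Fin 32)}
    (hf : Fr xs as σ τ) (hx : ∀ x ∈ [xn, xmx, xK, xN], x ∉ xs := by decide)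
    (ha : ∀ B ∈ [aPar, aZ, aA, aRow], B ∉ as := by decide) : Par n m K N τ :=
  ⟨(hf.1 _ (hx _ (by decide))).trans h.size, (hf.1 _ (hx _ (by decide))).trans h.mx,
    (hf.1 _ (hx _ (by decide))).trans h.bd, h.tab.fr hf (hx _ (by decide)) ha⟩

lemma le_exponent (m K : ℕ) : m ≤ 91 * (m + K + 1) ^ 2 := by
  have : m + K + 1 ≤ (m + K + 1) ^ 2 := Nat.le_self_pow two_ne_zero _
  omega

/-- Finds a free slot. -/
def slotCm : Cm :=
  .set xb (.lit 0) ;; .set xc (.lit 1) ;;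
  .loop xi (.var xmx) (.set xb (.ite (.lit 0) (.var xb) (.var xb)
    (.ite (.lit 0) (.get aUs (.var xc)) (.var xb) (.var xc))) ;; .set xc (.add (.var xc) (.var xc)))

/-- The place values `1, 2, 4, …` are tried in turn. Since place values are positive, `xb = 0` can
mean that no free one has been found so far. -/
lemma slot_spec {n m : ℕ} {X : Finset (Fin n)} {sl : Fin n → ℕ} {σ : St} {Q : St → Prop}
    (hm : σ.v xmx = m) (hs : Slots X m sl σ) (hX : X.card < m) (hD : m ≤ D) (hW : 2 ^ m ≤ W)
    (hQ : ∀ τ, Fr [xb, xc, xi] [] σ τ → ∀ i < m, τ.v xb = 2 ^ i → (∀ u ∈ X, sl u ≠ i) → Q τ) :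
    Tr I β W D slotCm σ Q := by
  have hW1 : 1 ≤ W := Nat.one_le_two_pow.trans hW
  refine Tr.seq (Tr.set (by simp [Ex.ev]) (Tr.seq (Tr.set (by simpa [Ex.ev] using hW1) ?_)))
  set σ' := (σ.setv xb ((Ex.lit 0).ev σ)).setv xc ((Ex.lit 1).ev (σ.setv xb ((Ex.lit 0).ev σ))) with hσ'
  have f' : Fr [xb, xc, xi] [] σ σ' := ((Fr.refl _ _ _).setv _).setv _
  have hm' : (Ex.var xmx).ev σ' = m := by rw [Ex.ev, f'.1 _ (by decide), hm]
  refine Tr.loop (fun i τ => Fr [xb, xc, xi] [] σ τ ∧ τ.v xc = 2 ^ i ∧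
    ((τ.v xb = 0 ∧ ∀ i' < i, σ.a aUs (2 ^ i') ≠ 0) ∨
      ∃ i' < i, τ.v xb = 2 ^ i' ∧ σ.a aUs (2 ^ i') = 0)) ?_ (by rw [hm']; exact hD) ?_ ?_
  · refine ⟨f', by simp [hσ', Ex.ev], Or.inl ⟨by simp [hσ', Ex.ev], fun i' h => by omega⟩⟩
  · rw [hm']
    intro i hi τ ⟨h1, h2, h3⟩
    have hle : 2 ^ (i + 1) ≤ W := (Nat.pow_le_pow_right (by omega) (by omega)).trans hW
    have hp : 2 ^ (i + 1) = 2 ^ i + 2 ^ i := by rw [pow_succ]; omega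
    have hpos : 0 < 2 ^ i := by positivity
    have key : ∃ b, (Ex.ite (.lit 0) (.var xb) (.var xb)
        (.ite (.lit 0) (.get aUs (.var xc)) (.var xb) (.var xc))).ev (τ.setv xi i) = b ∧ b ≤ W ∧
        ((b = 0 ∧ ∀ i' < i + 1, σ.a aUs (2 ^ i') ≠ 0) ∨
          ∃ i' < i + 1, b = 2 ^ i' ∧ σ.a aUs (2 ^ i') = 0) := by
      refine ⟨_, rfl, ?_⟩
      simp (decide := true) only [Ex.ev, St.setv_v, if_false, St.setv_a, h2, h1.2 aUs (by decide)]
      rcases h3 with ⟨h3, h4⟩ | ⟨i', hi', h3, h4⟩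
      · rw [if_neg (by omega)]
        split_ifs with h5
        · refine ⟨by omega, Or.inl ⟨h3, fun i' hi' => ?_⟩⟩
          by_cases h : i' = i
          · subst h; omega
          · exact h4 i' (by omega)
        · exact ⟨by omega, Or.inr ⟨i, by omega, rfl, by omega⟩⟩
      · have : 0 < 2 ^ i' := by positivity
        have : 2 ^ i' ≤ 2 ^ i := Nat.pow_le_pow_right (by omega) hi'.le
        rw [if_pos (by omega)]
        exact ⟨by omega, Or.inr ⟨i', by omega, h3, h4⟩⟩
    obtain ⟨b, e1, e2, e3⟩ := key
    refine Tr.seq (Tr.set (by rw [e1]; exact e2) ?_)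
    rw [e1]
    refine Tr.set ?_ ⟨((h1.setv _).setv _).setv _, ?_, ?_⟩
    · simp (decide := true) only [Ex.ev, St.setv_v, if_false, h2]; omega
    · simp (decide := true) only [Ex.ev, St.setv_v, if_false, if_true, h2]; omega
    · simpa (decide := true) only [Ex.ev, St.setv_v, if_false, if_true] using e3
  · rw [hm']
    intro τ ⟨h1, _, h3⟩
    rcases h3 with ⟨_, h4⟩ | ⟨i, hi, h3, h4⟩
    · exfalso
      -- If no slot were free, the fewer than `m` vertices of `X` would occupy `m` slots.
      have : Finset.range m ⊆ X.image sl := by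
        intro i hi
        have hi := Finset.mem_range.1 hi
        have := h4 i hi
        rw [hs.us i hi] at this
        have : ∃ u ∈ X, sl u = i := by by_contra hn; exact this (ind_false hn)
        simpa using this
      have h5 := (Finset.card_le_card this).trans Finset.card_image_le
      rw [Finset.card_range] at h5
      omega
    · rw [hs.us i hi] at h4
      refine hQ τ h1 i hi h3 fun u hu e => ?_
      rw [ind_true ⟨u, hu, e⟩] at h4
      omega

def introCm : Cm :=
  slotCm ;; .put aUs (.var xb) (.lit 1) ;; .put aSl (.var xv) (.var xb) ;; introTab

lemma intro_spec {n m K N : ℕ} {S X : Finset (Fin n)} {E : Fin n → Fin n → Prop} {σ : St} {v : Fin n}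
    {Q : St → Prop} (hp : Par n m K N σ) (h : Dp K N m S E X σ) (hv : σ.v xv = v) (hXS : X ⊆ S)
    (hvS : v ∉ S) (hE : ∀ a b, E a b → a ∈ S ∧ b ∈ S) (hX : (insert v X).card ≤ m)
    (hN : 2 ^ (91 * (m + K + 1) ^ 2) ≤ N) (hD : N + 1 ≤ D) (hW : N + 1 ≤ W)
    (hQ : ∀ τ, Par n m K N τ → Dp K N m (insert v S) E (insert v X) τ → τ.v xb = τ.a aSl v →
      τ.v xv = v → Q τ) :
    Tr I β W D introCm σ Q := by
  obtain ⟨sl, hs, hg⟩ := h.good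
  have hvX : v ∉ X := fun h => hvS (hXS h)
  have hc : X.card < m := by rw [Finset.card_insert_of_notMem hvX] at hX; omega
  have hmN : 2 ^ m ≤ N := (Nat.pow_le_pow_right (by omega) (le_exponent m K)).trans hN
  have hm : m < 2 ^ m := Nat.lt_two_pow_self
  refine Tr.seq (slot_spec hp.mx hs hc (by omega) (by omega) fun σ1 f1 i hi hb hfree => ?_)
  have hpow : 2 ^ i ≤ W := (Nat.pow_le_pow_right (by omega) hi.le).trans (by omega)
  have e1 : (Ex.var xb).ev σ1 = 2 ^ i := hb
  refine Tr.seq (Tr.put (by simp only [Ex.ev]; omega) (Tr.seq (Tr.put (by simpa [Ex.ev, hb] using hpow) ?_)))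
  have e2 : (Ex.lit 1).ev σ1 = 1 := rfl
  rw [e1, e2]
  have e3 : (Ex.var xb).ev (σ1.seta aUs (2 ^ i) 1) = 2 ^ i := hb
  have e4 : (Ex.var xv).ev (σ1.seta aUs (2 ^ i) 1) = v := by
    rw [Ex.ev, St.seta_v, f1.1 _ (by decide), hv]
  rw [e3, e4]
  set σ2 := (σ1.seta aUs (2 ^ i) 1).seta aSl v (2 ^ i) with hσ2
  have f2 : Fr [xb, xc, xi] [aUs, aSl] σ σ2 :=
    ((f1.trans (Fr.refl [] [] _) (ys := [xb, xc, xi]) (bs := [aUs, aSl])).seta _ _).seta _ _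
  have hs2 : Slots (insert v X) m (Function.update sl v i) σ2 := by
    have hne : ∀ u ∈ X, u ≠ v := fun u hu e => hvX (e ▸ hu)
    refine ⟨?_, ?_, ?_, ?_⟩
    · intro a ha b hb hab
      rw [Finset.coe_insert] at ha hb
      rcases ha with rfl | ha <;> rcases hb with rfl | hb
      · rfl
      · rw [Function.update_self, Function.update_of_ne (hne b hb)] at hab
        exact absurd hab.symm (hfree b hb)
      · rw [Function.update_self, Function.update_of_ne (hne a ha)] at hab
        exact absurd hab (hfree a ha)
      · rw [Function.update_of_ne (hne a ha), Function.update_of_ne (hne b hb)] at hab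
        exact hs.inj ha hb hab
    · intro u hu
      rcases Finset.mem_insert.1 hu with rfl | hu
      · rw [Function.update_self]; exact hi
      · rw [Function.update_of_ne (hne u hu)]; exact hs.lt u hu
    · intro u
      by_cases huv : u = v
      · subst huv; simp [hσ2]
      · simp (decide := true) only [hσ2, St.seta_a, true_and, false_and, if_false, Finset.mem_insert,
          huv, false_or, Function.update_of_ne huv, Fin.val_inj]
        rw [f1.2 _ (by decide), hs.val u]
    · intro i' hi'
      simp (decide := true) only [hσ2, St.seta_a, true_and, false_and, if_false]
      rw [f1.2 _ (by decide)]
      split_ifs with h1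
      · have : i' = i := Nat.pow_right_injective (le_refl 2) h1
        rw [ind_true ⟨v, by simp, by simp [this]⟩]
      · rw [hs.us i' hi']
        refine ind_congr ⟨?_, ?_⟩
        · rintro ⟨u, hu, e⟩
          exact ⟨u, by simp [hu], by rw [Function.update_of_ne (hne u hu), e]⟩
        · rintro ⟨u, hu, e⟩
          rcases Finset.mem_insert.1 hu with rfl | hu
          · rw [Function.update_self] at e; rw [e] at h1; exact absurd rfl h1
          · rw [Function.update_of_ne (hne u hu)] at e; exact ⟨u, hu, e⟩
  have hR : σ2.a aR = σ.a aR := f2.2 _ (by decide)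
  have hp2 : Par n m K N σ2 := hp.fr f2
  refine introTab_spec hp2.tab (b := 2 ^ i) hb (by positivity) hp2.bd hD hW (by rw [hR, h.zero]) ?_
  intro τ f3 hτ
  refine hQ τ (hp2.fr f3) ⟨⟨Function.update sl v i, ?_, ?_⟩, ?_, ?_⟩ ?_ ?_
  · exact hs2.congr (f3.2 _ (by decide)) (f3.2 _ (by decide))
  · refine Good.intro (m := m) hg hXS hvS hE ?_ hs2.inj hs2.lt hX hN ?_
    · intro u hu
      rw [Function.update_of_ne]
      rintro rfl; exact hvX hu
    · intro t ht0 ht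
      rw [hτ t ht, ind_pos, Function.update_self, hR]
      exact ⟨fun h => h.2, fun h => ⟨ht0, h⟩⟩
  · rw [hτ 0 (by omega)]; exact ind_false (by simp)
  · intro t ht
    rw [hτ t ht]; exact ind_le _
  · rw [f3.1 _ (by decide), f3.2 _ (by decide), show σ2.v xb = 2 ^ i from hb]
    simp [hσ2]
  · rw [f3.1 _ (by decide), f2.1 _ (by decide), hv]

/-- Handles the edge between the vertex with place value `xb` and the neighbour number `xe`, if the
neighbour is in the bag. -/
def edgeCm : Cm :=
  .rd xu (.add (.add (.add (.var xn) (.add (.var xn) (.add (.var xn) (.add (.var xn) (.add (.var xn)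
    (.lit 2)))))) (.var xlo)) (.var xe)) ;;
  .set xb' (.get aSl (.var xu)) ;; .loop xi' (.ite (.lit 0) (.var xb') (.lit 1) (.lit 0)) edgeTab

/-- Whether `u` is in the bag is seen from `aSl`, whose value is `0` outside `X`. Outside the bag
nothing has to be done, as `E'` contains the new edge only if its end lies in `X`. -/
lemma edge_spec {n m K N : ℕ} {S X : Finset (Fin n)} {E E' : Fin n → Fin n → Prop} {σ : St}
    {v u : Fin n} {i : ℕ}
    {Q : St → Prop} (hp : Par n m K N σ) (h : Dp K N m S E X σ) (hb : σ.v xb = σ.a aSl v)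
    (hvX : v ∈ X) (hi : 5 * n + 2 + σ.v xlo + σ.v xe = i) (hiβ : i < β) (hIi : I i = u)
    (hu : u.1 ≤ W)
    (hE : ∀ a b, E' a b ↔ E a b ∨ (a = v ∧ b = u ∧ b ∈ X))
    (hmN : 2 ^ m ≤ N) (hD : N + 1 ≤ D) (hW : N + 1 ≤ W)
    (hQ : ∀ τ, Fr [xu, xb', xi', xt] [aH, aH', aCov, aR] σ τ → Dp K N m S E' X τ → Q τ) :
    Tr I β W D edgeCm σ Q := by
  obtain ⟨sl, hs, hg⟩ := h.good
  have ei : (Ex.add (.add (.add (.var xn) (.add (.var xn) (.add (.var xn) (.add (.var xn)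
      (.add (.var xn) (.lit 2)))))) (.var xlo)) (.var xe)).ev σ = i := by
    simp only [Ex.ev, hp.size]; omega
  refine Tr.seq (Tr.rd (by rw [ei]; exact hiβ) (by rw [ei, hIi]; exact hu) ?_)
  rw [ei, hIi]
  have eb : (Ex.get aSl (.var xu)).ev (σ.setv xu u) = σ.a aSl u := by simp [Ex.ev]
  have hpow : ∀ w ∈ X, 2 ^ sl w ≤ N := fun w hw =>
    (Nat.pow_le_pow_right (by omega) (hs.lt w hw).le).trans hmN
  refine Tr.seq (Tr.set ?_ ?_)
  · rw [eb, hs.val u]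
    split_ifs with hu
    · have := hpow u hu; omega
    · omega
  rw [eb]
  set σ1 := (σ.setv xu u).setv xb' (σ.a aSl u) with hσ1
  have f1 : Fr [xu, xb', xi', xt] [aH, aH', aCov, aR] σ σ1 := ((Fr.refl _ _ _).setv _).setv _
  refine Tr.when (p := u ∈ X) ?_ (by omega) ?_ ?_
  · simp only [Ex.ev, hσ1, St.setv_v, if_true]
    refine ite_eq_ind ?_
    rw [hs.val u]
    split_ifs with h <;> simp [h]
  · intro huX
    have f2 : Fr [xu, xb', xi', xt] [aH, aH', aCov, aR] σ (σ1.setv xi' 0) := f1.setv 0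
    have hp2 : Par n m K N (σ1.setv xi' 0) := hp.fr f2
    refine edgeTab_spec (b := 2 ^ sl v) (b' := 2 ^ sl u) hp2.tab ?_ (by positivity) ?_
      (by positivity) hD hW h.le ?_
    · rw [f2.1 _ (by decide), hb, hs.val v, if_pos hvX]
    · rw [St.setv_v, if_neg (by decide), hσ1, St.setv_v, if_pos rfl, hs.val u, if_pos huX]
    · intro τ f3 hR
      refine hQ τ (f2.trans f3) ⟨⟨sl, ?_, ?_⟩, ?_, ?_⟩
      · exact hs.congr (f3.2 _ (by decide)) (f3.2 _ (by decide))
      · refine Good.edge hg hs.inj huX hvX (fun a b => (hE a b).trans (or_congr_right ?_)) ?_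
        · constructor
          · rintro ⟨h1, h2, -⟩; exact ⟨h1, h2⟩
          · rintro ⟨h1, h2⟩; exact ⟨h1, h2, h2 ▸ huX⟩
        · intro t _ ht
          rw [hR t ht]
          split_ifs with hh
          · simp only [hh, and_true]; rfl
          · simp [hh]
      · rw [hR 0 (by omega), path_zero]; simp
      · intro t ht
        rw [hR t ht]
        split_ifs
        · exact h.le t ht
        · omega
  · intro huX
    refine hQ σ1 f1 ⟨⟨sl, hs.congr rfl rfl, ?_⟩, h.zero, h.le⟩
    have : E' = E := by
      funext a b
      refine propext ((hE a b).trans ?_)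
      constructor
      · rintro (h | ⟨_, rfl, h⟩)
        · exact h
        · exact absurd h huX
      · exact Or.inl
    rw [this]; exact hg

def forgetCm : Cm :=
  .set xb (.get aSl (.var xv)) ;; .put aSl (.var xv) (.lit 0) ;; .put aUs (.var xb) (.lit 0) ;; forgetTab

lemma forget_spec {n m K N : ℕ} {S X : Finset (Fin n)} {E : Fin n → Fin n → Prop} {σ : St} {v : Fin n}
    {Q : St → Prop} (hp : Par n m K N σ) (h : Dp K N m S E X σ) (hv : σ.v xv = v) (hXS : X ⊆ S)
    (hvX : v ∈ X) (hX : X.card ≤ m)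
    (hN : 2 ^ (91 * (m + K + 1) ^ 2) ≤ N) (hD : N + 1 ≤ D) (hW : N + 1 ≤ W)
    (hQ : ∀ τ, Par n m K N τ → Dp K N m S E (X.erase v) τ → Q τ) :
    Tr I β W D forgetCm σ Q := by
  obtain ⟨sl, hs, hg⟩ := h.good
  have hmN : 2 ^ m ≤ N := (Nat.pow_le_pow_right (by omega) (le_exponent m K)).trans hN
  have hpow : 2 ^ sl v ≤ W :=
    (Nat.pow_le_pow_right (by omega) (hs.lt v hvX).le).trans (by omega)
  have e1 : (Ex.get aSl (.var xv)).ev σ = 2 ^ sl v := by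
    rw [Ex.ev, Ex.ev, hv, hs.val, if_pos hvX]
  refine Tr.seq (Tr.set (by rw [e1]; exact hpow) ?_)
  rw [e1]
  have e2 : (Ex.var xv).ev (σ.setv xb (2 ^ sl v)) = v := by
    rw [Ex.ev, St.setv_v, if_neg (by decide), hv]
  refine Tr.seq (Tr.put (by simp [Ex.ev]) ?_)
  rw [e2, show (Ex.lit 0).ev (σ.setv xb (2 ^ sl v)) = 0 from rfl]
  refine Tr.seq (Tr.put (by simp [Ex.ev]) ?_)
  rw [show (Ex.var xb).ev ((σ.setv xb (2 ^ sl v)).seta aSl v 0) = 2 ^ sl v by simp [Ex.ev],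
    show (Ex.lit 0).ev ((σ.setv xb (2 ^ sl v)).seta aSl v 0) = 0 from rfl]
  set σ2 := ((σ.setv xb (2 ^ sl v)).seta aSl v 0).seta aUs (2 ^ sl v) 0 with hσ2
  have f2 : Fr [xb] [aUs, aSl] σ σ2 := (((Fr.refl _ _ _).setv _).seta _ _).seta _ _
  have hs2 : Slots (X.erase v) m sl σ2 := by
    refine ⟨hs.inj.mono (by simp), fun u hu => hs.lt u (Finset.mem_of_mem_erase hu), ?_, ?_⟩
    · intro u
      simp (decide := true) only [hσ2, St.seta_a, true_and, false_and, if_false, St.setv_a, Fin.val_inj]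
      by_cases huv : u = v
      · simp [huv]
      · rw [if_neg huv, hs.val u]; simp [huv]
    · intro i hi
      simp (decide := true) only [hσ2, St.seta_a, true_and, false_and, if_false, St.setv_a]
      split_ifs with h1
      · have : i = sl v := Nat.pow_right_injective (le_refl 2) h1
        refine (ind_false ?_).symm
        rintro ⟨u, hu, e⟩
        exact Finset.ne_of_mem_erase hu (hs.inj (Finset.mem_of_mem_erase hu) hvX (e.trans this))
      · rw [hs.us i hi]
        refine ind_congr ⟨?_, ?_⟩
        · rintro ⟨u, hu, e⟩
          refine ⟨u, Finset.mem_erase.2 ⟨?_, hu⟩, e⟩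
          rintro rfl
          exact h1 (by rw [e])
        · rintro ⟨u, hu, e⟩
          exact ⟨u, Finset.mem_of_mem_erase hu, e⟩
  have hR : σ2.a aR = σ.a aR := f2.2 _ (by decide)
  have hp2 : Par n m K N σ2 := hp.fr f2
  refine forgetTab_spec hp2.tab (b := 2 ^ sl v) (by simp [hσ2]) (by positivity) hp2.bd hD hW
    (by rw [hR, h.zero]) ?_
  intro τ f3 hτ
  refine hQ τ (hp2.fr f3) ⟨⟨sl, ?_, ?_⟩, ?_, ?_⟩
  · exact hs2.congr (f3.2 _ (by decide)) (f3.2 _ (by decide))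
  · refine Good.forget (m := m) hg hXS hs.inj hvX hs.lt hX hN ?_
    intro t ht0 ht
    rw [hτ t ht, ind_pos, hR]
    exact ⟨fun h => h.2, fun h => ⟨ht0, h⟩⟩
  · rw [hτ 0 (by omega)]; exact ind_false (by simp)
  · intro t ht
    rw [hτ t ht]; exact ind_le _

end Loop

/-! ### The subgraph seen before a node of the given decomposition -/

namespace PathDecomposition

variable {n : ℕ} {G : SimpleGraph (Fin n)} (P : PathDecomposition G)

/-- The vertices introduced before step `j`. -/
noncomputable def seen (j : ℕ) : Finset (Fin n) := Finset.univ.filter fun v => (P.inAt v : ℕ) < j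

/-- The edges between vertices introduced before step `j`. -/
def seenAdj (j : ℕ) (a b : Fin n) : Prop := G.Adj a b ∧ a ∈ P.seen j ∧ b ∈ P.seen j

lemma mem_seen {j : ℕ} {v : Fin n} : v ∈ P.seen j ↔ (P.inAt v : ℕ) < j := by simp [seen]

/-- The bag after `j` steps. -/
def bagAt (j : ℕ) : Finset (Fin n) := PathDec.bagAfter P.p P.isIntro j

lemma mem_bagAt {v : Fin n} {j : ℕ} : v ∈ P.bagAt j ↔ (P.inAt v : ℕ) < j ∧ j ≤ P.outAt v :=
  P.mem_bagAfter v j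

lemma bagAt_subset (j : ℕ) : P.bagAt j ⊆ P.seen j := fun _ hv =>
  P.mem_seen.2 (P.mem_bagAt.1 hv).1

lemma inAt_of_intro {j : Fin (2 * n)} (h : P.isIntro j = true) : P.inAt (P.p j) = j := by
  obtain ⟨_, _, _, _, h5, h6⟩ := P.inAt_spec (P.p j)
  rcases h6 j rfl with e | e
  · exact e.symm
  · rw [← e, h] at h5; exact absurd h5 (by simp)

lemma outAt_of_forget {j : Fin (2 * n)} (h : P.isIntro j = false) : P.outAt (P.p j) = j := by
  obtain ⟨_, _, h3, _, _, h6⟩ := P.inAt_spec (P.p j)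
  rcases h6 j rfl with e | e
  · rw [← e, h] at h3; exact absurd h3 (by simp)
  · exact e.symm

lemma bagAt_intro {j : Fin (2 * n)} (h : P.isIntro j = true) :
    P.bagAt (j + 1) = insert (P.p j) (P.bagAt j) := by
  simp [bagAt, PathDec.bagAfter, h]

lemma bagAt_forget {j : Fin (2 * n)} (h : P.isIntro j = false) :
    P.bagAt (j + 1) = (P.bagAt j).erase (P.p j) := by
  simp [bagAt, PathDec.bagAfter, h]

lemma seen_intro {j : Fin (2 * n)} (h : P.isIntro j = true) :
    P.seen (j + 1) = insert (P.p j) (P.seen j) := by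
  ext u
  rw [Finset.mem_insert, mem_seen, mem_seen]
  constructor
  · intro hu
    by_cases e : (P.inAt u : ℕ) = j
    · left
      rw [← (P.inAt_spec u).2.1, Fin.ext e]
    · right; omega
  · rintro (rfl | hu)
    · rw [P.inAt_of_intro h]; omega
    · omega

lemma seen_forget {j : Fin (2 * n)} (h : P.isIntro j = false) : P.seen (j + 1) = P.seen j := by
  ext u
  rw [mem_seen, mem_seen]
  constructor
  · intro hu
    by_cases e : (P.inAt u : ℕ) = j
    · have := (P.inAt_spec u).2.2.1
      rw [Fin.ext e, h] at this
      exact absurd this (by simp)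
    · omega
  · omega

lemma notMem_seen {j : Fin (2 * n)} (h : P.isIntro j = true) : P.p j ∉ P.seen j := by
  rw [mem_seen, P.inAt_of_intro h]; omega

lemma mem_bagAt_forget {j : Fin (2 * n)} (h : P.isIntro j = false) : P.p j ∈ P.bagAt j := by
  have h1 := (P.inAt_spec (P.p j)).1
  have h2 : (P.inAt (P.p j) : ℕ) < P.outAt (P.p j) := h1
  rw [P.outAt_of_forget h] at h2
  rw [mem_bagAt, P.outAt_of_forget h]
  exact ⟨h2, le_rfl⟩

/-- Some bag contains both ends of the edge. It comes after the introduction of `P.p j`, so `u`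
cannot have been forgotten before. -/
lemma adj_mem_bagAt {j : Fin (2 * n)} (h : P.isIntro j = true) {u : Fin n} (hu : u ∈ P.seen j)
    (ha : G.Adj (P.p j) u) : u ∈ P.bagAt j := by
  obtain ⟨i, h1, h2⟩ := P.edge_covered _ _ ha
  rw [P.mem_bagAfter, P.inAt_of_intro h] at h1
  rw [P.mem_bagAfter] at h2
  rw [mem_bagAt]
  exact ⟨P.mem_seen.1 hu, by omega⟩

/-- The algorithm inserts each edge in one direction only and only towards neighbours in the current
bag. By `adj_mem_bagAt` these are all earlier neighbours, and the covering condition is symmetric,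
so the requirement is the one for `P.seenAdj (j + 1)`. -/
lemma bagSeq_intro {j : Fin (2 * n)} (h : P.isIntro j = true) {S : Finset (Fin n)} {K : ℕ}
    {l : List (Finset (Fin n))} : BagSeq S (fun a b => P.seenAdj j a b ∨
      (a = P.p j ∧ G.Adj (P.p j) b ∧ b ∈ P.bagAt (j + 1))) K l ↔ BagSeq S (P.seenAdj (j + 1)) K l := by
  have hs := P.seen_intro h
  have hi := P.bagAt_intro h
  constructor
  · intro hl
    refine ⟨hl.sub, hl.card, hl.runs, ?_, hl.last⟩
    rintro a b ⟨hab, ha, hb⟩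
    rw [hs, Finset.mem_insert] at ha hb
    rcases ha with rfl | ha <;> rcases hb with rfl | hb
    · exact absurd hab (G.loopless.irrefl _)
    · have hm : b ∈ P.bagAt (j + 1) := by
        rw [hi]; exact Finset.mem_insert_of_mem (P.adj_mem_bagAt h hb hab)
      exact hl.edge _ _ (Or.inr ⟨rfl, hab, hm⟩)
    · obtain ⟨B, hB, h1, h2⟩ := hl.edge _ _ (Or.inr ⟨rfl, hab.symm, by
        rw [hi]; exact Finset.mem_insert_of_mem (P.adj_mem_bagAt h ha hab.symm)⟩)
      exact ⟨B, hB, h2, h1⟩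
    · exact hl.edge a b (Or.inl ⟨hab, ha, hb⟩)
  · intro hl
    refine ⟨hl.sub, hl.card, hl.runs, ?_, hl.last⟩
    rintro a b (⟨hab, ha, hb⟩ | ⟨rfl, hab, hb⟩)
    · exact hl.edge a b ⟨hab, by rw [hs]; exact Finset.mem_insert_of_mem ha,
        by rw [hs]; exact Finset.mem_insert_of_mem hb⟩
    · exact hl.edge _ b ⟨hab, by rw [hs]; exact Finset.mem_insert_self _ _, P.bagAt_subset _ hb⟩

lemma bagSeq_forget {j : Fin (2 * n)} (h : P.isIntro j = false) : P.seenAdj (j + 1) = P.seenAdj j := by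
  funext a b; simp only [seenAdj, P.seen_forget h]

lemma seen_last : P.seen (2 * n) = Finset.univ := by ext u; simp [mem_seen]

lemma seenAdj_last : P.seenAdj (2 * n) = G.Adj := by
  funext a b; simp [seenAdj, P.seen_last]

lemma seen_zero : P.seen 0 = ∅ := by ext u; simp [mem_seen]

lemma seenAdj_zero : P.seenAdj 0 = fun _ _ => False := by
  funext a b; simp [seenAdj, P.seen_zero]

lemma bagAt_zero : P.bagAt 0 = ∅ := rfl

end PathDecomposition

/-! ### Processing one node of the given decomposition -/

namespace Loop
open Tree

variable {I : ℕ → ℕ} {β W D D' : ℕ}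

def times4 (e f : Ex) : Ex := .add e (.add e (.add e (.add e f)))

def introNode : Cm :=
  introCm ;; .rd xlo (.add (times4 (.var xn) (.lit 1)) (.var xv)) ;;
  .rd xhi (.add (times4 (.var xn) (.lit 2)) (.var xv)) ;;
  .loop xe (.sub (.var xhi) (.var xlo)) edgeCm

/-- The kind of the node, `1` or `0`, is used directly as the number of passes of the first loop,
and its complement as that of the second. -/
def nodeCm : Cm :=
  .rd xv (.add (.lit 1) (.add (.var xj) (.var xj))) ;;
  .rd xq (.add (.lit 2) (.add (.var xj) (.var xj))) ;;
  .loop xi (.var xq) introNode ;; .loop xi (.sub (.lit 1) (.var xq)) forgetCm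

/-- The numerical constants of later time bounds are values of `L`: bounds for twice the length of
fixed pieces of code, verified by evaluation. -/
lemma Tr.unit {c : Cm} {σ : St} {Q : St → Prop} {N L : ℕ} (h : Tr I β W (N + 1) c σ Q) (hD : N + 1 ≤ D)
    (hd : c.depth ≤ 2 := by decide) (hL : 2 * c.len ≤ L := by decide) :
    Tm I β W D c σ (L * (N + 2) ^ 2) Q := by
  refine (h.timed hD).mono ?_ fun _ h => h
  exact Nat.mul_le_mul hL (Nat.pow_le_pow_right (by omega) hd)

variable {n : ℕ} {G : SimpleGraph (Fin n)} {A : AdjacencyLists G} {P : PathDecomposition G}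

lemma introNode_spec {m K N : ℕ} {S X : Finset (Fin n)} {E : Fin n → Fin n → Prop} {σ : St} {v : Fin n}
    {Q : St → Prop} (hI : Inp A P I β W)
    (hp : Par n m K N σ) (h : Dp K N m S E X σ) (hv : σ.v xv = v) (hXS : X ⊆ S)
    (hvS : v ∉ S) (hE : ∀ a b, E a b → a ∈ S ∧ b ∈ S) (hX : (insert v X).card ≤ m)
    (hN : 2 ^ (91 * (m + K + 1) ^ 2) ≤ N) (hD : N + 1 ≤ D) (hDn : n ≤ D) (hW : N + 1 ≤ W)
    (hnW : n ≤ W)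
    (hQ : ∀ τ, Par n m K N τ → Dp K N m (insert v S)
      (fun a b => E a b ∨ (a = v ∧ G.Adj v b ∧ b ∈ insert v X)) (insert v X) τ → Q τ) :
    Tm I β W D introNode σ (1500 * (N + 2) ^ 2 + 50 + (A.nbrs v).length * (1000 * (N + 2) ^ 2 + 8)) Q := by
  have hmN : 2 ^ m ≤ N := (Nat.pow_le_pow_right (by omega) (le_exponent m K)).trans hN
  have hle := hI.le v
  have hdeg := hI.deg v
  have hvn := v.2
  refine (Tm.seq (T := 1500 * (N + 2) ^ 2) (T' := 50 + (A.nbrs v).length * (1000 * (N + 2) ^ 2 + 8))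
    ((intro_spec hp h hv hXS hvS hE hX hN le_rfl hW ?_).unit hD)).mono (by omega) fun _ h => h
  intro σ1 hp1 h1 hb1 hv1
  have e1 : (Ex.add (times4 (.var xn) (.lit 1)) (.var xv)).ev σ1 = 4 * n + 1 + v := by
    simp only [times4, Ex.ev, hp1.size, hv1]; omega
  have hβ := hI.len
  refine (Tm.seq (T' := 38 + (A.nbrs v).length * (1000 * (N + 2) ^ 2 + 8))
    (Tm.rd (by rw [e1]; omega) (by rw [e1]; exact hI.val _ (by omega)) ?_)).mono ?_ fun _ h => h
  swap
  · simp only [times4, Ex.len]; omega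
  rw [e1]
  have e2 : (Ex.add (times4 (.var xn) (.lit 2)) (.var xv)).ev (σ1.setv xlo (I (4 * n + 1 + v))) =
      4 * n + 2 + v := by
    simp (decide := true) only [times4, Ex.ev, St.setv_v, if_false, hp1.size, hv1]; omega
  refine (Tm.seq (T' := 26 + (A.nbrs v).length * (1000 * (N + 2) ^ 2 + 8))
    (Tm.rd (by rw [e2]; omega) (by rw [e2]; exact hI.val _ (by omega)) ?_)).mono ?_ fun _ h => h
  swap
  · simp only [times4, Ex.len]; omega
  rw [e2]
  set σ2 := (σ1.setv xlo (I (4 * n + 1 + v))).setv xhi (I (4 * n + 2 + v)) with hσ2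
  have f2 : Fr [xlo, xhi] [] σ1 σ2 := ((Fr.refl _ _ _).setv _).setv _
  have e3 : (Ex.sub (.var xhi) (.var xlo)).ev σ2 = (A.nbrs v).length := by
    simp (decide := true) only [Ex.ev, hσ2, St.setv_v, if_true, if_false]; omega
  have elo : σ2.v xlo = I (4 * n + 1 + v) := by
    simp (decide := true) only [hσ2, St.setv_v, if_true, if_false]
  have hlen : (A.nbrs v).length ≤ n := by
    simpa using (A.nodup v).length_le_card
  -- After `e` passes exactly the first `e` neighbours of `v` have been taken into account; the full
  -- adjacency list yields `G.Adj v`.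
  refine (Tm.loop (fun _ => 1000 * (N + 2) ^ 2) (fun e τ =>
    Fr [xe, xu, xb', xi', xt] [aH, aH', aCov, aR] σ2 τ ∧
    Dp K N m (insert v S) (fun a b => E a b ∨ (a = v ∧ b ∈ (A.nbrs v).take e ∧ b ∈ insert v X))
      (insert v X) τ) ?_ (by rw [e3]; omega) ?_ ?_).mono ?_ fun _ h => h
  · refine ⟨Fr.refl _ _ _, ?_⟩
    obtain ⟨⟨sl, hs, hg⟩, hz, hl⟩ := h1
    refine ⟨⟨sl, hs.congr rfl rfl, ?_⟩, hz, hl⟩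
    have e0 : (fun a b => E a b ∨ (a = v ∧ b ∈ (A.nbrs v).take 0 ∧ b ∈ insert v X)) = E := by
      funext a b; simp
    rw [e0]; exact hg
  · rw [e3]
    intro e he τ ⟨hf, hd⟩
    have hf' : Fr [xe, xu, xb', xi', xt] [aH, aH', aCov, aR] σ2 (τ.setv xe e) := hf.setv e
    have hp2 : Par n m K N (τ.setv xe e) := (hp1.fr f2).fr hf'
    have hi := hI.nbr v e he
    have hu := (A.nbrs v)[e].2
    have hd' : Dp K N m (insert v S) (fun a b => E a b ∨ (a = v ∧ b ∈ (A.nbrs v).take e ∧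
        b ∈ insert v X)) (insert v X) (τ.setv xe e) := by
      obtain ⟨⟨sl, hs, hg⟩, hz, hl⟩ := hd
      exact ⟨⟨sl, hs.congr rfl rfl, hg⟩, hz, hl⟩
    refine (edge_spec (v := v) (u := (A.nbrs v)[e]) hp2 hd' ?_ (Finset.mem_insert_self _ _)
      (i := 5 * n + 2 + I (4 * n + 1 + v) + e) ?_ (by omega) hi (by omega) (E' := fun a b => E a b ∨
        (a = v ∧ b ∈ (A.nbrs v).take (e + 1) ∧ b ∈ insert v X)) (hE := ?_) hmN le_rfl hW ?_).unit hD
    · rw [hf'.1 _ (by decide), f2.1 _ (by decide), hb1, hf'.2 _ (by decide), f2.2 _ (by decide)]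
    · rw [hf'.1 xlo (by decide), elo]; simp
    · intro a b
      rw [List.take_add_one, List.getElem?_eq_getElem he]
      simp only [List.mem_append, Option.toList_some, List.mem_singleton]
      tauto
    · intro υ f3 h3
      exact ⟨hf'.trans f3, h3⟩
  · rw [e3]
    intro τ ⟨hf, hd⟩
    refine hQ τ ((hp1.fr f2).fr hf) ?_
    have e0 : (fun a b => E a b ∨ (a = v ∧ b ∈ (A.nbrs v).take (A.nbrs v).length ∧ b ∈ insert v X)) =
        fun a b => E a b ∨ (a = v ∧ G.Adj v b ∧ b ∈ insert v X) := by
      funext a b; simp [A.mem_iff]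
    rwa [e0] at hd
  · rw [e3]
    simp only [Ex.len, Finset.sum_const, Finset.card_range, smul_eq_mul]
    omega

/-- A bound for the time that a step of the decomposition takes, apart from the edges. -/
def unitTime (N : ℕ) : ℕ := 3000 * (N + 2) ^ 2 + 100

lemma node_spec {m K N : ℕ} {σ : St} (j : Fin (2 * n))
    {Q : St → Prop} (hI : Inp A P I β W) (hm : ∀ j, (P.bagAt j).card ≤ m)
    (hp : Par n m K N σ) (h : Dp K N m (P.seen j) (P.seenAdj j) (P.bagAt j) σ) (hj : σ.v xj = j)
    (hN : 2 ^ (91 * (m + K + 1) ^ 2) ≤ N) (hD : N + 1 ≤ D) (hDn : n ≤ D) (hW : N + 1 ≤ W)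
    (hnW : n ≤ W)
    (hQ : ∀ τ, Par n m K N τ → Dp K N m (P.seen (j + 1)) (P.seenAdj (j + 1)) (P.bagAt (j + 1)) τ → Q τ) :
    Tm I β W D nodeCm σ (unitTime N +
      if P.isIntro j = true then (A.nbrs (P.p j)).length * unitTime N else 0) Q := by
  have hj2 := j.2
  have hβ := hI.len
  have hpj := (P.p j).2
  have e1 : (Ex.add (.lit 1) (.add (.var xj) (.var xj))).ev σ = 1 + (j + j) := by simp [Ex.ev, hj]
  set X := unitTime N + if P.isIntro j = true then (A.nbrs (P.p j)).length * unitTime N else 0 with hX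
  have hXu : 3000 * (N + 2) ^ 2 + 100 ≤ X := by rw [hX]; unfold unitTime; omega
  refine (Tm.seq (T' := X - 6) (Tm.rd (by rw [e1]; omega) (by rw [e1]; exact hI.val _ (by omega)) ?_)).mono
    (by simp only [Ex.len]; omega) fun _ h => h
  rw [e1, hI.vert]
  have e2 : (Ex.add (.lit 2) (.add (.var xj) (.var xj))).ev (σ.setv xv (P.p j)) = 2 + (j + j) := by
    simp (decide := true) [Ex.ev, hj]
  refine (Tm.seq (T' := X - 12) (Tm.rd (by rw [e2]; omega) (by rw [e2]; exact hI.val _ (by omega)) ?_)).mono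
    (by simp only [Ex.len]; omega) fun _ h => h
  rw [e2, hI.kind]
  set σ1 := (σ.setv xv (P.p j)).setv xq (if P.isIntro j = true then 1 else 0) with hσ1
  have f1 : Fr [xv, xq] [] σ σ1 := ((Fr.refl _ _ _).setv _).setv _
  have ev : σ1.v xv = P.p j := by simp (decide := true) [hσ1]
  have eq : σ1.v xq = if P.isIntro j = true then 1 else 0 := by simp (decide := true) [hσ1]
  have hd1 : Dp K N m (P.seen j) (P.seenAdj j) (P.bagAt j) σ1 := by
    obtain ⟨⟨sl, hs, hg⟩, hz, hl⟩ := h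
    exact ⟨⟨sl, hs.congr rfl rfl, hg⟩, hz, hl⟩
  have hp1 : Par n m K N σ1 := hp.fr f1
  have fx : ∀ τ : St, Fr [xi] [] τ (τ.setv xi 0) := fun τ => (Fr.refl _ _ _).setv _
  have hdx : ∀ {S E X} {τ : St}, Dp (n := n) K N m S E X τ → Dp K N m S E X (τ.setv xi 0) := by
    rintro S E X τ ⟨⟨sl, hs, hg⟩, hz, hl⟩
    exact ⟨⟨sl, hs.congr rfl rfl, hg⟩, hz, hl⟩
  by_cases hb : P.isIntro j = true
  · rw [if_pos hb] at eq hX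
    have eP := P.bagAt_intro hb
    refine (Tm.seq (T' := 30) (Tm.when (p := True) (T := 1500 * (N + 2) ^ 2 + 50 +
      (A.nbrs (P.p j)).length * (1000 * (N + 2) ^ 2 + 8)) (T' := X - 42)
      (by rw [Ex.ev, eq, ind_true trivial]) (by omega) (fun _ => ?_) (fun h => absurd trivial h) ?_)).mono
      (by omega) fun _ h => h
    · have hm1 := hm (j + 1)
      rw [eP] at hm1
      have hev : (σ1.setv xi 0).v xq = 1 := by rw [(fx σ1).1 _ (by decide), eq]
      refine (introNode_spec (v := P.p j) hI (hp1.fr (fx _)) (hdx hd1) ?_ (P.bagAt_subset j)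
        (P.notMem_seen hb) (fun a b h => h.2) hm1 hN hD hDn hW hnW (Q := fun τ => Par n m K N τ ∧
          Dp K N m (P.seen (j + 1)) (P.seenAdj (j + 1)) (P.bagAt (j + 1)) τ) ?_).and_frame
        (xs := introNode.wv) (as := introNode.wa) (List.Subset.refl _) (List.Subset.refl _) |>.mono
        le_rfl ?_
      · rw [(fx σ1).1 _ (by decide), ev]
      · rintro τ hp2 ⟨⟨sl, hs, hg⟩, hz, hl⟩
        refine ⟨hp2, ⟨sl, ?_, ?_⟩, hz, hl⟩
        · rw [eP]; exact hs
        · rw [P.seen_intro hb, eP]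
          refine hg.congr (fun _ _ => Iff.rfl) fun l => ?_
          have := P.bagSeq_intro hb (S := insert (P.p j) (P.seen j)) (K := K) (l := l)
          rw [eP] at this
          exact this
      · rintro τ ⟨⟨hp2, hd2⟩, hf⟩
        refine Tm.when (p := False) (T := 0) ?_ (by omega) (fun h => h.elim) (fun _ => hQ τ hp2 hd2) ?_
        · rw [ind_false (by simp), Ex.ev, Ex.ev, Ex.ev, hf.1 xq (by decide), hev]
        · simp only [Ex.len]; split_ifs <;> omega
    · rw [if_pos (ind_true trivial), Ex.len, hX]
      unfold unitTime
      have : (A.nbrs (P.p j)).length * (1000 * (N + 2) ^ 2 + 8) ≤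
        (A.nbrs (P.p j)).length * (3000 * (N + 2) ^ 2 + 100) := Nat.mul_le_mul_left _ (by omega)
      have h4 : 1 ≤ (N + 2) ^ 2 := Nat.one_le_pow _ _ (by omega)
      omega
  · have hb' : P.isIntro j = false := by simpa using hb
    rw [if_neg hb] at eq hX
    refine (Tm.seq (T := 20) (T' := X - 32) (Tm.when (p := False) (T := 0) ?_ (by omega) (fun h => h.elim)
      (fun _ => ?_) ?_)).mono (by omega) fun _ h => h
    · rw [ind_false (by simp), Ex.ev, eq]
    · refine Tm.when (p := True) (T := 1500 * (N + 2) ^ 2) ?_ (by omega) (fun _ => ?_)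
        (fun h => absurd trivial h) ?_
      · rw [ind_true trivial, Ex.ev, Ex.ev, Ex.ev, eq]
      · refine (forget_spec (v := P.p j) (hp1.fr (fx _)) (hdx hd1) ?_ (P.bagAt_subset j)
          (P.mem_bagAt_forget hb') (hm j) hN le_rfl hW ?_).unit hD
        · rw [(fx σ1).1 _ (by decide), ev]
        · intro τ hp2 hd2
          rw [P.seen_forget hb', P.bagAt_forget hb', P.bagSeq_forget hb'] at hQ
          exact hQ τ hp2 hd2
      · rw [if_pos (ind_true trivial)]
        simp only [Ex.len]
        omega
    · simp only [Ex.len]; split_ifs <;> omega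

end Loop

/-! ### The number of edges -/

namespace PathDecomposition

variable {n : ℕ} {G : SimpleGraph (Fin n)} (P : PathDecomposition G)

lemma card_back_le {m : ℕ} (hm : ∀ j, (P.bagAt j).card ≤ m) (v : Fin n) (s : Finset (Fin n))
    (hs : ∀ u ∈ s, G.Adj v u ∧ P.inAt u < P.inAt v) : s.card ≤ m := by
  refine (Finset.card_le_card fun u hu => ?_).trans (hm (P.inAt v))
  obtain ⟨h1, h2⟩ := hs u hu
  have hi := P.inAt_spec v
  have e : P.p (P.inAt v) = v := hi.2.1
  refine P.adj_mem_bagAt (j := P.inAt v) hi.2.2.1 (P.mem_seen.2 h2) ?_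
  rw [e]; exact h1

/-- Each edge is counted at its later introduced end. There its earlier end is still in the bag
(`card_back_le`), so a vertex has at most `m` earlier neighbours. -/
lemma sum_deg_le {m : ℕ} (hm : ∀ j, (P.bagAt j).card ≤ m) (A : AdjacencyLists G) :
    ∑ v, (A.nbrs v).length ≤ 2 * (n * m) := by
  classical
  set r : Fin n → Fin n → Prop := fun v u => G.Adj v u ∧ P.inAt u < P.inAt v with hr
  have h1 : ∀ v, (A.nbrs v).length ≤ (Finset.univ.filter fun u => r v u).card +
      (Finset.univ.filter fun u => r u v).card := by
    intro v
    rw [← List.toFinset_card_of_nodup (A.nodup v)]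
    refine (Finset.card_le_card ?_).trans (Finset.card_union_le _ _)
    intro u hu
    rw [List.mem_toFinset, A.mem_iff] at hu
    simp only [Finset.mem_union, Finset.mem_filter, Finset.mem_univ, true_and, hr]
    rcases lt_trichotomy (P.inAt u) (P.inAt v) with h | h | h
    · exact Or.inl ⟨hu, h⟩
    · have := (P.inAt_spec u).2.1
      rw [h, (P.inAt_spec v).2.1] at this
      exact absurd hu (by rw [this]; exact G.loopless.irrefl _)
    · exact Or.inr ⟨hu.symm, h⟩
  have h2 : ∑ v, (Finset.univ.filter fun u => r u v).card =
      ∑ u, (Finset.univ.filter fun v => r u v).card :=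
    (Finset.sum_card_bipartiteAbove_eq_sum_card_bipartiteBelow (s := Finset.univ) (t := Finset.univ) r).symm
  have h3 : ∑ v, (Finset.univ.filter fun u => r v u).card ≤ n * m := by
    refine (Finset.sum_le_card_nsmul _ _ m fun v _ => ?_).trans (by simp)
    exact P.card_back_le hm v _ fun u hu => by simpa using hu
  calc ∑ v, (A.nbrs v).length ≤ _ := Finset.sum_le_sum fun v _ => h1 v
    _ ≤ 2 * (n * m) := by rw [Finset.sum_add_distrib, h2]; omega

/-- Different introduce nodes belong to different vertices. -/
lemma sum_intro_le {f : Fin n → ℕ} : ∑ j : Fin (2 * n), (if P.isIntro j = true then f (P.p j) else 0) ≤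
    ∑ v, f v := by
  rw [← Finset.sum_filter]
  rw [← Finset.sum_image (g := P.p) (f := f)]
  · exact Finset.sum_le_sum_of_subset (Finset.subset_univ _)
  · intro i hi j hj hij
    have hi' := P.inAt_of_intro (Finset.mem_filter.1 hi).2
    have hj' := P.inAt_of_intro (Finset.mem_filter.1 hj).2
    rw [← hi', ← hj', hij]

end PathDecomposition

namespace Loop
open Tree

variable {I : ℕ → ℕ} {β W D D' : ℕ}
variable {n : ℕ} {G : SimpleGraph (Fin n)} {A : AdjacencyLists G} {P : PathDecomposition G}

/-! ### One value of the width -/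

def mmE : Ex := .add (.add (.var xmx) (.var xK)) (.lit 1)

/-- Computes the size of the tables. -/
def sizeCm : Cm :=
  .set xN (.lit 1) ;;
  .loop xi mmE (.loop xi' mmE (.loop xe (.lit 91) (.set xN (.add (.var xN) (.var xN)))))

/-- The quadratic exponent is realized by nested loops around a doubling: `M * M * 91` doublings
with `M = m + K + 1`. -/
lemma size_spec {m K : ℕ} {σ : St} {Q : St → Prop} (hm : σ.v xmx = m) (hK : σ.v xK = K)
    (hW : 2 ^ (91 * (m + K + 1) ^ 2) ≤ W)
    (hQ : ∀ τ, Fr [xN, xi, xi', xe] [] σ τ → τ.v xN = 2 ^ (91 * (m + K + 1) ^ 2) → Q τ) :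
    Tr I β W (m + K + 92) sizeCm σ Q := by
  set M := m + K + 1 with hM
  have hmm : ∀ τ, Fr [xN, xi, xi', xe] [] σ τ → mmE.ev τ = M := fun τ hf => by
    simp only [mmE, Ex.ev]; rw [hf.1 _ (by decide), hf.1 xK (by decide), hm, hK]
  refine Tr.seq (Tr.set (by simp only [Ex.ev]; exact Nat.one_le_two_pow.trans hW) ?_)
  have f0 : Fr [xN, xi, xi', xe] [] σ (σ.setv xN ((Ex.lit 1).ev σ)) := (Fr.refl _ _ _).setv _
  refine Tr.loop (fun i τ => Fr [xN, xi, xi', xe] [] σ τ ∧ τ.v xN = 2 ^ (91 * (M * i)))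
    ⟨f0, by simp [Ex.ev]⟩ (by rw [hmm _ f0]; omega) ?_ ?_
  · rw [hmm _ f0]
    intro i hi τ ⟨h1, h2⟩
    refine Tr.loop (fun j τ => Fr [xN, xi, xi', xe] [] σ τ ∧ τ.v xN = 2 ^ (91 * (M * i + j)))
      ⟨h1.setv i, by simpa (decide := true) using h2⟩ (by rw [hmm _ (h1.setv i)]; omega) ?_ ?_
    · rw [hmm _ (h1.setv i)]
      intro j hj τ ⟨h1, h2⟩
      refine Tr.loop (fun l τ => Fr [xN, xi, xi', xe] [] σ τ ∧ τ.v xN = 2 ^ (91 * (M * i + j) + l))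
        ⟨h1.setv j, by simpa (decide := true) using h2⟩ (by simp only [Ex.ev]; omega) ?_ ?_
      · intro l hl τ ⟨h1, h2⟩
        simp only [Ex.ev] at hl
        have e : (Ex.add (.var xN) (.var xN)).ev (τ.setv xe l) = 2 ^ (91 * (M * i + j) + (l + 1)) := by
          simp (decide := true) only [Ex.ev, St.setv_v, if_false, h2]
          rw [← add_assoc, pow_succ]; omega
        refine Tr.set ?_ ⟨(h1.setv _).setv _, ?_⟩
        · rw [e]
          refine (Nat.pow_le_pow_right (by omega) ?_).trans hW
          have : M * i + j + 1 ≤ M ^ 2 := by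
            have := Nat.mul_le_mul_left M (Nat.succ_le_of_lt hi)
            rw [Nat.mul_succ] at this
            rw [sq]; omega
          omega
        · rw [e]; simp
      · intro τ ⟨h1, h2⟩
        refine ⟨h1, ?_⟩
        rw [h2]; simp only [Ex.ev]; congr 1
    · rw [hmm _ (h1.setv i)]
      intro τ ⟨h1, h2⟩
      exact ⟨h1, by rw [h2]; congr 1⟩
  · rw [hmm _ f0]
    intro τ ⟨h1, h2⟩
    exact hQ τ h1 (by rw [h2, sq])

/-- Releases all slots. -/
def clearCm : Cm :=
  .set xc (.lit 1) ;; .loop xi (.var xmx) (.put aUs (.var xc) (.lit 0) ;; .set xc (.add (.var xc) (.var xc)))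

lemma clear_spec {m : ℕ} {σ : St} {Q : St → Prop} (hm : σ.v xmx = m) (hW : 2 ^ m ≤ W) (hD : m ≤ D)
    (hQ : ∀ τ, Fr [xc, xi] [aUs] σ τ → (∀ i < m, τ.a aUs (2 ^ i) = 0) → Q τ) :
    Tr I β W D clearCm σ Q := by
  refine Tr.seq (Tr.set (by simp only [Ex.ev]; exact Nat.one_le_two_pow.trans hW) ?_)
  have f0 : Fr [xc, xi] [aUs] σ (σ.setv xc ((Ex.lit 1).ev σ)) := (Fr.refl _ _ _).setv _
  have hm' : (Ex.var xmx).ev (σ.setv xc ((Ex.lit 1).ev σ)) = m :=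
    (f0.1 xmx (by decide)).trans hm
  refine Tr.loop (fun i τ => Fr [xc, xi] [aUs] σ τ ∧ τ.v xc = 2 ^ i ∧ ∀ i' < i, τ.a aUs (2 ^ i') = 0)
    ⟨f0, by simp [Ex.ev], fun _ h => absurd h (by omega)⟩ (by rw [hm']; exact hD) ?_ ?_
  · rw [hm']
    intro i hi τ ⟨h1, h2, h3⟩
    have hp : 2 ^ (i + 1) = 2 ^ i + 2 ^ i := by rw [pow_succ]; omega
    have hle : 2 ^ (i + 1) ≤ W := (Nat.pow_le_pow_right (by omega) (by omega)).trans hW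
    refine Tr.seq (Tr.put (by simp [Ex.ev]) (Tr.set ?_ ⟨((h1.setv _).seta _ _).setv _, ?_, ?_⟩))
    · simp (decide := true) only [Ex.ev, St.seta_v, St.setv_v, if_false, h2]; omega
    · simp (decide := true) only [Ex.ev, St.seta_v, St.setv_v, if_false, if_true, h2]; omega
    · intro i' hi'
      simp (decide := true) only [Ex.ev, St.seta_a, St.setv_a, St.setv_v, if_false, true_and, h2]
      split_ifs with h
      · rfl
      · refine h3 i' ?_
        by_contra hn
        exact h (by rw [show i' = i by omega])
  · rw [hm']
    intro τ ⟨h1, _, h3⟩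
    exact hQ τ h1 h3

/-- Forgets all registered vertices. -/
def clearSlCm : Cm := .loop xv (.var xn) (.put aSl (.var xv) (.lit 0))

lemma clearSl_spec {σ : St} {Q : St → Prop} (hn : σ.v xn = n) (hD : n ≤ D)
    (hQ : ∀ τ, Fr [xv] [aSl] σ τ → (∀ i < n, τ.a aSl i = 0) → Q τ) :
    Tm I β W D clearSlCm σ (20 * n + 20) Q := by
  refine (Tm.loop (fun _ => 11) (fun i τ => Fr [xv] [aSl] σ τ ∧ ∀ i' < i, τ.a aSl i' = 0)
    ⟨Fr.refl _ _ _, fun _ h => absurd h (by omega)⟩ (by simp only [Ex.ev]; omega) ?_ ?_).mono ?_ fun _ h => h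
  · intro i hi τ ⟨h1, h3⟩
    refine (Tm.put (by simp [Ex.ev]) ⟨(h1.setv _).seta _ _, ?_⟩).mono (by simp [Ex.len]) fun _ h => h
    intro i' hi'
    simp (decide := true) only [Ex.ev, St.seta_a, St.setv_a, St.setv_v, if_true, true_and]
    split_ifs with h
    · rfl
    · exact h3 i' (by omega)
  · rw [Ex.ev, hn]
    intro τ ⟨h1, h3⟩
    exact hQ τ h1 h3
  · rw [Ex.ev, hn]
    simp only [Ex.len, Finset.sum_const, Finset.card_range, smul_eq_mul]; omega

def initCm : Cm := fill xt szE aR (eqE tE (.lit 1) (.lit 1) (.lit 0))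

def foundCm : Cm :=
  .loop xt szE (.set xfound (.ite (.lit 0) (.get aR tE) (.lit 1) (.var xfound)))

lemma found_spec {N : ℕ} {σ : St} {Q : St → Prop} (hN : σ.v xN = N) (hf : σ.v xfound = 0)
    (hD : N + 1 ≤ D) (hW : 1 ≤ W)
    (hQ : ∀ τ, Fr [xt, xfound] [] σ τ → τ.v xfound = ind (∃ t ≤ N, 0 < σ.a aR t) → Q τ) :
    Tr I β W D foundCm σ Q := by
  have hz : szE.ev σ = N + 1 := by simp [szE, Ex.ev, hN]
  refine Tr.loop (fun i τ => Fr [xt, xfound] [] σ τ ∧ τ.v xfound = ind (∃ t < i, 0 < σ.a aR t))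
    ⟨Fr.refl _ _ _, by rw [hf, ind_false (by simp)]⟩ (by rw [hz]; exact hD) ?_ ?_
  · rw [hz]
    intro i hi τ ⟨h1, h2⟩
    have e : (Ex.ite (.lit 0) (.get aR tE) (.lit 1) (.var xfound)).ev (τ.setv xt i) =
        ind (∃ t < i + 1, 0 < σ.a aR t) := by
      simp (decide := true) only [Ex.ev, tE, St.setv_v, if_true, if_false, St.setv_a, h2,
        h1.2 aR (by decide)]
      split_ifs with h
      · rw [ind_true ⟨i, by omega, h⟩]
      · refine ind_congr ⟨fun ⟨t, ht, h3⟩ => ⟨t, by omega, h3⟩, fun ⟨t, ht, h3⟩ => ⟨t, ?_, h3⟩⟩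
        by_contra hn
        rw [show t = i by omega] at h3
        exact h h3
    refine Tr.set (by rw [e]; exact (ind_le _).trans hW) ?_
    rw [e]
    exact ⟨(h1.setv _).setv _, by simp⟩
  · rw [hz]
    intro τ ⟨h1, h2⟩
    refine hQ τ h1 ?_
    rw [h2]
    exact ind_congr ⟨fun ⟨t, ht, h3⟩ => ⟨t, by omega, h3⟩, fun ⟨t, ht, h3⟩ => ⟨t, by omega, h3⟩⟩

def stageCm : Cm :=
  .set xK (.add (.var xk) (.lit 1)) ;; sizeCm ;; treeCm ;; initCm ;; clearCm ;; clearSlCm ;;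
  .loop xj (.add (.var xn) (.var xn)) nodeCm ;; foundCm ;; .set xans (.var xk)

/-- The number of table entries for the width `k`. -/
def tabSize (m k : ℕ) : ℕ := 2 ^ (91 * (m + (k + 1) + 1) ^ 2)

def stageTime (n m k : ℕ) : ℕ :=
  400 * (m + (k + 1) + 93) ^ 3 + 6000 * (tabSize m k + 2) ^ 2 + 20 * n + 50 +
    (2 * n + 2 * (n * m)) * (unitTime (tabSize m k) + 8)

lemma nodes_spec {m K N : ℕ} {σ : St} {Q : St → Prop} (hI : Inp A P I β W)
    (hm : ∀ j, (P.bagAt j).card ≤ m) (hp : Par n m K N σ) (h : Dp (n := n) K N m ∅ (fun _ _ => False) ∅ σ)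
    (hN : 2 ^ (91 * (m + K + 1) ^ 2) ≤ N) (hD : N + 1 ≤ D) (hDn : 2 * n ≤ D) (hW : N + 1 ≤ W)
    (hnW : n ≤ W)
    (hQ : ∀ τ, Par n m K N τ → Dp K N m Finset.univ G.Adj ∅ τ → Q τ) :
    Tm I β W D (.loop xj (.add (.var xn) (.var xn)) nodeCm) σ
      ((2 * n + 2 * (n * m)) * (unitTime N + 8) + 15) Q := by
  have e : (Ex.add (.var xn) (.var xn)).ev σ = 2 * n := by simp only [Ex.ev, hp.size]; omega
  -- The number of edge transitions at node `j`. Its sum is at most the total degree, and this makes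
  -- the time linear in `n`.
  set f : ℕ → ℕ := fun j => if h : j < 2 * n then
    if P.isIntro ⟨j, h⟩ = true then (A.nbrs (P.p ⟨j, h⟩)).length else 0 else 0 with hf
  refine (Tm.loop (fun j => unitTime N + f j * unitTime N) (fun j τ => Par n m K N τ ∧
    Dp K N m (P.seen j) (P.seenAdj j) (P.bagAt j) τ) ?_ (by rw [e]; omega) ?_ ?_).mono ?_ fun _ h => h
  · rw [P.seen_zero, P.seenAdj_zero, P.bagAt_zero]
    exact ⟨hp, h⟩
  · rw [e]
    intro j hj τ ⟨hp1, h1⟩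
    have hp2 : Par n m K N (τ.setv xj j) := hp1.fr ((Fr.refl [xj] [] τ).setv j)
    have h2 : Dp K N m (P.seen j) (P.seenAdj j) (P.bagAt j) (τ.setv xj j) := by
      obtain ⟨⟨sl, hs, hg⟩, hz, hl⟩ := h1
      exact ⟨⟨sl, hs.congr rfl rfl, hg⟩, hz, hl⟩
    refine (node_spec ⟨j, hj⟩ hI hm hp2 h2 (by simp) hN hD (by omega) hW hnW ?_).mono ?_ fun _ h => h
    · intro υ a b; exact ⟨a, b⟩
    · simp only [hf, dif_pos hj]
      split_ifs <;> omega
  · rw [e]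
    intro τ ⟨hp1, h1⟩
    refine hQ τ hp1 ?_
    have hb : P.bagAt (2 * n) = ∅ := by
      ext u
      rw [P.mem_bagAt]
      have := (P.outAt u).2
      simp
    rwa [P.seen_last, P.seenAdj_last, hb] at h1
  · rw [e]
    have h1 : ∑ j ∈ Finset.range (2 * n), f j ≤ 2 * (n * m) := by
      rw [Finset.sum_range]
      refine le_trans (le_of_eq ?_) ((P.sum_intro_le (f := fun v => (A.nbrs v).length)).trans
        (P.sum_deg_le hm A))
      refine Finset.sum_congr rfl fun j _ => ?_
      simp [hf]
    have h2 : ∑ i ∈ Finset.range (2 * n), (unitTime N + f i * unitTime N + 8) =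
        2 * n * (unitTime N + 8) + (∑ j ∈ Finset.range (2 * n), f j) * unitTime N := by
      simp only [Finset.sum_add_distrib, Finset.sum_const, Finset.card_range, smul_eq_mul,
        Finset.sum_mul]
      ring
    rw [h2]
    simp only [Ex.len]
    have h3 := Nat.mul_le_mul_right (unitTime N) h1
    nlinarith

lemma le_tabSize (m k : ℕ) : 2 ^ m ≤ tabSize m k ∧ m + (k + 1) + 92 ≤ tabSize m k := by
  have h1 := Nat.pow_le_pow_right (n := 2) (by omega) (le_exponent m (k + 1))
  have h2 : 91 + (m + (k + 1) + 1) ≤ 91 * (m + (k + 1) + 1) ^ 2 := by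
    have : 2 ≤ m + (k + 1) + 1 := by omega
    nlinarith
  have h3 : 91 * (m + (k + 1) + 1) ^ 2 < 2 ^ (91 * (m + (k + 1) + 1) ^ 2) := Nat.lt_two_pow_self
  unfold tabSize
  exact ⟨h1, by omega⟩

/-- At the end all vertices and edges have been seen, so the invariant `Good` for `Finset.univ` and
`G.Adj` says that some node is marked iff a sequence of bags with at most `k + 1` elements exists.
-/
lemma stage_spec {m k : ℕ} {σ : St} {Q : St → Prop} (hI : Inp A P I β W)
    (hm : ∀ j, (P.bagAt j).card ≤ m) (hn : σ.v xn = n) (hmx : σ.v xmx = m) (hk : σ.v xk = k)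
    (hkn : k < n) (hf : σ.v xfound = 0) (hD : tabSize m k + 1 ≤ D) (hDn : 2 * n ≤ D)
    (hW : (tabSize m k + 2) * (tabSize m k + 2) ≤ W) (hnW : n ≤ W)
    (hQ : ∀ τ, τ.v xn = n → τ.v xmx = m → τ.v xfound = ind (pathWidth G ≤ k) → τ.v xans = k → Q τ) :
    Tm I β W D stageCm σ (stageTime n m k) Q := by
  set N := tabSize m k with hNdef
  obtain ⟨hmN, hN92⟩ := le_tabSize m k
  rw [← hNdef] at hmN hN92
  have hNW : N + 2 ≤ W := by nlinarith
  have hN1 : 1 ≤ (N + 2) ^ 2 := Nat.one_le_pow _ _ (by omega)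
  suffices Tm I β W D stageCm σ (5 + (400 * (m + (k + 1) + 93) ^ 3 + (4400 * (N + 2) ^ 2 +
      (200 * (N + 2) ^ 2 + (200 * (N + 2) ^ 2 + (20 * n + 20 +
      ((2 * n + 2 * (n * m)) * (unitTime N + 8) + 15 + (200 * (N + 2) ^ 2 + 5)))))))) Q from
    this.mono (by unfold stageTime; rw [← hNdef]; omega) fun _ h => h
  have e0 : (Ex.add (.var xk) (.lit 1)).ev σ = k + 1 := by simp [Ex.ev, hk]
  refine Tm.seq ((Tm.set (by rw [e0]; omega) ?_).mono (by simp [Ex.len]) fun _ h => h)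
  rw [e0]
  set σ0 := σ.setv xK (k + 1) with hσ0
  have f0 : Fr [xK] [] σ σ0 := (Fr.refl _ _ _).setv _
  refine Tm.seq (T := 400 * (m + (k + 1) + 93) ^ 3) (((size_spec (m := m) (K := k + 1) (σ := σ0)
    (by rw [f0.1 _ (by decide), hmx]) (by simp [hσ0]) (by change N ≤ W; omega) ?_).timed (by omega)).mono
    (Nat.mul_le_mul (by decide) (by rfl)) fun _ h => h)
  intro σ1 f1 hN1'
  change σ1.v xN = N at hN1'
  have f01 : Fr [xK, xN, xi, xi', xe] [] σ σ1 := f0.trans f1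
  refine Tm.seq ((((tree_spec (σ := σ1) hN1' le_rfl hW fun τ h => h).and_frame (xs := [xt])
    (as := treeCm.wa) (by decide) (List.Subset.refl _)).mono ?_).unit (by omega))
  intro σ2 ⟨hT2, f2⟩
  have f02 : Fr [xK, xN, xi, xi', xe, xt] treeCm.wa σ σ2 :=
    f01.trans f2 (by decide) (by decide) (by decide) (List.Subset.refl _)
  have hp2 : Par n m (k + 1) N σ2 := by
    refine ⟨?_, ?_, ?_, hT2⟩
    · rw [f02.1 _ (by decide), hn]
    · rw [f02.1 _ (by decide), hmx]
    · rw [f2.1 _ (by decide), f1.1 _ (by decide)]; simp [hσ0]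
  refine Tm.seq (Tr.unit (N := N) (Tr.tab (fun t => if t = 1 then 1 else 0) hT2.size le_rfl ?_ ?_)
    (by omega))
  · intro i hi τ hf ht _ _
    refine ⟨?_, by split_ifs <;> omega⟩
    simp [ev_eqE, Ex.ev, tE, ht]
  intro σ3 f3 hR3
  have hp3 := hp2.fr f3
  refine Tm.seq (Tr.unit (N := N) (clear_spec hp3.mx (by omega) (by omega) ?_) (by omega))
  intro σ4 f4 hU4
  have hp4 := hp3.fr f4
  refine Tm.seq (clearSl_spec hp4.size (by omega) ?_)
  intro σ5 f5 hS5
  have hp5 := hp4.fr f5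
  have f25 : Fr [xt, xc, xi, xv] [aR, aUs, aSl] σ2 σ5 :=
    (f3.trans f4 (ys := [xt, xc, xi]) (bs := [aR, aUs])).trans f5
  have hR5 : ∀ t ≤ N, σ5.a aR t = if t = 1 then 1 else 0 := by
    rw [f5.2 _ (by decide), f4.2 _ (by decide)]; exact hR3
  have hd5 : Dp (n := n) (k + 1) N m ∅ (fun _ _ => False) ∅ σ5 := by
    refine ⟨⟨fun _ => 0, ⟨by simp, by simp, fun u => by simpa using hS5 u u.2, ?_⟩, ?_⟩, ?_, ?_⟩
    · intro i hi
      rw [f5.2 _ (by decide), hU4 i hi, ind_false (by simp)]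
    · refine (Good.init (K := k + 1) (N := N) (by omega) (fun _ => 0) (R := fun t => t = 1)
        fun t => Iff.rfl).congr ?_ fun _ => Iff.rfl
      intro t ht
      rw [hR5 t ht]
      split_ifs with h <;> simp [h]
    · rw [hR5 0 (by omega)]; simp
    · intro t ht
      rw [hR5 t ht]; split_ifs <;> omega
  refine Tm.seq (((nodes_spec hI hm hp5 hd5 le_rfl hD hDn (by omega) hnW fun τ h1 h2 =>
    (⟨h1, h2⟩ : Par n m (k + 1) N τ ∧ Dp (k + 1) N m Finset.univ G.Adj ∅ τ)).and_frame
    (xs := xj :: nodeCm.wv) (as := nodeCm.wa) (List.Subset.refl _) (List.Subset.refl _)).mono le_rfl ?_)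
  intro σ6 ⟨⟨hp6, hd6⟩, f6⟩
  have f06 : σ6.v xfound = 0 ∧ σ6.v xk = k := by
    constructor
    · rw [f6.1 _ (by decide), f25.1 _ (by decide), f02.1 _ (by decide), hf]
    · rw [f6.1 _ (by decide), f25.1 _ (by decide), f02.1 _ (by decide), hk]
  refine Tm.seq (Tr.unit (N := N) (found_spec hp6.tab.size f06.1 le_rfl (by omega) ?_) (by omega))
  intro σ7 f7 hf7
  have hk7 : (Ex.var xk).ev σ7 = k := (f7.1 xk (by decide)).trans f06.2
  refine (Tm.set (by rw [hk7]; omega) ?_).mono (by simp [Ex.len]) fun _ h => h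
  rw [hk7]
  have f8 : Fr [xans] [] σ7 (σ7.setv xans k) := (Fr.refl _ _ _).setv _
  have hp8 : Par n m (k + 1) N (σ7.setv xans k) := (hp6.fr f7).fr f8
  refine hQ _ hp8.size hp8.mx ?_ (by simp)
  rw [f8.1 _ (by decide), hf7]
  refine ind_congr ?_
  rw [pathWidth_le_iff P]
  obtain ⟨sl, _, hg⟩ := hd6.good
  constructor
  · rintro ⟨t, ht, hr⟩
    obtain ⟨l, hl, _⟩ := hg.sound t (by rintro rfl; rw [hd6.zero] at hr; omega) ht hr
    exact ⟨l, hl⟩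
  · rintro ⟨l, hl⟩
    obtain ⟨t, _, ht, hr, _⟩ := hg.complete l hl
    exact ⟨t, ht, hr⟩

end Loop

/-! ### The largest bag -/

namespace PathDecomposition

variable {n : ℕ} {G : SimpleGraph (Fin n)} (P : PathDecomposition G)

/-- The largest number of vertices in one of the first bags. -/
def maxBag (j : ℕ) : ℕ := (Finset.range (j + 1)).sup fun i => (P.bagAt i).card

lemma card_bagAt_le (j : ℕ) : (P.bagAt j).card ≤ P.maxBag (2 * n) := by
  by_cases h : j ≤ 2 * n
  · exact Finset.le_sup (f := fun i => (P.bagAt i).card) (by simp; omega)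
  · have : P.bagAt j = ∅ := by
      ext u
      rw [P.mem_bagAt]
      have := (P.outAt u).2
      simp only [Finset.notMem_empty, iff_false]; omega
    simp [this]

lemma maxBag_le (j : ℕ) : P.maxBag j ≤ P.width + 1 :=
  Finset.sup_le fun i _ => P.card_bagAfter_le i

lemma maxBag_succ (j : ℕ) : P.maxBag (j + 1) = max (P.maxBag j) (P.bagAt (j + 1)).card := by
  unfold maxBag
  rw [Finset.range_add_one, Finset.sup_insert, max_comm]

lemma pathWidth_lt (P : PathDecomposition G) (hn : 0 < n) : pathWidth G < n := by
  have h1 : pathWidth G ≤ P.width := Nat.sInf_le ⟨P, rfl⟩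
  have h2 : (Finset.univ.sup fun j : Fin (2 * n) => (P.bag j).card) ≤ n :=
    Finset.sup_le fun j _ => by simpa using Finset.card_le_univ (P.bag j)
  unfold width at h1
  omega

end PathDecomposition

/-! ### The search for the path-width -/

namespace Loop
open Tree

variable {I : ℕ → ℕ} {β W D : ℕ}
variable {n : ℕ} {G : SimpleGraph (Fin n)} {A : AdjacencyLists G} {P : PathDecomposition G}

/-- Computes the size of the largest bag. -/
def maxCm : Cm :=
  .loop xj (.add (.var xn) (.var xn)) (.rd xq (.add (.lit 2) (.add (.var xj) (.var xj))) ;;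
    .set xcur (.sub (.add (.var xcur) (.add (.var xq) (.var xq))) (.lit 1)) ;;
    .set xmx (.add (.var xmx) (.sub (.var xcur) (.var xmx))))

/-- The main program. -/
def mainCm : Cm :=
  .rd xn (.lit 0) ;; maxCm ;;
  .loop xk (.var xn) (.loop xi' (.sub (.lit 1) (.var xfound)) stageCm)

/-- The initial state. -/
def st0 : St := ⟨fun _ => 0, fun _ _ => 0⟩

def mainTime (n m k : ℕ) : ℕ := 100 * n + 100 + (k + 1) * stageTime n m k

lemma max_spec {σ : St} {Q : St → Prop} (hI : Inp A P I β W) (hn : σ.v xn = n) (h0 : σ.v xcur = 0)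
    (hmx : σ.v xmx = 0) (hD : 2 * n ≤ D) (hW : 2 * n + 2 ≤ W)
    (hQ : ∀ τ, Fr [xj, xq, xcur, xmx] [] σ τ → τ.v xmx = P.maxBag (2 * n) → Q τ) :
    Tm I β W D maxCm σ (60 * n + 20) Q := by
  have e : (Ex.add (.var xn) (.var xn)).ev σ = 2 * n := by simp only [Ex.ev, hn]; omega
  have hβ := hI.len
  have hcard : ∀ j, (P.bagAt j).card ≤ n := fun j => by simpa using Finset.card_le_univ (P.bagAt j)
  have hmxb : ∀ j, P.maxBag j ≤ n := fun j => Finset.sup_le fun i _ => hcard i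
  refine (Tm.loop (fun _ => 20) (fun j τ => Fr [xj, xq, xcur, xmx] [] σ τ ∧
    τ.v xcur = (P.bagAt j).card ∧ τ.v xmx = P.maxBag j) ?_ (by rw [e]; exact hD) ?_ ?_).mono ?_
    fun _ h => h
  · refine ⟨Fr.refl _ _ _, by rw [h0, P.bagAt_zero]; rfl, ?_⟩
    rw [hmx]; simp [PathDecomposition.maxBag, P.bagAt_zero]
  · rw [e]
    intro j hj τ ⟨h1, h2, h3⟩
    have e1 : (Ex.add (.lit 2) (.add (.var xj) (.var xj))).ev (τ.setv xj j) = 2 + (j + j) := by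
      simp [Ex.ev]
    refine (Tm.seq (T' := 14) (Tm.rd (by rw [e1]; omega) (by rw [e1]; exact hI.val _ (by omega)) ?_)).mono
      (by simp [Ex.len]) fun _ h => h
    rw [e1, hI.kind ⟨j, hj⟩]
    set q := if P.isIntro ⟨j, hj⟩ = true then 1 else 0 with hq
    -- The size changes by `2 * q - 1`, that is, by `+1` or `-1`. At a forget node the bag is
    -- nonempty before, so the truncated subtraction is exact.
    have e2 : (Ex.sub (.add (.var xcur) (.add (.var xq) (.var xq))) (.lit 1)).ev
        ((τ.setv xj j).setv xq q) = (P.bagAt (j + 1)).card := by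
      simp (decide := true) only [Ex.ev, St.setv_v, if_true, if_false, h2]
      by_cases hb : P.isIntro ⟨j, hj⟩ = true
      · have e3 := P.bagAt_intro hb
        have e4 := P.notMem_seen hb
        have e5 : P.p ⟨j, hj⟩ ∉ P.bagAt j := fun h => e4 (P.bagAt_subset _ h)
        simp only at e3
        rw [hq, if_pos hb, e3, Finset.card_insert_of_notMem e5]; rfl
      · have hb' : P.isIntro ⟨j, hj⟩ = false := by simpa using hb
        have e3 := P.bagAt_forget hb'
        simp only at e3
        rw [hq, if_neg hb, e3, Finset.card_erase_of_mem (P.mem_bagAt_forget hb')]; rfl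
    refine (Tm.seq (T' := 6) (Tm.set (by rw [e2]; have := hcard (j + 1); omega) ?_)).mono
      (by simp [Ex.len]) fun _ h => h
    rw [e2]
    have e6 : (Ex.add (.var xmx) (.sub (.var xcur) (.var xmx))).ev
        (((τ.setv xj j).setv xq q).setv xcur (P.bagAt (j + 1)).card) = P.maxBag (j + 1) := by
      simp (decide := true) only [Ex.ev, St.setv_v, if_true, if_false, h3]
      rw [P.maxBag_succ]; omega
    refine (Tm.set (by rw [e6]; have := hmxb (j + 1); omega) ?_).mono
      (by simp [Ex.len]) fun _ h => h
    rw [e6]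
    exact ⟨(((h1.setv _).setv _).setv _).setv _, by simp (decide := true), by simp⟩
  · rw [e]
    intro τ ⟨h1, _, h3⟩
    exact hQ τ h1 h3
  · rw [e]
    simp only [Ex.len, Finset.sum_const, Finset.card_range, smul_eq_mul]; omega

lemma tabSize_mono (m : ℕ) {k k' : ℕ} (h : k ≤ k') : tabSize m k ≤ tabSize m k' := by
  unfold tabSize
  exact Nat.pow_le_pow_right (by omega) (Nat.mul_le_mul_left _ (Nat.pow_le_pow_left (by omega) _))

lemma stageTime_mono (n m : ℕ) {k k' : ℕ} (h : k ≤ k') : stageTime n m k ≤ stageTime n m k' := by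
  have := tabSize_mono m h
  unfold stageTime unitTime
  gcongr

/-- Stages are executed only for `k ≤ pathWidth G`, and each is at most as expensive as the last
one. The remaining passes only test the flag. Since `pathWidth G < n`, trying `k < n` suffices. -/
lemma main_spec {m : ℕ} (hn : 0 < n) (hI : Inp A P I β W) (hm : m = P.maxBag (2 * n))
    (hD : tabSize m (pathWidth G) + 1 ≤ D) (hDn : 2 * n ≤ D)
    (hW : (tabSize m (pathWidth G) + 2) * (tabSize m (pathWidth G) + 2) ≤ W) (hnW : 2 * n + 2 ≤ W) :
    Tm I β W D mainCm st0 (mainTime n m (pathWidth G)) fun τ => τ.v xans = pathWidth G := by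
  have hβ := hI.len
  have hlt := P.pathWidth_lt hn
  set w := pathWidth G with hw
  suffices Tm I β W D mainCm st0 (2 + ((60 * n + 20) + (9 + 27 * n + (w + 1) * stageTime n m w)))
      fun τ => τ.v xans = w from this.mono (by unfold mainTime; omega) fun _ h => h
  refine Tm.seq ((Tm.rd (by simp only [Ex.ev]; omega) (hI.val _ (by simp only [Ex.ev]; omega)) ?_).mono
    (by simp [Ex.len]) fun _ h => h)
  rw [show (Ex.lit 0).ev st0 = 0 from rfl, hI.size]
  refine Tm.seq (max_spec hI (by simp) (by simp [st0]) (by simp [st0]) hDn hnW ?_)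
  rw [← hm]
  intro σ1 f1 hm1
  have hn1 : σ1.v xn = n := by rw [f1.1 _ (by decide)]; simp
  have hf1 : σ1.v xfound = 0 := by rw [f1.1 _ (by decide)]; simp [st0]
  have e1 : (Ex.var xn).ev σ1 = n := hn1
  -- Before pass `i` the flag tells whether `w < i`. It is set by stage `w`, after which `xans = w`
  -- is never changed. An idle pass costs `19 + 8`, whence `27 * n`.
  refine (Tm.loop (fun i => 19 + if i ≤ w then stageTime n m w else 0) (fun i τ => τ.v xn = n ∧
    τ.v xmx = m ∧ τ.v xfound = ind (w < i) ∧ (w < i → τ.v xans = w)) ?_ (by rw [e1]; omega) ?_ ?_).mono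
    ?_ fun _ h => h
  · exact ⟨hn1, hm1, by rw [hf1, ind_false (by omega)], fun h => absurd h (by omega)⟩
  · rw [e1]
    intro i hi τ ⟨h1, h2, h3, h4⟩
    refine Tm.when (p := ¬ w < i) (T := stageTime n m w) ?_ (by omega) ?_ ?_ ?_
    · simp (decide := true) only [Ex.ev, St.setv_v, if_false, h3]
      unfold ind; split_ifs <;> rfl
    · intro hwi
      have hiw : i ≤ w := by omega
      have t1 := tabSize_mono m hiw
      refine (stage_spec (k := i) hI (fun j => by rw [hm]; exact P.card_bagAt_le j) ?_ ?_ ?_ hi ?_ ?_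
        hDn ?_ (by omega) ?_).mono (stageTime_mono n m hiw) fun _ h => h
      · simpa (decide := true) using h1
      · simpa (decide := true) using h2
      · simp (decide := true)
      · simp (decide := true) only [St.setv_v, if_false, h3]
        exact ind_false hwi
      · omega
      · exact le_trans (Nat.mul_le_mul (by omega) (by omega)) hW
      · intro υ u1 u2 u3 u4
        refine ⟨u1, u2, ?_, fun h => ?_⟩
        · rw [u3]; exact ind_congr ⟨fun h => by omega, fun h => by omega⟩
        · omega
    · intro hwi
      have hwi : w < i := by omega
      refine ⟨by simpa (decide := true) using h1, by simpa (decide := true) using h2, ?_, fun _ => ?_⟩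
      · simp (decide := true) only [St.setv_v, if_false, h3]
        rw [ind_true hwi, ind_true (by omega)]
      · simpa (decide := true) using h4 hwi
    · simp only [Ex.len, ind_eq_one]
      split_ifs <;> omega
  · rw [e1]
    intro τ ⟨_, _, _, h4⟩
    exact h4 hlt
  · rw [e1]
    have h1 : ∑ i ∈ Finset.range n, (if i ≤ w then stageTime n m w else 0) ≤
        (w + 1) * stageTime n m w := by
      rw [← Finset.sum_filter, Finset.sum_const, smul_eq_mul]
      refine Nat.mul_le_mul_right _ ?_
      refine (Finset.card_le_card (t := Finset.range (w + 1)) fun i hi => ?_).trans (by simp)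
      simp only [Finset.mem_filter, Finset.mem_range] at hi ⊢
      omega
    simp only [Ex.len, Finset.sum_add_distrib, Finset.sum_const, Finset.card_range, smul_eq_mul]
    omega

/-! ### The input words -/

lemma getD_flatMap_pair {α : Type*} (f g : α → ℕ) (l : List α) (h : ℕ) : ∀ (i : ℕ) (hi : i < l.length),
    (l.flatMap fun j => [f j, g j]).getD (i + i) h = f l[i] ∧
    (l.flatMap fun j => [f j, g j]).getD (i + i + 1) h = g l[i] := by
  induction l with
  | nil => intro i hi; simp at hi
  | cons x l ih =>
    intro i hi
    cases i with
    | zero => simp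
    | succ i =>
      have := ih i (by simpa using hi)
      rw [show i + 1 + (i + 1) = i + i + 2 by omega]
      simpa using this

lemma length_flatMap_pair {α : Type*} (f g : α → ℕ) (l : List α) :
    (l.flatMap fun j => [f j, g j]).length = 2 * l.length := by
  induction l with
  | nil => rfl
  | cons x l ih => simp [ih]; omega

lemma getD_flatMap {α : Type*} (g : α → List ℕ) (l : List α) (h : ℕ) : ∀ (i e : ℕ) (hi : i < l.length)
    (he : e < (g l[i]).length),
    (l.flatMap g).getD (((l.take i).map fun x => (g x).length).sum + e) h = (g l[i])[e] := by
  induction l with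
  | nil => intro i e hi; simp at hi
  | cons x l ih =>
    intro i e hi he
    cases i with
    | zero =>
      simp only [List.getElem_cons_zero] at he
      simp [List.getD_eq_getElem?_getD, List.getElem?_append_left he, List.getElem?_eq_getElem he]
    | succ i =>
      have := ih i e (by simpa using hi) (by simpa using he)
      simp only [List.flatMap_cons, List.take_succ_cons, List.map_cons, List.sum_cons,
        List.getElem_cons_succ]
      rw [← this, add_assoc, List.getD_append_right _ _ _ _ (by omega), Nat.add_sub_cancel_left]

/-- The total length of the adjacency lists of the vertices below `i`. -/
def offset (A : AdjacencyLists G) (i : ℕ) : ℕ :=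
  ∑ v ∈ Finset.univ.filter (fun v : Fin n => (v : ℕ) < i), (A.nbrs v).length

lemma offset_succ (A : AdjacencyLists G) (v : Fin n) :
    offset A (v + 1) = offset A v + (A.nbrs v).length := by
  unfold offset
  have : Finset.univ.filter (fun u : Fin n => (u : ℕ) < v + 1) =
      insert v (Finset.univ.filter (fun u : Fin n => (u : ℕ) < v)) := by
    ext u
    simp only [Finset.mem_filter, Finset.mem_univ, true_and, Finset.mem_insert, Fin.ext_iff]
    omega
  rw [this, Finset.sum_insert (by simp), add_comm]

lemma offset_eq (A : AdjacencyLists G) : ∀ i ≤ n, offset A i =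
    (((List.finRange n).take i).map fun v => (A.nbrs v).length).sum
  | 0, _ => by simp [offset]
  | i + 1, h => by
    have h1 := offset_eq A i (by omega)
    have h2 := offset_succ A ⟨i, by omega⟩
    simp only at h2
    rw [h2, h1, List.take_add_one, List.getElem?_eq_getElem (by simpa using h)]
    simp

lemma inputWords_inp (A : AdjacencyLists G) (P : PathDecomposition G) :
    (inputWords A P).length = 5 * n + 2 + offset A n ∧
    (∀ i ≤ n, (inputWords A P).getD (4 * n + 1 + i) 0 = offset A i) ∧
    ∀ W, n ≤ W → 1 ≤ W → offset A n ≤ W →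
      Inp A P (fun i => (inputWords A P).getD i 0) (inputWords A P).length W := by
  set L1 := (List.finRange (2 * n)).flatMap
    (fun j => [(P.p j : ℕ), if P.isIntro j = true then 1 else 0]) with hL1
  set L2 := (List.range (n + 1)).map (offset A) with hL2
  set L3 := (List.finRange n).flatMap (fun v => (A.nbrs v).map Fin.val) with hL3
  have hw : inputWords A P = [n] ++ L1 ++ L2 ++ L3 := by
    -- Brings a coerced neighbour list, written as a monadic expression, into the form of a
    -- `List.map`.
    have h : ∀ l : List (Fin n), (do let a ← l; pure (a : ℕ)) = l.map Fin.val := fun l => by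
      induction l with
      | nil => rfl
      | cons x l ih => simpa using ih
    simp only [inputWords, h, List.map_id', hL1, hL2, hL3]
    rfl
  have l1 : L1.length = 4 * n := by rw [hL1, length_flatMap_pair, List.length_finRange]; omega
  have l2 : L2.length = n + 1 := by simp [hL2]
  have l3 : L3.length = offset A n := by
    rw [offset_eq A n le_rfl, hL3, List.length_flatMap, List.take_of_length_le (by simp)]
    simp
  have hlen : (inputWords A P).length = 5 * n + 2 + offset A n := by
    rw [hw]; simp only [List.length_append, l1, l2, l3, List.length_singleton]; omega
  have g1 : ∀ i < 4 * n, (inputWords A P).getD (1 + i) 0 = L1.getD i 0 := by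
    intro i hi
    rw [hw, List.append_assoc, List.append_assoc, List.getD_append_right _ _ _ _ (by simp),
      List.getD_append _ _ _ _ (by simp; omega)]
    congr 1
    simp
  have g2 : ∀ i ≤ n, (inputWords A P).getD (4 * n + 1 + i) 0 = offset A i := by
    intro i hi
    rw [hw, List.append_assoc, List.getD_append_right _ _ _ _ (by simp; omega),
      List.getD_append _ _ _ _ (by simp [l1, l2]; omega)]
    have : 4 * n + 1 + i - ([n] ++ L1).length = i := by
      simp only [List.length_append, List.length_singleton, l1]; omega
    rw [this, hL2, List.getD_eq_getElem _ _ (by simp; omega)]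
    simp
  have g3 : ∀ i, (inputWords A P).getD (5 * n + 2 + i) 0 = L3.getD i 0 := by
    intro i
    rw [hw, List.getD_append_right _ _ _ _ (by simp only [List.length_append, List.length_singleton, l1, l2]; omega)]
    congr 1
    simp [l1, l2]; omega
  refine ⟨hlen, g2, fun W hW hW1 hWo => ?_⟩
  have hmono : ∀ i ≤ n, offset A i ≤ offset A n := by
    intro i hi
    unfold offset
    refine Finset.sum_le_sum_of_subset fun u hu => ?_
    simp
  refine ⟨?_, ?_, ?_, ?_, ?_, ?_, by omega, ?_⟩
  · rw [hw]; rfl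
  · intro j
    have := j.2
    rw [g1 _ (by omega)]
    simpa using (getD_flatMap_pair (fun j => (P.p j : ℕ)) (fun j => if P.isIntro j = true then 1 else 0)
      (List.finRange (2 * n)) 0 j (by simp)).1
  · intro j
    have := j.2
    rw [show 2 + ((j : ℕ) + j) = 1 + (j + j + 1) by omega, g1 _ (by omega)]
    simpa using (getD_flatMap_pair (fun j => (P.p j : ℕ)) (fun j => if P.isIntro j = true then 1 else 0)
      (List.finRange (2 * n)) 0 j (by simp)).2
  · intro v
    have := v.2
    rw [g2 _ (by omega), show 4 * n + 2 + (v : ℕ) = 4 * n + 1 + (v + 1) by omega, g2 _ (by omega),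
      offset_succ]
  · intro v e he
    have := v.2
    rw [g2 _ (by omega), add_assoc, g3, offset_eq A v (by omega)]
    have := getD_flatMap (fun v => (A.nbrs v).map Fin.val) (List.finRange n) 0 v e (by simp)
      (by simpa using he)
    simpa using this
  · intro v
    have := v.2
    rw [g2 _ (by omega), hlen]
    have := hmono (v + 1) (by omega)
    rw [offset_succ] at this
    omega
  · intro i hi
    rw [hlen] at hi
    rcases Nat.eq_zero_or_pos i with rfl | h0
    · rw [hw]; exact hW
    by_cases h1 : i < 4 * n + 1
    · have e : i = 1 + (i - 1) := by omega
      rw [e, g1 _ (by omega)]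
      have hmem : L1.getD (i - 1) 0 ∈ L1 := by
        rw [List.getD_eq_getElem _ _ (by omega)]; exact List.getElem_mem _
      rw [hL1, List.mem_flatMap] at hmem
      obtain ⟨j, _, hj⟩ := hmem
      rw [← hL1] at hj
      simp only [List.mem_cons, List.not_mem_nil, or_false] at hj
      have := (P.p j).2
      rcases hj with hj | hj <;> rw [hj]
      · omega
      · split_ifs <;> omega
    by_cases h2 : i < 5 * n + 2
    · have e : i = 4 * n + 1 + (i - (4 * n + 1)) := by omega
      rw [e, g2 _ (by omega)]
      exact (hmono _ (by omega)).trans hWo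
    · have e : i = 5 * n + 2 + (i - (5 * n + 2)) := by omega
      rw [e, g3]
      have hmem : L3.getD (i - (5 * n + 2)) 0 ∈ L3 := by
        rw [List.getD_eq_getElem _ _ (by omega)]; exact List.getElem_mem _
      rw [hL3, List.mem_flatMap] at hmem
      obtain ⟨v, _, hv⟩ := hmem
      rw [List.mem_map] at hv
      obtain ⟨u, _, hu⟩ := hv
      rw [← hL3] at hu
      rw [← hu]
      have := u.2
      omega

end Loop

/-! ### The complete program -/

namespace Loop
open RAM

/-- Computes the length of the input in register `2`. -/
def prologue : List Instr :=
  [.load 1 1, .add 4 1 1, .add 4 4 4, .add 4 4 1, .const 7 1, .add 10 4 7, .load 10 10,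
    .add 4 4 7, .add 4 4 7, .add 2 4 10]

/-- The complete program. -/
def program : Program := prologue ++ (mainCm.code 0 10 ++ [.move 0 (regV xans)])

/-- The last offset, stored at `5 * n + 1`, is the total length of the adjacency lists. Register `2`
is `regH 0`, the base address of the arrays. The other registers used are temporaries, so all
variables are still `0`. -/
lemma prologue_run {B n o : ℕ} {mem : ℕ → ℕ} (h0 : mem 0 = n) (h1 : mem (5 * n + 1) = o)
    (hmem : ∀ i, mem i ≤ B) (hB : 5 * n + 2 + o ≤ B) :
    ∃ reg, Steps program B ⟨0, fun _ => 0, mem⟩ 10 ⟨10, reg, mem⟩ ∧ reg 2 = 5 * n + 2 + o ∧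
      ∀ x, reg (3 * x + 3) = 0 := by
  have hb : CBdd B ⟨0, fun _ => 0, mem⟩ := fun i => ⟨Nat.zero_le _, hmem i⟩
  have s1 := Steps.one (prog := program) (c := ⟨0, fun _ => 0, mem⟩) hb (ins := .load 1 1) rfl
    (hb.reg (hmem _))
  have s2 := Steps.one (prog := program) s1.bdd (ins := .add 4 1 1) rfl
    (s1.bdd.reg (by simp [Instr.exec, h0]; omega))
  have s3 := Steps.one (prog := program) s2.bdd (ins := .add 4 4 4) rfl
    (s2.bdd.reg (by simp [Instr.exec, h0]; omega))
  have s4 := Steps.one (prog := program) s3.bdd (ins := .add 4 4 1) rfl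
    (s3.bdd.reg (by simp [Instr.exec, h0]; omega))
  have s5 := Steps.one (prog := program) s4.bdd (ins := .const 7 1) rfl
    (s4.bdd.reg (by omega))
  have s6 := Steps.one (prog := program) s5.bdd (ins := .add 10 4 7) rfl
    (s5.bdd.reg (by simp [Instr.exec, h0]; omega))
  have s7 := Steps.one (prog := program) s6.bdd (ins := .load 10 10) rfl
    (s6.bdd.reg (hmem _))
  have s8 := Steps.one (prog := program) s7.bdd (ins := .add 4 4 7) rfl
    (s7.bdd.reg (by simp [Instr.exec, h0]; omega))
  have s9 := Steps.one (prog := program) s8.bdd (ins := .add 4 4 7) rfl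
    (s8.bdd.reg (by simp [Instr.exec, h0]; omega))
  have e : n + n + (n + n) + n + 1 = 5 * n + 1 := by omega
  have s10 := Steps.one (prog := program) s9.bdd (ins := .add 2 4 10) rfl
    (s9.bdd.reg (by simp [Instr.exec, h0, e, h1]; omega))
  refine ⟨_, ((((((((s1.trans s2).trans s3).trans s4).trans s5).trans s6).trans s7).trans s8).trans
    s9).trans s10, ?_, ?_⟩
  · simp [Instr.exec, h0, e, h1]
  · intro x
    have a1 : 3 * x + 3 ≠ 1 := by omega
    have a2 : 3 * x + 3 ≠ 4 := by omega
    have a3 : 3 * x + 3 ≠ 7 := by omega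
    have a4 : 3 * x + 3 ≠ 10 := by omega
    have a5 : 3 * x + 3 ≠ 2 := by omega
    simp [Instr.exec, a1, a2, a3, a4, a5]

/-- The memory behind the input is `0`, hence it represents the empty arrays of `st0`. The summand
`11` covers the ten instructions of the prologue and the final move to the output register. -/
lemma program_computes {input : List ℕ} {n o W D B T k : ℕ} (h0 : input.getD 0 0 = n)
    (h1 : input.getD (5 * n + 1) 0 = o) (hlen : input.length = 5 * n + 2 + o)
    (hm : Tm (fun i => input.getD i 0) input.length W D mainCm st0 T fun τ => τ.v xans = k)
    (hv : ∀ i < input.length, input.getD i 0 ≤ W) (hW : 1 ≤ W) (hDW : D ≤ W)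
    (hB : input.length + 32 * (mainCm.wt * W) + 32 + mainCm.wt + W + 1 ≤ B) (hT : T + 11 ≤ B) :
    ComputesWithin program input k B := by
  have hmem : ∀ i, input.getD i 0 ≤ B := by
    intro i
    by_cases hi : i < input.length
    · have := hv i hi; omega
    · rw [List.getD_eq_default _ _ (by omega)]; omega
  obtain ⟨reg, r1, r2, r3⟩ := prologue_run (B := B) (mem := fun i => input.getD i 0) h0 h1 hmem (by omega)
  have hcode : CodeAt program 10 (mainCm.code 0 10) := by
    intro i hi
    unfold program
    rw [List.getElem?_append_right (by simp [prologue]),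
      List.getElem?_append_left (by simpa [prologue] using hi)]
    simp [prologue]
  have hmatch : Match input.length (fun i => input.getD i 0) st0 reg (fun i => input.getD i 0) := by
    refine ⟨fun x => r3 x, by rw [hlen]; exact r2, fun _ _ => rfl, fun A i => ?_⟩
    exact List.getD_eq_default _ _ (by omega)
  obtain ⟨t, ht, reg', mem', s, hmatch', -⟩ := mainCm.code_run hW hDW hB 0 10 st0 reg _ le_rfl hcode
    r1.bdd ⟨fun _ => Nat.zero_le _, fun _ _ => Nat.zero_le _⟩ hm.1 hmatch
  have hlast : program[10 + mainCm.len]? = some (.move 0 (regV xans)) := by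
    unfold program
    rw [List.getElem?_append_right (by simp [prologue]),
      List.getElem?_append_right (by simp [prologue, Cm.code_length])]
    simp [prologue, Cm.code_length]
  have s' := Steps.one s.bdd hlast (s.bdd.reg (s.bdd _).1)
  have tot := (r1.trans s).trans s'
  have hrun : ∀ u, run program input u = (step program)^[u] ⟨0, fun _ => 0, fun i => input.getD i 0⟩ :=
    fun u => rfl
  refine ⟨10 + t + 1, by have := hm.2.1; omega, ?_, ?_, ?_⟩
  · rw [hrun, tot.1]
    simp [Instr.exec, program, prologue, Cm.code_length]; omega
  · rw [hrun, tot.1]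
    simp only [Instr.exec, Function.update_self]
    rw [hmatch'.vars]
    exact hm.2.2
  · intro u hu i
    rw [hrun]
    exact tot.2 u hu i

/-! ### The resource bounds -/

/-- With `X = tabSize m k + 2`, a transition costs `O(X ^ 2)`, and there are `O(n * X)` of them
because `m < X`. -/
lemma stageTime_le {n m k : ℕ} (hn : 1 ≤ n) :
    stageTime n m k ≤ 12700 * (n * (tabSize m k + 2) ^ 3) := by
  obtain ⟨-, h⟩ := le_tabSize m k
  unfold stageTime unitTime
  obtain ⟨X, hX⟩ : ∃ X, X = tabSize m k + 2 := ⟨_, rfl⟩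
  rw [← hX]
  have hX0 : 0 < X := by omega
  have h1 : (m + (k + 1) + 93) ^ 3 ≤ X ^ 3 := Nat.pow_le_pow_left (by omega) 3
  have hX1 : 1 ≤ X := by omega
  have h2 : X ^ 2 ≤ n * X ^ 3 := by
    calc X ^ 2 ≤ X ^ 3 := Nat.pow_le_pow_right hX1 (by omega)
      _ ≤ n * X ^ 3 := Nat.le_mul_of_pos_left _ hn
  have h3 : n ≤ n * X ^ 3 := Nat.le_mul_of_pos_right _ (pow_pos hX0 _)
  have h4 : X ^ 3 ≤ n * X ^ 3 := Nat.le_mul_of_pos_left _ hn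
  have h5 : (2 * n + 2 * (n * m)) * (3000 * X ^ 2 + 100 + 8) ≤ 2 * n * X * (3108 * X ^ 2) := by
    refine Nat.mul_le_mul ?_ ?_
    · have : n * (m + 1) ≤ n * X := Nat.mul_le_mul_left _ (by omega)
      nlinarith
    · have : 1 ≤ X ^ 2 := Nat.one_le_pow _ _ (by omega)
      omega
  have h6 : 2 * n * X * (3108 * X ^ 2) = 6216 * (n * X ^ 3) := by ring
  omega

lemma mainTime_le {n m k : ℕ} (hn : 1 ≤ n) :
    mainTime n m k ≤ 12900 * (n * (tabSize m k + 2) ^ 4) := by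
  obtain ⟨-, h⟩ := le_tabSize m k
  have h1 := stageTime_le (m := m) (k := k) hn
  unfold mainTime
  obtain ⟨X, hX⟩ : ∃ X, X = tabSize m k + 2 := ⟨_, rfl⟩
  rw [← hX] at h1 ⊢
  have hX0 : 0 < X := by omega
  have h2 : (k + 1) * stageTime n m k ≤ X * (12700 * (n * X ^ 3)) := Nat.mul_le_mul (by omega) h1
  have h3 : n ≤ n * X ^ 4 := Nat.le_mul_of_pos_right _ (pow_pos hX0 _)
  have h4 : X * (12700 * (n * X ^ 3)) = 12700 * (n * X ^ 4) := by ring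
  omega

/-- Since `(k + 1) ^ 2 ≤ 2 * (k ^ 2 + 1)`, the exponent splits into a multiple of `k ^ 2` and a
constant that depends on `c` only; the latter is needed for `k = 0`. -/
lemma tabSize_le {c m k : ℕ} (hm : m ≤ c * (k + 1) + 1) :
    tabSize m k + 2 ≤ 2 ^ (182 * (c + 3) ^ 2 * (k ^ 2 + 1) + 2) := by
  have h1 : m + (k + 1) + 1 ≤ (c + 3) * (k + 1) := by nlinarith
  have h2 : (m + (k + 1) + 1) ^ 2 ≤ (c + 3) ^ 2 * (2 * (k ^ 2 + 1)) := by
    calc (m + (k + 1) + 1) ^ 2 ≤ ((c + 3) * (k + 1)) ^ 2 := Nat.pow_le_pow_left h1 2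
      _ = (c + 3) ^ 2 * (k + 1) ^ 2 := by ring
      _ ≤ (c + 3) ^ 2 * (2 * (k ^ 2 + 1)) := by
        refine Nat.mul_le_mul_left _ ?_
        zify
        nlinarith [sq_nonneg ((k : ℤ) - 1)]
  have h3 : tabSize m k ≤ 2 ^ (182 * (c + 3) ^ 2 * (k ^ 2 + 1)) := by
    unfold tabSize
    refine Nat.pow_le_pow_right (by omega) ?_
    calc 91 * (m + (k + 1) + 1) ^ 2 ≤ 91 * ((c + 3) ^ 2 * (2 * (k ^ 2 + 1))) := Nat.mul_le_mul_left _ h2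
      _ = 182 * (c + 3) ^ 2 * (k ^ 2 + 1) := by ring
  have h4 : 1 ≤ 2 ^ (182 * (c + 3) ^ 2 * (k ^ 2 + 1)) := Nat.one_le_two_pow
  rw [pow_add]
  omega

end Loop

/-! ### The final choice of constants -/

open Loop in
theorem corollary1 :
    ∃ prog : RAM.Program, ∀ c : ℕ, ∃ C : ℕ,
      ∀ (n : ℕ) (_ : 0 < n) (G : SimpleGraph (Fin n)) (A : AdjacencyLists G)
        (P : PathDecomposition G),
        P.width ≤ c * (pathWidth G + 1) →
        RAM.ComputesWithin prog (inputWords A P) (pathWidth G)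
          (C * 2 ^ (C * pathWidth G ^ 2) * n) := by
  refine ⟨program, fun c => ?_⟩
  obtain ⟨S, hS⟩ : ∃ S, S = mainCm.wt := ⟨_, rfl⟩
  obtain ⟨a, ha⟩ : ∃ a, a = 182 * (c + 3) ^ 2 := ⟨_, rfl⟩
  -- This constant has to serve as a factor and in the exponent. From `X ≤ 2 ^ (a * (k ^ 2 + 1) +
  -- 2)` follows `X ^ 4 ≤ 2 ^ (4 * (a + 2)) * 2 ^ (4 * a * k ^ 2)`, so the first summand is the
  -- factor and `4 * a` the coefficient in the exponent.
  refine ⟨(20000 + 400 * S) * 2 ^ (4 * (a + 2)) + 4 * a, fun n hn G A P hP => ?_⟩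
  obtain ⟨k, hk⟩ : ∃ k, k = pathWidth G := ⟨_, rfl⟩
  obtain ⟨m, hm⟩ : ∃ m, m = P.maxBag (2 * n) := ⟨_, rfl⟩
  rw [← hk] at hP ⊢
  have hmc : m ≤ c * (k + 1) + 1 := hm.le.trans ((P.maxBag_le _).trans (by omega))
  obtain ⟨X, hX⟩ : ∃ X, X = tabSize m k + 2 := ⟨_, rfl⟩
  have hXle : X ≤ 2 ^ (a * (k ^ 2 + 1) + 2) := by rw [hX, ha]; exact tabSize_le hmc
  have hX0 : 0 < X := by omega
  obtain ⟨-, hN92⟩ := le_tabSize m k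
  have hdeg : offset A n ≤ 2 * (n * m) := by
    have := P.sum_deg_le P.card_bagAt_le A
    rw [← hm] at this
    refine le_trans (Finset.sum_le_sum_of_subset (Finset.filter_subset _ _)) this
  obtain ⟨i1, i2, i3⟩ := inputWords_inp A P
  -- The summands bound the indices of pairs of table entries, the numbers of vertices and nodes,
  -- and the offsets of the adjacency lists.
  obtain ⟨W, hW⟩ : ∃ W, W = X * X + 2 * n + 2 * (n * m) := ⟨_, rfl⟩
  have hXX : X ≤ X * X := Nat.le_mul_self X
  have hI := i3 W (by omega) (by omega) (by omega)
  have hmain := main_spec (D := X + 2 * n) (W := W) (m := m) hn hI hm (by rw [← hk]; omega) (by omega)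
    (by rw [← hk, ← hX]; omega) (by omega)
  rw [← hk] at hmain
  have hnm : n * m ≤ n * X := Nat.mul_le_mul_left _ (by omega)
  have hW4 : W ≤ 5 * (n * X ^ 4) := by
    have h1 : X * X ≤ n * X ^ 4 := by
      calc X * X = X ^ 2 := by ring
        _ ≤ X ^ 4 := Nat.pow_le_pow_right (by omega) (by omega)
        _ ≤ n * X ^ 4 := Nat.le_mul_of_pos_left _ hn
    have h2 : n ≤ n * X ^ 4 := Nat.le_mul_of_pos_right _ (pow_pos hX0 _)
    have h3 : n * X ≤ n * X ^ 4 := Nat.mul_le_mul_left _ (Nat.le_self_pow (by omega) X)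
    omega
  have hn4 : n ≤ n * X ^ 4 := Nat.le_mul_of_pos_right _ (pow_pos hX0 _)
  have hbig : (20000 + 400 * S) * (n * X ^ 4) ≤
      ((20000 + 400 * S) * 2 ^ (4 * (a + 2)) + 4 * a) *
        2 ^ (((20000 + 400 * S) * 2 ^ (4 * (a + 2)) + 4 * a) * k ^ 2) * n := by
    have h1 : X ^ 4 ≤ 2 ^ (4 * (a + 2)) * 2 ^ (4 * a * k ^ 2) := by
      calc X ^ 4 ≤ (2 ^ (a * (k ^ 2 + 1) + 2)) ^ 4 := Nat.pow_le_pow_left hXle 4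
        _ = 2 ^ (4 * (a + 2)) * 2 ^ (4 * a * k ^ 2) := by rw [← pow_mul, ← pow_add]; congr 1; ring
    have h2 : 2 ^ (4 * a * k ^ 2) ≤
        2 ^ (((20000 + 400 * S) * 2 ^ (4 * (a + 2)) + 4 * a) * k ^ 2) :=
      Nat.pow_le_pow_right (by omega) (Nat.mul_le_mul_right _ (Nat.le_add_left _ _))
    calc (20000 + 400 * S) * (n * X ^ 4)
        ≤ (20000 + 400 * S) * (n * (2 ^ (4 * (a + 2)) * 2 ^ (4 * a * k ^ 2))) := by gcongr
      _ = (20000 + 400 * S) * 2 ^ (4 * (a + 2)) * 2 ^ (4 * a * k ^ 2) * n := by ring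
      _ ≤ _ := by
        refine Nat.mul_le_mul_right _ (Nat.mul_le_mul (Nat.le_add_right _ _) h2)
  have hT := mainTime_le (m := m) (k := k) (n := n) hn
  rw [← hX] at hT
  have hSW : S * W ≤ S * (5 * (n * X ^ 4)) := Nat.mul_le_mul_left _ hW4
  have hn1 : 1 ≤ n * X ^ 4 := le_trans hn hn4
  have hS1 : S ≤ S * (n * X ^ 4) := Nat.le_mul_of_pos_right _ hn1
  have hsum : (20000 + 400 * S) * (n * X ^ 4) = 20000 * (n * X ^ 4) + 400 * (S * (n * X ^ 4)) := by ring
  have hSW' : S * (5 * (n * X ^ 4)) = 5 * (S * (n * X ^ 4)) := by ring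
  refine program_computes hI.size (o := offset A n) ?_ i1 hmain hI.val (by omega) (by omega) ?_ ?_
  · have := i2 n le_rfl
    rwa [show 4 * n + 1 + n = 5 * n + 1 by omega] at this
  · refine le_trans ?_ hbig
    rw [i1, hsum, ← hS]
    have : 2 * (n * m) ≤ W := by omega
    omega
  · refine le_trans ?_ hbig
    rw [hsum]
    omega
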